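/- Let $R$ be a Dedekind domain with $\operatorname{char}(R)\neq 3$ and fraction field $K$, and let $\mathfrak a$ be a nonzero fractional ideal of $R$. Let $V_{\mathfrak a}$ be the set of binary cubic forms $ax^3+3bx^2y+3cxy^2+dy^3$ with $a\in\mathfrak a$, $b\in R$, $c\in\mathfrak a^{-1}$, $d\in\mathfrak a^{-2}$. The group $\mathrm{GL}(R\oplus\mathfrak a)$ of matrices $\begin{pmatrix}r&s\\t&u\end{pmatrix}$ with $r,u\in R$, $s\in\mathfrak a$, $t\in\mathfrak a^{-1}$, $ru-st\in R^\times$ acts on $V_{\mathfrak a}$ by $(g\cdot f)(x,y)=\det(g)^{-1}f((x,y)g)$. Let $\mathrm{disc}(f)=-\frac1{27}\mathrm{Disc}(f)=a^2d^2-6abcd-3b^2c^2+4ac^3+4b^3d$, and call $f$ (and its orbit) nondegenerate if $\mathrm{disc}(f)\neq0$. Call $f$ projective if no prime ideal of $R$ divides all three of $(b^2-ac)R$, $(ad-bc)\mathfrak a$, $(c^2-bd)\mathfrak a^2$. A lattice $M=\mathfrak b_1v_1+\dots+\mathfrak b_nv_n$ (with $v_1,\dots,v_n$ linearly independent over $K$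 and $\mathfrak b_i$ nonzero fractional ideals of $R$) has Steinitz class $\mathrm{St}(M)=[\mathfrak b_1\cdots\mathfrak b_n]$. A quadratic ring $S$ over $R$ is a commutative $R$-algebra that is finitely generated and torsion-free of rank $2$ as an $R$-module; put $L=S\otimes_RK$. It is nondegenerate if the trace form of $L/K$ is nondegenerate. If $S=\mathfrak b_1\xi_1+\mathfrak b_2\xi_2$ is a decomposition as above, its discriminant ideal is $(\mathfrak b_1\mathfrak b_2)^2\det(\mathrm{Tr}(\xi_i\xi_j))$. A fractional ideal of $S$ is a finitely generated $S$-submodule of $L$ spanning $L$ over $K$; it is invertible if its product with some fractional ideal is $S$. The module index $[S:I]$ of a fractional ideal $I$ is the intersection over the primes $\mathfrak p$ of $R$ of the principal $R_{(\mathfrak p)}$-modules $\det(g_{\mathfrak p})R_{(\mathfrak p)}\subset K$, where $g_{\mathfrak p}$ is any $K$-automorphism of $L$ with $g_{\mathfrak p}(S_{(\mathfrak p)})=I_{(\mathfrak p)}$. Consider quadruples $(S,I,\delta,s)$ where $S$ is a nondegenerate quadratic ring over $R$, $I$ is a fractional ideal of $S$, $\delta\in L^\times$, $s\in K^\times$,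 such that $\mathrm{St}(I)=[\mathfrak a]=\mathrm{St}(S)$, $I^3\subset\delta S$, $[S:I]=sR$ and $s^3=N_{L/K}(\delta)$. Write $(S,I,\delta,s)\approx(S',I',\delta',s')$ if there are an isomorphism $\phi\colon S\to S'$ of $R$-algebras and $\kappa\in S'\otimes_RK$ with $I'=\kappa\phi(I)$, $\delta'=\kappa^3\phi(\delta)$ and $s'=N(\kappa)s$. Then there is a bijection $\Phi$ from the set of $\approx$-classes of such quadruples to the set of nondegenerate $\mathrm{GL}(R\oplus\mathfrak a)$-orbits on $V_{\mathfrak a}$, characterized as follows: $f$ lies in the orbit $\Phi(S,I,\delta,s)$ if and only if there are a $K$-bilinear alternating form $\pi$ on $L$ restricting to an isomorphism $\bigwedge^2S\to\mathfrak a$ and $K$-linearly independent $\alpha,\beta\in L$ with $I=R\alpha+\mathfrak a\beta$ and $\pi(\alpha\wedge\beta)=s$, such that $f(x,y)=\pi\bigl(1\wedge(\alpha x+\beta y)^3\delta^{-1}\bigr)$. Moreover, if $f$ lies in the orbit $\Phi(S,I,\delta,s)$, then $\mathrm{disc}(f)\,\mathfrak a^2$ is the discriminant ideal of $S$, and $f$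 is projective if and only if $I$ is invertible. -/

import Mathlib

open scoped TensorProduct nonZeroDivisors

universe u v

noncomputable section

set_option linter.unusedSectionVars false

namespace TripSymCubic

/-! ## Lattices over a Dedekind domain -/

section Lattices

variable {R : Type u} [CommRing R] [IsDedekindDomain R]
  {K : Type v} [Field K] [Algebra R K] [IsFractionRing R K]
  {V : Type*} [AddCommGroup V] [Module K V] [Module R V] [IsScalarTower R K V]

/-- `M = 𝔟₁ v₁ + ⋯ + 𝔟ₙ vₙ` inside the `K`-vector space `V`, with `v₁, …, vₙ` linearly
independent over `K` and `𝔟₁, …, 𝔟ₙ` nonzero fractional ideals: a Steinitz decomposition of the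
lattice `M`. -/
def IsSteinitzDecomp {n : ℕ} (M : Submodule R V) (𝔟 : Fin n → (FractionalIdeal R⁰ K)ˣ)
    (v : Fin n → V) : Prop :=
  LinearIndependent K v ∧
    M = ⨆ i, Submodule.map ((LinearMap.toSpanSingleton K V (v i)).restrictScalars R)
      ((𝔟 i : FractionalIdeal R⁰ K) : Submodule R K)

variable (K) in
/-- The Steinitz class of the lattice `M ⊆ V` is `c`: the class of `𝔟₁ ⋯ 𝔟ₙ` for a Steinitz
decomposition `M = 𝔟₁ v₁ + ⋯ + 𝔟ₙ vₙ`. -/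
def HasSteinitzClass (M : Submodule R V) (c : ClassGroup R) : Prop :=
  ∃ (n : ℕ) (𝔟 : Fin n → (FractionalIdeal R⁰ K)ˣ) (v : Fin n → V),
    IsSteinitzDecomp M 𝔟 v ∧ ClassGroup.mk K (∏ i, 𝔟 i) = c

/-- The localization `M₍𝔭₎` of a lattice `M ⊆ V`, as an `R`-submodule of the `K`-vector space `V`:
all `x` with `r x ∈ M` for some `r ∉ 𝔭`. -/
def localAt {W : Type*} [AddCommGroup W] [Module R W] (p : PrimeSpectrum R) (M : Submodule R W) :
    Submodule R W where
  carrier := {x | ∃ r : R, r ∉ p.asIdeal ∧ r • x ∈ M}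
  zero_mem' := ⟨1, p.isPrime.one_notMem, by simp⟩
  add_mem' := by
    rintro x y ⟨r, hr, hx⟩ ⟨t, ht, hy⟩
    refine ⟨r * t, fun h => (p.isPrime.mem_or_mem h).elim hr ht, ?_⟩
    rw [smul_add]
    refine M.add_mem ?_ ?_
    · rw [mul_comm, mul_smul]
      exact M.smul_mem t hx
    · rw [mul_smul]
      exact M.smul_mem r hy
  smul_mem' := by
    rintro c x ⟨r, hr, hx⟩
    exact ⟨r, hr, by rw [smul_comm]; exact M.smul_mem c hx⟩

variable (K) in
/-- The module index `[M : N]_R ⊆ K` of two lattices of full rank in `V`: the intersection over the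
primes `𝔭` of the local indices `det(g) R₍𝔭₎`, where `g` is any `K`-linear automorphism of `V` that
maps `M₍𝔭₎` onto `N₍𝔭₎` (the local index does not depend on the choice of `g`). -/
def moduleIndex (M N : Submodule R V) : Submodule R K :=
  ⨅ (p : PrimeSpectrum R) (g : V ≃ₗ[K] V)
    (_ : (localAt p M).map ((g : V →ₗ[K] V).restrictScalars R) = localAt p N),
    localAt p (Submodule.span R {LinearMap.det (g : V →ₗ[K] V)})

end Lattices

/-! ## Quadratic rings and their fractional ideals -/

section Rings

variable (R : Type u) [CommRing R] [IsDedekindDomain R]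
  (K : Type v) [Field K] [Algebra R K] [IsFractionRing R K]
  (S : Type*) [CommRing S] [Algebra R S]

/-- The image of `S` in its ambient `K`-algebra `L = K ⊗ S`. -/
def ringLattice : Submodule R (K ⊗[R] S) :=
  LinearMap.range (Algebra.TensorProduct.includeRight : S →ₐ[R] K ⊗[R] S).toLinearMap

variable {R K S}

/-- `I` is a fractional ideal of `S`: a finitely generated `S`-submodule of `L = K ⊗ S` that spans
`L` over `K`. (For `S` finite over `R`, finite generation over `S` and over `R` agree.) -/
structure IsFracIdeal (I : Submodule R (K ⊗[R] S)) : Prop where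
  smul_mem : ∀ (x : S), ∀ y ∈ I, ((1 : K) ⊗ₜ[R] x) * y ∈ I
  fg : I.FG
  span_eq_top : Submodule.span K (I : Set (K ⊗[R] S)) = ⊤

/-- The fractional ideal `I` of `S` is invertible: `I J = S` for some fractional ideal `J`. -/
def IsInvertibleIdeal (I : Submodule R (K ⊗[R] S)) : Prop :=
  ∃ J : Submodule R (K ⊗[R] S), IsFracIdeal J ∧ I * J = ringLattice R K S

/-- The submodule `x M` of `L`, for `x ∈ L`. -/
def scale (x : K ⊗[R] S) (M : Submodule R (K ⊗[R] S)) : Submodule R (K ⊗[R] S) :=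
  M.map (LinearMap.mulLeft R x)

variable (K) in
/-- The `K`-algebra isomorphism `L ≃ L'` induced by an isomorphism `S ≃ S'`. -/
def extendEquiv {S' : Type*} [CommRing S'] [Algebra R S'] (φ : S ≃ₐ[R] S') :
    (K ⊗[R] S) ≃ₐ[K] (K ⊗[R] S') :=
  Algebra.TensorProduct.congr AlgEquiv.refl φ

/-- `D` is the discriminant ideal of `S`: it equals `(𝔟₁ ⋯ 𝔟ₙ)² det(Tr(ξᵢ ξⱼ))` for every Steinitz
decomposition `S = 𝔟₁ ξ₁ + ⋯ + 𝔟ₙ ξₙ`, and there is such a decomposition. -/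
def IsDiscriminantIdeal (S : Type*) [CommRing S] [Algebra R S] (D : FractionalIdeal R⁰ K) : Prop :=
  (∃ (n : ℕ) (𝔟 : Fin n → (FractionalIdeal R⁰ K)ˣ) (ξ : Fin n → K ⊗[R] S),
    IsSteinitzDecomp (ringLattice R K S) 𝔟 ξ) ∧
  ∀ (n : ℕ) (𝔟 : Fin n → (FractionalIdeal R⁰ K)ˣ) (ξ : Fin n → K ⊗[R] S),
    IsSteinitzDecomp (ringLattice R K S) 𝔟 ξ →
      D = FractionalIdeal.spanSingleton R⁰ (Algebra.discr K ξ) *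
        (∏ i, (𝔟 i : FractionalIdeal R⁰ K)) ^ 2

/-- The `K`-bilinear alternating form `π` on `L` is (the extension to `L` of) an `𝔞`-orientation of
`S`: the image of `⋀² S` under `π` is `𝔞`. (For `S` of rank two this says that `π` restricts to an
isomorphism `⋀² S ≃ 𝔞`, since `⋀² S` is torsion-free of rank one.) -/
def IsOrientation (𝔞 : (FractionalIdeal R⁰ K)ˣ) (π : (K ⊗[R] S) [⋀^Fin 2]→ₗ[K] K) : Prop :=
  Submodule.span R {t : K | ∃ x ∈ ringLattice R K S, ∃ y ∈ ringLattice R K S, t = π ![x, y]} =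
    ((𝔞 : FractionalIdeal R⁰ K) : Submodule R K)

end Rings

/-! ## Balanced quadruples and general equivalence -/

section Quadruples

variable {R : Type u} [CommRing R] [IsDedekindDomain R]
  {K : Type v} [Field K] [Algebra R K] [IsFractionRing R K]

/-- Quadruples `(S, I, δ, s)`: a nondegenerate quadratic ring `S` over `R` (a commutative
`R`-algebra that is a lattice of rank two, with nonzero discriminant) with ambient algebra
`L = K ⊗ S`, a fractional ideal `I` of `S`, a unit `δ` of `L` and a unit `s` of `K`, such that
`St(I) = [𝔞] = St(S)`, `I³ ⊆ δ S`, `[S : I] = s R` and `s³ = N(δ)`. -/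
structure BalancedQuadruple (𝔞 : (FractionalIdeal R⁰ K)ˣ) where
  S : Type u
  [instCommRing : CommRing S]
  [instAlgebra : Algebra R S]
  finite : Module.Finite R S
  torsionFree : Module.IsTorsionFree R S
  rank_eq_two : Module.finrank K (K ⊗[R] S) = 2
  nondegenerate : (Algebra.traceForm K (K ⊗[R] S)).Nondegenerate
  I : Submodule R (K ⊗[R] S)
  isFracIdeal : IsFracIdeal I
  δ : (K ⊗[R] S)ˣ
  s : Kˣ
  steinitz_ring : HasSteinitzClass K (ringLattice R K S) (ClassGroup.mk K 𝔞)
  steinitz_ideal : HasSteinitzClass K I (ClassGroup.mk K 𝔞)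
  cube_le : I ^ 3 ≤ scale (δ : K ⊗[R] S) (ringLattice R K S)
  index_eq : moduleIndex K (ringLattice R K S) I = Submodule.span R {(s : K)}
  norm_eq : (s : K) ^ 3 = Algebra.norm K (δ : K ⊗[R] S)

attribute [instance] BalancedQuadruple.instCommRing BalancedQuadruple.instAlgebra

/-- `(S, I, δ, s) ≈ (S', I', δ', s')`: there are an isomorphism of rings `φ : S ≃ S'` over `R` and
`κ ∈ L'` with `I' = κ φ(I)`, `δ' = κ³ φ(δ)` and `s' = N(κ) s`. -/
def GenEquivalent {𝔞 : (FractionalIdeal R⁰ K)ˣ} (Q Q' : BalancedQuadruple 𝔞) : Prop :=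
  ∃ (φ : Q.S ≃ₐ[R] Q'.S) (κ : K ⊗[R] Q'.S),
    Q'.I = scale κ (Q.I.map ((extendEquiv K φ).toLinearMap.restrictScalars R)) ∧
    (Q'.δ : K ⊗[R] Q'.S) = κ ^ 3 * extendEquiv K φ (Q.δ : K ⊗[R] Q.S) ∧
    (Q'.s : K) = Algebra.norm K κ * (Q.s : K)

theorem scale_one {S : Type*} [CommRing S] [Algebra R S] (M : Submodule R (K ⊗[R] S)) :
    scale 1 M = M := by
  ext z
  simp [scale]

theorem scale_scale {S : Type*} [CommRing S] [Algebra R S] (x y : K ⊗[R] S)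
    (M : Submodule R (K ⊗[R] S)) : scale x (scale y M) = scale (x * y) M := by
  ext z
  simp [scale]

theorem map_scale {S S' : Type*} [CommRing S] [Algebra R S] [CommRing S'] [Algebra R S']
    (e : (K ⊗[R] S) ≃ₐ[K] (K ⊗[R] S')) (x : K ⊗[R] S) (M : Submodule R (K ⊗[R] S)) :
    (scale x M).map (e.toLinearMap.restrictScalars R) =
      scale (e x) (M.map (e.toLinearMap.restrictScalars R)) := by
  ext z
  simp [scale]

theorem extendEquiv_refl {S : Type*} [CommRing S] [Algebra R S] :
    extendEquiv K (AlgEquiv.refl : S ≃ₐ[R] S) = AlgEquiv.refl :=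
  Algebra.TensorProduct.congr_refl

theorem extendEquiv_symm {S S' : Type*} [CommRing S] [Algebra R S] [CommRing S'] [Algebra R S']
    (φ : S ≃ₐ[R] S') : extendEquiv K φ.symm = (extendEquiv K φ).symm := rfl

theorem extendEquiv_trans {S S' S'' : Type*} [CommRing S] [Algebra R S] [CommRing S']
    [Algebra R S'] [CommRing S''] [Algebra R S''] (φ : S ≃ₐ[R] S') (ψ : S' ≃ₐ[R] S'') :
    extendEquiv K (φ.trans ψ) = (extendEquiv K φ).trans (extendEquiv K ψ) := by
  ext x
  induction x using TensorProduct.induction_on with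
  | zero => simp
  | tmul a b => simp [extendEquiv]
  | add a b ha hb => rw [map_add, map_add, ha, hb]

theorem genEquivalent_refl {𝔞 : (FractionalIdeal R⁰ K)ˣ} (Q : BalancedQuadruple 𝔞) :
    GenEquivalent Q Q := by
  refine ⟨AlgEquiv.refl, 1, ?_, ?_, ?_⟩
  · rw [extendEquiv_refl, scale_one]
    ext z
    simp
  · simp [extendEquiv_refl]
  · simp

theorem genEquivalent_symm {𝔞 : (FractionalIdeal R⁰ K)ˣ} {Q Q' : BalancedQuadruple 𝔞}
    (h : GenEquivalent Q Q') : GenEquivalent Q' Q := by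
  obtain ⟨φ, κ, hI, hδ, hs⟩ := h
  have hu : IsUnit κ := by
    have h1 : IsUnit (κ ^ 3 * extendEquiv K φ (Q.δ : K ⊗[R] Q.S)) := hδ ▸ Q'.δ.isUnit
    exact (isUnit_pow_iff three_ne_zero).1 (isUnit_of_mul_isUnit_left h1)
  obtain ⟨k, rfl⟩ := hu
  set e := extendEquiv K φ with he
  refine ⟨φ.symm, e.symm (k⁻¹).val, ?_, ?_, ?_⟩
  · rw [extendEquiv_symm, ← he, ← map_scale, hI, scale_scale, Units.inv_mul, scale_one]
    ext z
    simp
  · rw [extendEquiv_symm, ← he, hδ, ← map_pow, ← map_mul, ← mul_assoc, ← mul_pow, Units.inv_mul,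
      one_pow, one_mul, AlgEquiv.symm_apply_apply]
  · rw [hs, Algebra.norm_eq_of_algEquiv, ← mul_assoc, ← map_mul, Units.inv_mul, map_one, one_mul]

theorem genEquivalent_trans {𝔞 : (FractionalIdeal R⁰ K)ˣ} {Q Q' Q'' : BalancedQuadruple 𝔞}
    (h : GenEquivalent Q Q') (h' : GenEquivalent Q' Q'') : GenEquivalent Q Q'' := by
  obtain ⟨φ, κ, hI, hδ, hs⟩ := h
  obtain ⟨φ', κ', hI', hδ', hs'⟩ := h'
  refine ⟨φ.trans φ', κ' * extendEquiv K φ' κ, ?_, ?_, ?_⟩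
  · rw [hI', hI, map_scale, scale_scale, extendEquiv_trans]
    congr 1
    ext z
    simp
  · rw [hδ', hδ, extendEquiv_trans, map_mul, map_pow, AlgEquiv.trans_apply]
    ring
  · rw [hs', hs, map_mul, Algebra.norm_eq_of_algEquiv, mul_assoc]

/-- General equivalence of balanced quadruples. -/
def generalEquivalence (𝔞 : (FractionalIdeal R⁰ K)ˣ) : Setoid (BalancedQuadruple 𝔞) where
  r := GenEquivalent
  iseqv := ⟨genEquivalent_refl, genEquivalent_symm, genEquivalent_trans⟩

end Quadruples

/-! ## Triply symmetric binary cubic forms -/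

section Forms

variable {R : Type u} [CommRing R] [IsDedekindDomain R]
  {K : Type v} [Field K] [Algebra R K] [IsFractionRing R K]

open MvPolynomial in
/-- The binary cubic form `a x³ + 3 b x² y + 3 c x y² + d y³` in the variables `x = X 0`,
`y = X 1`. -/
def cubicForm (a b c d : K) : MvPolynomial (Fin 2) K :=
  C a * X 0 ^ 3 + 3 * C b * X 0 ^ 2 * X 1 + 3 * C c * X 0 * X 1 ^ 2 + C d * X 1 ^ 3

/-- The lattice `V_𝔞` of forms `a x³ + 3 b x² y + 3 c x y² + d y³` with `a ∈ 𝔞`, `b ∈ R`,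
`c ∈ 𝔞⁻¹`, `d ∈ 𝔞⁻²`. -/
def formLattice (𝔞 : (FractionalIdeal R⁰ K)ˣ) : Set (MvPolynomial (Fin 2) K) :=
  {f | ∃ a ∈ (𝔞 : FractionalIdeal R⁰ K), ∃ b ∈ (1 : FractionalIdeal R⁰ K),
    ∃ c ∈ ((𝔞⁻¹ : (FractionalIdeal R⁰ K)ˣ) : FractionalIdeal R⁰ K),
    ∃ d ∈ ((𝔞⁻¹ ^ 2 : (FractionalIdeal R⁰ K)ˣ) : FractionalIdeal R⁰ K), f = cubicForm a b c d}

/-- The coefficient of `x ^ i * y ^ j`. -/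
def formCoeff (i j : ℕ) (f : MvPolynomial (Fin 2) K) : K :=
  f.coeff (Finsupp.single 0 i + Finsupp.single 1 j)

/-- The reduced discriminant of a binary cubic form: `-1/27` times its usual discriminant. -/
def disc (f : MvPolynomial (Fin 2) K) : K :=
  -(Cubic.mk (formCoeff 3 0 f) (formCoeff 2 1 f) (formCoeff 1 2 f) (formCoeff 0 3 f)).discr / 27

/-- The form `f = a x³ + 3 b x² y + 3 c x y² + d y³` is projective: no prime `𝔭` of `R` divides all
of `(b² - a c) R`, `(a d - b c) 𝔞`, `(c² - b d) 𝔞²`. -/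
def IsProjectiveForm (𝔞 : (FractionalIdeal R⁰ K)ˣ) (f : MvPolynomial (Fin 2) K) : Prop :=
  ∀ a b c d : K, f = cubicForm a b c d →
    ¬ ∃ p : Ideal R, p.IsPrime ∧
      FractionalIdeal.spanSingleton R⁰ (b ^ 2 - a * c) ≤ (p : FractionalIdeal R⁰ K) ∧
      FractionalIdeal.spanSingleton R⁰ (a * d - b * c) * (𝔞 : FractionalIdeal R⁰ K) ≤
        (p : FractionalIdeal R⁰ K) ∧
      FractionalIdeal.spanSingleton R⁰ (c ^ 2 - b * d) * (𝔞 : FractionalIdeal R⁰ K) ^ 2 ≤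
        (p : FractionalIdeal R⁰ K)

open MvPolynomial in
/-- The action `(g · f)(x, y) = det(g)⁻¹ f((x, y) g)` of `GL₂(K)` on binary forms. -/
def act (g : GL (Fin 2) K) (f : MvPolynomial (Fin 2) K) : MvPolynomial (Fin 2) K :=
  C (g.det⁻¹ : Kˣ).val * bind₁ (fun j => ∑ i, C (g.val i j) * X i) f

/-- The group `GL(R ⊕ 𝔞)` of matrices with diagonal entries in `R`, upper right entry in `𝔞`, lower
left entry in `𝔞⁻¹` and determinant in `Rˣ`. -/
def GLa (𝔞 : (FractionalIdeal R⁰ K)ˣ) : Subgroup (GL (Fin 2) K) where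
  carrier := {g | g.val 0 0 ∈ (1 : FractionalIdeal R⁰ K) ∧ g.val 1 1 ∈ (1 : FractionalIdeal R⁰ K) ∧
    g.val 0 1 ∈ (𝔞 : FractionalIdeal R⁰ K) ∧
    g.val 1 0 ∈ ((𝔞⁻¹ : (FractionalIdeal R⁰ K)ˣ) : FractionalIdeal R⁰ K) ∧
    ∃ r : Rˣ, algebraMap R K r = g.val.det}
  one_mem' := by
    refine ⟨?_, ?_, ?_, ?_, 1, ?_⟩ <;> simp [FractionalIdeal.zero_mem]
  mul_mem' := by
    rintro g h ⟨g1, g2, g3, g4, r, hr⟩ ⟨h1, h2, h3, h4, t, ht⟩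
    have e1 : (𝔞 : FractionalIdeal R⁰ K) * ((𝔞⁻¹ : (FractionalIdeal R⁰ K)ˣ) : _) = 1 := by
      rw [← Units.val_mul, mul_inv_cancel, Units.val_one]
    have e2 : ((𝔞⁻¹ : (FractionalIdeal R⁰ K)ˣ) : FractionalIdeal R⁰ K) * 𝔞 = 1 := by
      rw [← Units.val_mul, inv_mul_cancel, Units.val_one]
    have m {I J L : FractionalIdeal R⁰ K} (hIJ : I * J = L) {x y : K} (hx : x ∈ I) (hy : y ∈ J) :
        x * y ∈ L := hIJ ▸ FractionalIdeal.mul_mem_mul hx hy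
    have ad {L : FractionalIdeal R⁰ K} {x y : K} (hx : x ∈ L) (hy : y ∈ L) : x + y ∈ L :=
      Submodule.add_mem (L : Submodule R K) hx hy
    simp only [Set.mem_ofPred_eq, Units.val_mul, Matrix.mul_apply, Fin.sum_univ_two, Matrix.det_mul]
    exact ⟨ad (m (one_mul _) g1 h1) (m e1 g3 h4), ad (m e2 g4 h3) (m (one_mul _) g2 h2),
      ad (m (one_mul _) g1 h3) (m (mul_one _) g3 h2), ad (m (mul_one _) g4 h1) (m (one_mul _) g2 h4),
      r * t, by rw [← hr, ← ht, Units.val_mul, map_mul]⟩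
  inv_mem' := by
    rintro g ⟨g1, g2, g3, g4, r, hr⟩
    have hd : g.val.det ≠ 0 := ((Matrix.isUnit_iff_isUnit_det _).1 g.isUnit).ne_zero
    have hr' : Ring.inverse g.val.det = algebraMap R K (r⁻¹).val := by
      rw [Ring.inverse_eq_inv', ← hr]
      refine inv_eq_of_mul_eq_one_right ?_
      rw [← map_mul, Units.mul_inv, map_one]
    have sm {L : FractionalIdeal R⁰ K} {x : K} (c : R) (hx : x ∈ L) : algebraMap R K c * x ∈ L := by
      rw [← Algebra.smul_def]
      exact Submodule.smul_mem (L : Submodule R K) c hx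
    have ng {L : FractionalIdeal R⁰ K} {x : K} (hx : x ∈ L) : -x ∈ L :=
      Submodule.neg_mem (L : Submodule R K) hx
    simp only [Set.mem_ofPred_eq, Matrix.coe_units_inv, Matrix.inv_def, hr', Matrix.adjugate_fin_two,
      Matrix.smul_apply, Matrix.of_apply, Matrix.cons_val', Matrix.cons_val_zero,
      Matrix.cons_val_one, Matrix.cons_val_fin_one, smul_eq_mul]
    refine ⟨sm _ g2, sm _ g1, sm _ (ng g3), sm _ (ng g4), r⁻¹, ?_⟩
    rw [Matrix.det_smul, Matrix.det_fin_two_of, ← hr', Ring.inverse_eq_inv', Fintype.card_fin]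
    have h2 : g.val.det = g.val 0 0 * g.val 1 1 - g.val 0 1 * g.val 1 0 := Matrix.det_fin_two _
    field_simp
    rw [h2]
    ring

theorem act_one (f : MvPolynomial (Fin 2) K) : act 1 f = f := by
  have h : (fun j : Fin 2 => ∑ i, MvPolynomial.C ((1 : GL (Fin 2) K).val i j) * MvPolynomial.X i) =
      (MvPolynomial.X : Fin 2 → MvPolynomial (Fin 2) K) := by
    funext j
    fin_cases j <;> simp
  rw [act, h]
  simp

theorem act_mul (g h : GL (Fin 2) K) (f : MvPolynomial (Fin 2) K) :
    act (g * h) f = act g (act h f) := by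
  simp only [act, map_mul, MvPolynomial.bind₁_C_right, MvPolynomial.bind₁_bind₁]
  rw [← mul_assoc, ← MvPolynomial.C_mul, mul_inv_rev, Units.val_mul, mul_comm (h.det⁻¹ : Kˣ).val]
  congr 3
  funext j
  simp only [Units.val_mul, Matrix.mul_apply, Fin.sum_univ_two, map_add, map_mul,
    MvPolynomial.bind₁_C_right, MvPolynomial.bind₁_X_right]
  ring

/-- The nondegenerate forms in `V_𝔞`, i.e. those with nonzero discriminant. -/
def NondegForm (𝔞 : (FractionalIdeal R⁰ K)ˣ) : Type v :=
  {f : MvPolynomial (Fin 2) K // f ∈ formLattice 𝔞 ∧ disc f ≠ 0}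

/-- The orbit relation of `GL(R ⊕ 𝔞)` on the nondegenerate forms in `V_𝔞`. -/
def orbitRelation (𝔞 : (FractionalIdeal R⁰ K)ˣ) : Setoid (NondegForm 𝔞) where
  r f f' := ∃ g ∈ GLa 𝔞, f'.1 = act g f.1
  iseqv := by
    refine ⟨fun f => ⟨1, one_mem _, (act_one _).symm⟩, ?_, ?_⟩
    · rintro f f' ⟨g, hg, h⟩
      refine ⟨g⁻¹, inv_mem hg, ?_⟩
      rw [h, ← act_mul, inv_mul_cancel, act_one]
    · rintro f f' f'' ⟨g, hg, h⟩ ⟨g', hg', h'⟩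
      refine ⟨g' * g, mul_mem hg' hg, ?_⟩
      rw [h', h, ← act_mul]

/-- The form `f` is the one attached to the quadruple `(S, I, δ, s)` by some `𝔞`-orientation `π` of
`S` and some decomposition `I = R α + 𝔞 β` with `π(α ∧ β) = s`, namely
`f(x, y) = π(1 ∧ (α x + β y)³ / δ)`. -/
def Corresponds {𝔞 : (FractionalIdeal R⁰ K)ˣ} (f : MvPolynomial (Fin 2) K)
    (Q : BalancedQuadruple 𝔞) : Prop :=
  ∃ (π : (K ⊗[R] Q.S) [⋀^Fin 2]→ₗ[K] K) (α β : K ⊗[R] Q.S),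
    IsOrientation 𝔞 π ∧ IsSteinitzDecomp Q.I ![1, 𝔞] ![α, β] ∧ π ![α, β] = (Q.s : K) ∧
    f = cubicForm (π ![1, α ^ 3 * (Q.δ⁻¹).val]) (π ![1, α ^ 2 * β * (Q.δ⁻¹).val])
      (π ![1, α * β ^ 2 * (Q.δ⁻¹).val]) (π ![1, β ^ 3 * (Q.δ⁻¹).val])

end Forms

end TripSymCubic

end

noncomputable section

set_option linter.unusedSectionVars false

namespace TripSymCubic

/-! ### Colon ideals and units for invertible fractional ideals -/

section FractionalIdeals

variable {R : Type u} [CommRing R] [IsDedekindDomain R]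
  {K : Type v} [Field K] [Algebra R K] [IsFractionRing R K]

/-! Write l = δ⁻¹, and let p = b² − ac, m = bc − ad, r = c² − bd be the Hessian covariants of the
form attached to I = Rα + 𝔞β. With α' = s⁻¹ᾱ, β' = s⁻¹β̄ and θ = α'β, polynomial identities together
with the balance condition s³N(l) = 1 give αα' = p, ββ' = r, αβ' = m − θ and π(1 ∧ θ) = 1
(`exists_conjugates`). Hence θ² = mθ − pr, θα = pβ and θβ = mβ − rα: the form alone dictates the
multiplication table of θ and its action on I. Since I³ ⊆ δS, the coefficients lie in the prescribed
ideals; then 𝔞θ is integral over R, and as R is integrally closed this forces S = R + 𝔞θ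
(`exists_isNormalForm`).

Different choices of (π, α, β) for one quadruple differ exactly by GL(R ⊕ 𝔞), the factor det(g)⁻¹
being the change of π that keeps π(α ∧ β) = s. So each quadruple gives one orbit (`Corresponds.act`,
`Corresponds.exists_act_eq`), which depends only on its class (`Corresponds.of_genEquivalent`).

Injectivity: two quadruples with the same form have the same tables, so θ ↦ θ₁ identifies the rings,
and `exists_scaling` produces κ. Surjectivity: in the quadratic algebra with ω² = mω − pr, explicit
α, β, l recover the form (`exists_model`), and the ideal conditions on a, b, c, d make R + 𝔞ω a ring
and Rα + 𝔞β a balanced ideal (`exists_quadruple`).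

The remaining claims are read from the tables. The discriminant of θ² − mθ + pr is m² − 4pr =
disc(f). The conjugate lattice J = Rα' + 𝔞β' satisfies IJ ⊆ S, and IJ contains pR + m𝔞 + r𝔞², so it
is S when the covariants have no common prime; if a prime P divides them all, then 𝔞θI ⊆ PI,
impossible for invertible I. The characteristic hypothesis enters because b and c are seen only
through 3b and 3c, and disc divides by 27. -/

theorem mul_mem_of_eq {I J L : FractionalIdeal R⁰ K} (h : I * J = L) {x y : K} (hx : x ∈ I)
    (hy : y ∈ J) : x * y ∈ L :=
  h ▸ FractionalIdeal.mul_mem_mul hx hy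

theorem frac_add_mem {I : FractionalIdeal R⁰ K} {x y : K} (hx : x ∈ I) (hy : y ∈ I) : x + y ∈ I :=
  Submodule.add_mem (I : Submodule R K) hx hy

theorem frac_sub_mem {I : FractionalIdeal R⁰ K} {x y : K} (hx : x ∈ I) (hy : y ∈ I) : x - y ∈ I :=
  Submodule.sub_mem (I : Submodule R K) hx hy

theorem frac_neg_mem {I : FractionalIdeal R⁰ K} {x : K} (hx : x ∈ I) : -x ∈ I :=
  Submodule.neg_mem (I : Submodule R K) hx

theorem unit_mul_inv (𝔞 : (FractionalIdeal R⁰ K)ˣ) :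
    (𝔞 : FractionalIdeal R⁰ K) * ((𝔞⁻¹ : (FractionalIdeal R⁰ K)ˣ) : FractionalIdeal R⁰ K) = 1 := by
  rw [← Units.val_mul, mul_inv_cancel, Units.val_one]

theorem inv_mul_unit (𝔞 : (FractionalIdeal R⁰ K)ˣ) :
    ((𝔞⁻¹ : (FractionalIdeal R⁰ K)ˣ) : FractionalIdeal R⁰ K) * (𝔞 : FractionalIdeal R⁰ K) = 1 := by
  rw [← Units.val_mul, inv_mul_cancel, Units.val_one]

/-- Multiply x𝔞 ⊆ I by 𝔞⁻¹. Applied repeatedly, this places the coefficients of a form in 1, 𝔞⁻¹ and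
𝔞⁻², since only the products tβ with t ∈ 𝔞 lie in the ideal, not β itself. -/
theorem mem_mul_inv_of_forall {𝔞 : (FractionalIdeal R⁰ K)ˣ} {I : FractionalIdeal R⁰ K} {x : K}
    (h : ∀ y ∈ (𝔞 : FractionalIdeal R⁰ K), x * y ∈ I) :
    x ∈ I * ((𝔞⁻¹ : (FractionalIdeal R⁰ K)ˣ) : FractionalIdeal R⁰ K) := by
  have h1 : FractionalIdeal.spanSingleton R⁰ x * (𝔞 : FractionalIdeal R⁰ K) ≤ I := by
    intro z hz
    obtain ⟨y, hy, rfl⟩ := FractionalIdeal.mem_singleton_mul.1 hz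
    exact h y hy
  have h2 := mul_le_mul_left h1 ((𝔞⁻¹ : (FractionalIdeal R⁰ K)ˣ) : FractionalIdeal R⁰ K)
  rw [mul_assoc, unit_mul_inv, mul_one] at h2
  exact FractionalIdeal.spanSingleton_le_iff_mem.1 h2

theorem mem_inv_of_forall {𝔞 : (FractionalIdeal R⁰ K)ˣ} {x : K}
    (h : ∀ y ∈ (𝔞 : FractionalIdeal R⁰ K), x * y ∈ (1 : FractionalIdeal R⁰ K)) :
    x ∈ ((𝔞⁻¹ : (FractionalIdeal R⁰ K)ˣ) : FractionalIdeal R⁰ K) := by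
  have := mem_mul_inv_of_forall h
  rwa [one_mul] at this

theorem mem_one_of_forall {𝔞 : (FractionalIdeal R⁰ K)ˣ} {x : K}
    (h : ∀ y ∈ (𝔞 : FractionalIdeal R⁰ K), x * y ∈ (𝔞 : FractionalIdeal R⁰ K)) :
    x ∈ (1 : FractionalIdeal R⁰ K) := by
  have := mem_mul_inv_of_forall h
  rwa [unit_mul_inv] at this

theorem one_mem_frac_one : (1 : K) ∈ (1 : FractionalIdeal R⁰ K) := FractionalIdeal.one_mem_one R⁰

/-- A scalar that multiplies a nonzero fractional ideal onto itself is a unit of the ring. -/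
theorem exists_unit_of_singleton_mul_eq {𝔞 : (FractionalIdeal R⁰ K)ˣ} {x : K}
    (h : FractionalIdeal.spanSingleton R⁰ x * (𝔞 : FractionalIdeal R⁰ K) = 𝔞) :
    ∃ u : Rˣ, algebraMap R K u = x := by
  have h1 : FractionalIdeal.spanSingleton R⁰ x = 1 := by
    have := congrArg (· * ((𝔞⁻¹ : (FractionalIdeal R⁰ K)ˣ) : FractionalIdeal R⁰ K)) h
    simpa only [mul_assoc, unit_mul_inv, mul_one] using this
  have hx : x ∈ (1 : FractionalIdeal R⁰ K) := by
    rw [← h1]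
    exact FractionalIdeal.mem_spanSingleton_self R⁰ x
  have h0 : (1 : K) ∈ FractionalIdeal.spanSingleton R⁰ x := by
    rw [h1]
    exact one_mem_frac_one
  obtain ⟨r, rfl⟩ := (FractionalIdeal.mem_one_iff R⁰).1 hx
  obtain ⟨t, ht⟩ := (FractionalIdeal.mem_spanSingleton R⁰).1 h0
  have h2 : t * r = 1 := by
    apply FaithfulSMul.algebraMap_injective R K
    rw [map_mul, map_one, ← Algebra.smul_def, ht]
  exact ⟨⟨r, t, by rw [mul_comm, h2], h2⟩, rfl⟩

theorem exists_ne_zero_mem (𝔞 : (FractionalIdeal R⁰ K)ˣ) :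
    ∃ x ∈ (𝔞 : FractionalIdeal R⁰ K), x ≠ 0 := by
  by_contra! h
  exact 𝔞.ne_zero ((FractionalIdeal.eq_zero_iff).2 h)

end FractionalIdeals

/-! ### Steinitz decompositions of rank two lattices -/

section Decompositions

variable {R : Type u} [CommRing R] [IsDedekindDomain R]
  {K : Type v} [Field K] [Algebra R K] [IsFractionRing R K]
  {V : Type*} [AddCommGroup V] [Module K V] [Module R V] [IsScalarTower R K V]
  {V' : Type*} [AddCommGroup V'] [Module K V'] [Module R V'] [IsScalarTower R K V']

theorem isSteinitzDecomp_two {M : Submodule R V} {𝔟 : Fin 2 → (FractionalIdeal R⁰ K)ˣ}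
    {v : Fin 2 → V} :
    IsSteinitzDecomp M 𝔟 v ↔ LinearIndependent K v ∧
      ∀ x, x ∈ M ↔ ∃ s ∈ (𝔟 0 : FractionalIdeal R⁰ K), ∃ t ∈ (𝔟 1 : FractionalIdeal R⁰ K),
        x = s • v 0 + t • v 1 := by
  unfold IsSteinitzDecomp
  refine and_congr_right fun _ => ?_
  rw [SetLike.ext_iff]
  refine forall_congr' fun x => ?_
  refine iff_congr Iff.rfl ?_
  have : (⨆ i, Submodule.map ((LinearMap.toSpanSingleton K V (v i)).restrictScalars R)
      ((𝔟 i : FractionalIdeal R⁰ K) : Submodule R K)) =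
      Submodule.map ((LinearMap.toSpanSingleton K V (v 0)).restrictScalars R)
      ((𝔟 0 : FractionalIdeal R⁰ K) : Submodule R K) ⊔
      Submodule.map ((LinearMap.toSpanSingleton K V (v 1)).restrictScalars R)
      ((𝔟 1 : FractionalIdeal R⁰ K) : Submodule R K) := by
    apply le_antisymm
    · refine iSup_le fun i => ?_
      fin_cases i
      · exact le_sup_left
      · exact le_sup_right
    · exact sup_le (le_iSup (fun i => Submodule.map
        ((LinearMap.toSpanSingleton K V (v i)).restrictScalars R)
        ((𝔟 i : FractionalIdeal R⁰ K) : Submodule R K)) 0) (le_iSup (fun i => Submodule.map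
        ((LinearMap.toSpanSingleton K V (v i)).restrictScalars R)
        ((𝔟 i : FractionalIdeal R⁰ K) : Submodule R K)) 1)
  rw [this, Submodule.mem_sup]
  constructor
  · rintro ⟨_, ⟨s, hs, rfl⟩, _, ⟨t, ht, rfl⟩, rfl⟩
    exact ⟨s, hs, t, ht, by simp⟩
  · rintro ⟨s, hs, t, ht, rfl⟩
    exact ⟨_, ⟨s, hs, rfl⟩, _, ⟨t, ht, rfl⟩, by simp⟩

theorem IsSteinitzDecomp.mem_iff {M : Submodule R V} {𝔟 𝔠 : (FractionalIdeal R⁰ K)ˣ}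
    {v w : V} (h : IsSteinitzDecomp M ![𝔟, 𝔠] ![v, w]) (x : V) :
    x ∈ M ↔ ∃ s ∈ (𝔟 : FractionalIdeal R⁰ K), ∃ t ∈ (𝔠 : FractionalIdeal R⁰ K),
        x = s • v + t • w :=
  (isSteinitzDecomp_two.1 h).2 x

theorem IsSteinitzDecomp.mk {M : Submodule R V} {𝔟 𝔠 : (FractionalIdeal R⁰ K)ˣ}
    {v w : V} (hvw : LinearIndependent K ![v, w]) (h : ∀ x, x ∈ M ↔
      ∃ s ∈ (𝔟 : FractionalIdeal R⁰ K), ∃ t ∈ (𝔠 : FractionalIdeal R⁰ K), x = s • v + t • w) :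
    IsSteinitzDecomp M ![𝔟, 𝔠] ![v, w] :=
  isSteinitzDecomp_two.2 ⟨hvw, h⟩

theorem IsSteinitzDecomp.map {n : ℕ} {M : Submodule R V} {𝔟 : Fin n → (FractionalIdeal R⁰ K)ˣ}
    {v : Fin n → V} (h : IsSteinitzDecomp M 𝔟 v) (e : V →ₗ[K] V') (he : Function.Injective e) :
    IsSteinitzDecomp (M.map (e.restrictScalars R)) 𝔟 (e ∘ v) := by
  refine ⟨h.1.map' e (LinearMap.ker_eq_bot.2 he), ?_⟩
  rw [h.2, Submodule.map_iSup]
  congr 1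
  funext i
  rw [← Submodule.map_comp]
  congr 1
  ext
  simp

/-- `𝔟 v + 𝔠 w = R (p v + q w) + 𝔟𝔠 (-t v + r w)` if `p r + q t = 1`. -/
theorem IsSteinitzDecomp.change {M : Submodule R V} {𝔟 𝔠 : (FractionalIdeal R⁰ K)ˣ}
    {v w : V} (h : IsSteinitzDecomp M ![𝔟, 𝔠] ![v, w]) {p q r t : K}
    (hp : p ∈ (𝔟 : FractionalIdeal R⁰ K)) (hq : q ∈ (𝔠 : FractionalIdeal R⁰ K))
    (hr : r ∈ ((𝔟⁻¹ : (FractionalIdeal R⁰ K)ˣ) : FractionalIdeal R⁰ K))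
    (ht : t ∈ ((𝔠⁻¹ : (FractionalIdeal R⁰ K)ˣ) : FractionalIdeal R⁰ K))
    (hd : p * r + q * t = 1) :
    IsSteinitzDecomp M ![1, 𝔟 * 𝔠] ![p • v + q • w, (-t) • v + r • w] := by
  have e1 := unit_mul_inv 𝔟
  have e2 := unit_mul_inv 𝔠
  have e3 := inv_mul_unit 𝔟
  have e4 := inv_mul_unit 𝔠
  have hv : v = r • (p • v + q • w) + (-q) • ((-t) • v + r • w) := by
    linear_combination (norm := module) (-hd) • v
  have hw : w = t • (p • v + q • w) + p • ((-t) • v + r • w) := by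
    linear_combination (norm := module) (-hd) • w
  refine IsSteinitzDecomp.mk ?_ fun x => ?_
  · have h1 := LinearIndependent.pair_iff.1 h.1
    refine LinearIndependent.pair_iff.2 fun s s' hs => ?_
    obtain ⟨h2, h3⟩ := h1 (s * p - s' * t) (s * q + s' * r) (by rw [← hs]; module)
    constructor
    · linear_combination r * h2 + t * h3 - s * hd
    · linear_combination -q * h2 + p * h3 - s' * hd
  · rw [h.mem_iff]
    constructor
    · rintro ⟨x, hx, y, hy, rfl⟩
      refine ⟨x * r + y * t, ?_, -(x * q) + y * p, ?_, ?_⟩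
      · exact frac_add_mem (mul_mem_of_eq e1 hx hr) (mul_mem_of_eq e2 hy ht)
      · rw [Units.val_mul]
        refine frac_add_mem (frac_neg_mem (mul_mem_of_eq rfl hx hq)) ?_
        exact mul_mem_of_eq (mul_comm _ _) hy hp
      · linear_combination (norm := module) (-hd) • (x • v) + (-hd) • (y • w)
    · rintro ⟨x, hx, y, hy, rfl⟩
      rw [Units.val_mul] at hy
      refine ⟨x * p - y * t, ?_, x * q + y * r, ?_, by module⟩
      · refine frac_sub_mem (mul_mem_of_eq (one_mul _) hx hp) (mul_mem_of_eq ?_ hy ht)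
        rw [mul_assoc, e2, mul_one]
      · refine frac_add_mem (mul_mem_of_eq (one_mul _) hx hq) (mul_mem_of_eq ?_ hy hr)
        rw [mul_right_comm, e1, one_mul]

/-- Replace `w` by a multiple, and the coefficient ideal correspondingly. -/
theorem IsSteinitzDecomp.rescale {M : Submodule R V} {𝔟 𝔠 𝔡 : (FractionalIdeal R⁰ K)ˣ}
    {v w : V} (h : IsSteinitzDecomp M ![𝔟, 𝔠] ![v, w]) {x : K} (hx : x ≠ 0)
    (hc : (𝔠 : FractionalIdeal R⁰ K) = FractionalIdeal.spanSingleton R⁰ x * 𝔡) :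
    IsSteinitzDecomp M ![𝔟, 𝔡] ![v, x • w] := by
  refine IsSteinitzDecomp.mk ?_ fun z => ?_
  · have h1 := LinearIndependent.pair_iff.1 h.1
    refine LinearIndependent.pair_iff.2 fun s s' hs => ?_
    obtain ⟨h2, h3⟩ := h1 s (s' * x) (by rw [← hs]; module)
    exact ⟨h2, (mul_eq_zero.1 h3).resolve_right hx⟩
  · rw [h.mem_iff]
    constructor
    · rintro ⟨s, hs, t, ht, rfl⟩
      rw [hc] at ht
      obtain ⟨t', ht', rfl⟩ := FractionalIdeal.mem_singleton_mul.1 ht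
      exact ⟨s, hs, t', ht', by module⟩
    · rintro ⟨s, hs, t, ht, rfl⟩
      refine ⟨s, hs, x * t, ?_, by module⟩
      rw [hc]
      exact FractionalIdeal.mem_singleton_mul.2 ⟨t, ht, rfl⟩

/-- Two nonzero fractional ideals become coprime after scaling by suitable elements of
their inverses. -/
theorem exists_coprime_pair (𝔟 𝔠 : (FractionalIdeal R⁰ K)ˣ) :
    ∃ p ∈ (𝔟 : FractionalIdeal R⁰ K), ∃ q ∈ (𝔠 : FractionalIdeal R⁰ K),
    ∃ r ∈ ((𝔟⁻¹ : (FractionalIdeal R⁰ K)ˣ) : FractionalIdeal R⁰ K),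
    ∃ t ∈ ((𝔠⁻¹ : (FractionalIdeal R⁰ K)ˣ) : FractionalIdeal R⁰ K), p * r + q * t = 1 := by
  obtain ⟨p, hp, hp0⟩ := exists_ne_zero_mem 𝔟
  obtain ⟨x, J, hx0, hJ⟩ := FractionalIdeal.exists_eq_spanSingleton_mul (𝔠 : FractionalIdeal R⁰ K)
  obtain ⟨A, hA⟩ : ∃ A : Ideal R, (A : FractionalIdeal R⁰ K) =
      FractionalIdeal.spanSingleton R⁰ p *
        ((𝔟⁻¹ : (FractionalIdeal R⁰ K)ˣ) : FractionalIdeal R⁰ K) := by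
    refine FractionalIdeal.le_one_iff_exists_coeIdeal.1 ?_
    rw [← unit_mul_inv 𝔟]
    exact mul_le_mul_left (FractionalIdeal.spanSingleton_le_iff_mem.2 hp) _
  have hA0 : A ≠ 0 := by
    rintro rfl
    have h1 := congrArg (· * (𝔟 : FractionalIdeal R⁰ K)) hA
    simp only [mul_assoc, inv_mul_unit, mul_one] at h1
    have h2 := FractionalIdeal.mem_spanSingleton_self R⁰ p
    rw [← h1] at h2
    simp at h2
    exact hp0 h2
  have hJ0 : J ≠ 0 := by
    rintro rfl
    exact 𝔠.ne_zero (by rw [hJ]; simp)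
  -- Here A = p𝔟⁻¹ is integral and J is 𝔠 up to a scalar. In a Dedekind domain J is generated by AJ
  -- and one further element j, so A𝔠 + (q) = 𝔠, and multiplication by 𝔠⁻¹ gives p𝔟⁻¹ + q𝔠⁻¹ = 1.
  obtain ⟨j, hj⟩ := IsDedekindDomain.exists_sup_span_eq (I := A * J) (J := J) Ideal.mul_le_right
    (mul_ne_zero hA0 hJ0)
  have hx : algebraMap R K x ≠ 0 := by simpa using hx0
  have hjJ : j ∈ J := hj ▸ Ideal.mem_sup_right (Ideal.mem_span_singleton_self j)
  set q : K := (algebraMap R K x)⁻¹ * algebraMap R K j with hq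
  have hqc : q ∈ (𝔠 : FractionalIdeal R⁰ K) := by
    rw [hJ, FractionalIdeal.mem_singleton_mul]
    exact ⟨_, FractionalIdeal.mem_coeIdeal_of_mem R⁰ hjJ, rfl⟩
  have key : FractionalIdeal.spanSingleton R⁰ p *
        ((𝔟⁻¹ : (FractionalIdeal R⁰ K)ˣ) : FractionalIdeal R⁰ K) +
      FractionalIdeal.spanSingleton R⁰ q *
        ((𝔠⁻¹ : (FractionalIdeal R⁰ K)ˣ) : FractionalIdeal R⁰ K) = 1 := by
    have h1 : (A : FractionalIdeal R⁰ K) * 𝔠 + FractionalIdeal.spanSingleton R⁰ q = 𝔠 := by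
      conv_rhs => rw [hJ, ← hj]
      rw [hJ, FractionalIdeal.coeIdeal_sup, FractionalIdeal.coeIdeal_mul,
        FractionalIdeal.coeIdeal_span_singleton, mul_add,
        FractionalIdeal.spanSingleton_mul_spanSingleton]
      ring
    have h2 := congrArg (· * ((𝔠⁻¹ : (FractionalIdeal R⁰ K)ˣ) : FractionalIdeal R⁰ K)) h1
    simp only [add_mul, mul_assoc, unit_mul_inv, mul_one] at h2
    rw [← hA, h2]
  have h1 : (1 : K) ∈ (1 : FractionalIdeal R⁰ K) := one_mem_frac_one
  rw [← key, FractionalIdeal.mem_add] at h1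
  obtain ⟨y, hy, z, hz, hyz⟩ := h1
  obtain ⟨r, hr, rfl⟩ := FractionalIdeal.mem_singleton_mul.1 hy
  obtain ⟨t, ht, rfl⟩ := FractionalIdeal.mem_singleton_mul.1 hz
  exact ⟨p, hp, q, hqc, r, hr, t, ht, hyz⟩

theorem exists_eq_singleton_mul_of_mk_eq {𝔟 𝔠 : (FractionalIdeal R⁰ K)ˣ}
    (h : ClassGroup.mk K 𝔟 = ClassGroup.mk K 𝔠) :
    ∃ x : K, x ≠ 0 ∧ (𝔟 : FractionalIdeal R⁰ K) = FractionalIdeal.spanSingleton R⁰ x * 𝔠 := by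
  have h1 := congrArg (ClassGroup.equiv K) h
  rw [ClassGroup.equiv_mk, ClassGroup.equiv_mk, QuotientGroup.mk'_eq_mk'] at h1
  obtain ⟨z, ⟨y, rfl⟩, hz⟩ := h1
  -- The class group is compared through a canonical isomorphism between two copies of the fraction
  -- field; both are K here, so it is the identity.
  have h2 : ∀ 𝔡 : (FractionalIdeal R⁰ K)ˣ,
      Units.mapEquiv (↑(FractionalIdeal.canonicalEquiv R⁰ K K)) 𝔡 = 𝔡 := by
    intro 𝔡
    ext1
    simp [FractionalIdeal.canonicalEquiv_self]
  rw [h2, h2] at hz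
  refine ⟨(y⁻¹ : Kˣ), (y⁻¹).ne_zero, ?_⟩
  rw [← hz, Units.val_mul, coe_toPrincipalIdeal, mul_comm, mul_assoc,
    FractionalIdeal.spanSingleton_mul_spanSingleton, Units.mul_inv,
    FractionalIdeal.spanSingleton_one, mul_one]

/-- The vectors of the decomposition span what the lattice spans, so they form a basis of the plane.
This reduces the Steinitz class, defined with any number of summands, to two. -/
theorem IsSteinitzDecomp.eq_two {n : ℕ} {M : Submodule R V} {𝔟 : Fin n → (FractionalIdeal R⁰ K)ˣ}
    {v : Fin n → V} (hv : IsSteinitzDecomp M 𝔟 v) (hV : Module.finrank K V = 2)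
    (hM : Submodule.span K (M : Set V) = ⊤) : n = 2 := by
  have h1 : ⊤ ≤ Submodule.span K (Set.range v) := by
    rw [← hM, Submodule.span_le, hv.2]
    have : (⨆ i, Submodule.map ((LinearMap.toSpanSingleton K V (v i)).restrictScalars R)
        ((𝔟 i : FractionalIdeal R⁰ K) : Submodule R K)) ≤
        (Submodule.span K (Set.range v)).restrictScalars R := by
      refine iSup_le fun i => ?_
      rintro _ ⟨x, -, rfl⟩
      exact Submodule.smul_mem _ _ (Submodule.subset_span (Set.mem_range_self i))
    exact this
  have := Module.finrank_eq_card_basis (Module.Basis.mk hv.1 h1)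
  simpa [hV] using this.symm

theorem IsSteinitzDecomp.to_pair {M : Submodule R V} {𝔟 : Fin 2 → (FractionalIdeal R⁰ K)ˣ}
    {v : Fin 2 → V} (hv : IsSteinitzDecomp M 𝔟 v) :
    IsSteinitzDecomp M ![𝔟 0, 𝔟 1] ![v 0, v 1] := by
  convert hv using 1
  · funext i
    fin_cases i <;> rfl
  · funext i
    fin_cases i <;> rfl

/-- A full lattice of rank two and Steinitz class `[𝔞]` is of the form `R v + 𝔞 w`. -/
theorem HasSteinitzClass.exists_decomp {M : Submodule R V} {𝔞 : (FractionalIdeal R⁰ K)ˣ}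
    (h : HasSteinitzClass K M (ClassGroup.mk K 𝔞)) (hV : Module.finrank K V = 2)
    (hM : Submodule.span K (M : Set V) = ⊤) :
    ∃ v w : V, IsSteinitzDecomp M ![1, 𝔞] ![v, w] := by
  obtain ⟨n, 𝔟, v, hv, hc⟩ := h
  obtain rfl := hv.eq_two hV hM
  rw [Fin.prod_univ_two] at hc
  obtain ⟨p, hp, q, hq, r, hr, t, ht, hd⟩ := exists_coprime_pair (𝔟 0) (𝔟 1)
  obtain ⟨x, hx, hxa⟩ := exists_eq_singleton_mul_of_mk_eq hc
  refine ⟨_, _, IsSteinitzDecomp.rescale (IsSteinitzDecomp.change hv.to_pair hp hq hr ht hd) hx hxa⟩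

end Decompositions

/-! ### Alternating forms on a plane -/

section Alternating

variable {K : Type v} [Field K] {V : Type*} [AddCommGroup V] [Module K V]
  {V' : Type*} [AddCommGroup V'] [Module K V'] (π : V [⋀^Fin 2]→ₗ[K] K)

theorem alt_self (x : V) : π ![x, x] = 0 :=
  π.map_eq_zero_of_eq ![x, x] (i := 0) (j := 1) rfl (by decide)

theorem alt_swap (x y : V) : π ![y, x] = -π ![x, y] := by
  rw [← π.map_swap ![x, y] (i := 0) (j := 1) (by decide)]
  congr 1
  funext i
  fin_cases i <;> rfl

theorem alt_add_left (x x' y : V) : π ![x + x', y] = π ![x, y] + π ![x', y] :=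
  π.map_vecCons_add _ _ _

theorem alt_smul_left (c : K) (x y : V) : π ![c • x, y] = c * π ![x, y] :=
  π.map_vecCons_smul _ _ _

theorem alt_add_right (x y y' : V) : π ![x, y + y'] = π ![x, y] + π ![x, y'] := by
  rw [alt_swap, alt_add_left, alt_swap π x y, alt_swap π x y']
  ring

theorem alt_smul_right (c : K) (x y : V) : π ![x, c • y] = c * π ![x, y] := by
  rw [alt_swap, alt_smul_left, alt_swap π x y]
  ring

theorem alt_comb (a b c d : K) (v w : V) :
    π ![a • v + b • w, c • v + d • w] = (a * d - b * c) * π ![v, w] := by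
  simp only [alt_add_left, alt_add_right, alt_smul_left, alt_smul_right, alt_self, alt_swap π v w]
  ring

theorem linearIndependent_of_alt_ne_zero {v w : V} (h : π ![v, w] ≠ 0) :
    LinearIndependent K ![v, w] := by
  by_contra h'
  exact h (π.map_linearDependent _ h')

theorem exists_coords (hV : Module.finrank K V = 2) {v w : V} (h : LinearIndependent K ![v, w])
    (x : V) : ∃ a b : K, x = a • v + b • w := by
  have h1 := h.span_eq_top_of_card_eq_finrank (by simp [hV])
  have h2 : x ∈ Submodule.span K (Set.range ![v, w]) := h1 ▸ Submodule.mem_top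
  rw [Matrix.range_cons, Matrix.range_cons, Matrix.range_empty, Set.union_empty,
    Set.singleton_union, Submodule.mem_span_pair] at h2
  obtain ⟨a, b, rfl⟩ := h2
  exact ⟨a, b, rfl⟩

/-- The basis formed by two linearly independent vectors of a plane. -/
def pairBasis (hV : Module.finrank K V = 2) {v w : V} (h : LinearIndependent K ![v, w]) :
    Module.Basis (Fin 2) K V :=
  basisOfLinearIndependentOfCardEqFinrank h (by simp [hV])

theorem coe_pairBasis (hV : Module.finrank K V = 2) {v w : V} (h : LinearIndependent K ![v, w]) :
    ⇑(pairBasis hV h) = ![v, w] :=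
  coe_basisOfLinearIndependentOfCardEqFinrank h _

theorem exists_alt_eq_one (hV : Module.finrank K V = 2) {v w : V}
    (h : LinearIndependent K ![v, w]) : ∃ π : V [⋀^Fin 2]→ₗ[K] K, π ![v, w] = 1 := by
  refine ⟨(pairBasis hV h).det, ?_⟩
  have := (pairBasis hV h).det_self
  rwa [coe_pairBasis] at this

theorem alt_ext (hV : Module.finrank K V = 2) {v w : V} (h : LinearIndependent K ![v, w])
    {π π' : V [⋀^Fin 2]→ₗ[K] K} (hp : π ![v, w] = π' ![v, w]) (x y : V) :
    π ![x, y] = π' ![x, y] := by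
  obtain ⟨a, b, rfl⟩ := exists_coords hV h x
  obtain ⟨c, d, rfl⟩ := exists_coords hV h y
  rw [alt_comb, alt_comb, hp]

theorem alt_map_det (hV : Module.finrank K V = 2) (f : V →ₗ[K] V) (x y : V) :
    π ![f x, f y] = LinearMap.det f * π ![x, y] := by
  have e : Module.Basis (Fin 2) K V := by
    have : Module.Finite K V := Module.finite_of_finrank_eq_succ hV
    exact Module.finBasisOfFinrankEq K V hV
  have h1 : ![f x, f y] = f ∘ ![x, y] := by
    funext i
    fin_cases i <;> rfl
  rw [π.eq_smul_basis_det e, AlternatingMap.smul_apply, AlternatingMap.smul_apply, h1,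
    e.det_comp, smul_eq_mul, smul_eq_mul]
  ring

end Alternating

/-! ### Exterior squares of lattices and the module index -/

section Wedge

variable {R : Type u} [CommRing R] [IsDedekindDomain R]
  {K : Type v} [Field K] [Algebra R K] [IsFractionRing R K]
  {V : Type*} [AddCommGroup V] [Module K V] [Module R V] [IsScalarTower R K V]
  (π : V [⋀^Fin 2]→ₗ[K] K)

/-- The image of `⋀² M` under `π`, for a lattice `M` with a given decomposition. -/
theorem wedge_eq {M : Submodule R V} {𝔟 𝔠 : (FractionalIdeal R⁰ K)ˣ} {v w : V}
    (h : IsSteinitzDecomp M ![𝔟, 𝔠] ![v, w]) :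
    Submodule.span R {t : K | ∃ x ∈ M, ∃ y ∈ M, t = π ![x, y]} =
      ((FractionalIdeal.spanSingleton R⁰ (π ![v, w]) * (𝔟 * 𝔠) : FractionalIdeal R⁰ K) :
        Submodule R K) := by
  apply le_antisymm
  · rw [Submodule.span_le]
    rintro _ ⟨x, hx, y, hy, rfl⟩
    obtain ⟨a, ha, b, hb, rfl⟩ := (h.mem_iff x).1 hx
    obtain ⟨c, hc, d, hd, rfl⟩ := (h.mem_iff y).1 hy
    rw [alt_comb, mul_comm (a * d - b * c)]
    exact FractionalIdeal.mem_singleton_mul.2 ⟨_, frac_sub_mem (mul_mem_of_eq rfl ha hd)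
      (mul_mem_of_eq (mul_comm _ _) hb hc), rfl⟩
  · rw [FractionalIdeal.coe_mul, FractionalIdeal.coe_mul, Submodule.mul_le]
    intro s hs t ht
    obtain ⟨r, rfl⟩ := (FractionalIdeal.mem_spanSingleton R⁰).1 hs
    rw [smul_mul_assoc]
    refine Submodule.smul_mem _ _ ?_
    refine Submodule.mul_induction_on ht ?_ ?_
    · intro b hb c hc
      refine Submodule.subset_span ⟨b • v + (0 : K) • w, (h.mem_iff _).2 ⟨b, hb, 0,
        FractionalIdeal.zero_mem _, rfl⟩, (0 : K) • v + c • w, (h.mem_iff _).2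
        ⟨0, FractionalIdeal.zero_mem _, c, hc, rfl⟩, ?_⟩
      rw [alt_comb]
      ring
    · intro x y hx hy
      rw [mul_add]
      exact Submodule.add_mem _ hx hy

/-- Two decompositions of the same lattice have proportional determinants. -/
theorem wedge_eq_wedge {M : Submodule R V} {𝔟 𝔠 𝔟' 𝔠' : (FractionalIdeal R⁰ K)ˣ} {v w v' w' : V}
    (h : IsSteinitzDecomp M ![𝔟, 𝔠] ![v, w]) (h' : IsSteinitzDecomp M ![𝔟', 𝔠'] ![v', w']) :
    FractionalIdeal.spanSingleton R⁰ (π ![v, w]) * (𝔟 * 𝔠 : FractionalIdeal R⁰ K) =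
      FractionalIdeal.spanSingleton R⁰ (π ![v', w']) * (𝔟' * 𝔠' : FractionalIdeal R⁰ K) :=
  FractionalIdeal.coeToSubmodule_injective ((wedge_eq π h).symm.trans (wedge_eq π h'))

theorem le_localAt (p : PrimeSpectrum R) (M : Submodule R V) : M ≤ localAt p M :=
  fun x hx => ⟨1, p.isPrime.one_notMem, by rwa [one_smul]⟩

/-- The ideal of all r with rx ∈ M is contained in no maximal ideal, hence contains 1. -/
theorem mem_of_forall_localAt {M : Submodule R V} {x : V}
    (h : ∀ p : PrimeSpectrum R, x ∈ localAt p M) : x ∈ M := by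
  let J : Ideal R := M.colon {x}
  by_cases hJ : J = ⊤
  · have : (1 : R) ∈ J := hJ ▸ Submodule.mem_top
    simpa [J, Submodule.mem_colon_singleton] using this
  · obtain ⟨P, hP, hJP⟩ := Ideal.exists_le_maximal J hJ
    obtain ⟨r, hr, hx⟩ := h ⟨P, hP.isPrime⟩
    exact absurd (hJP (Submodule.mem_colon_singleton.2 hx)) hr

theorem map_localAt {V' : Type*} [AddCommGroup V'] [Module K V'] [Module R V']
    [IsScalarTower R K V'] (p : PrimeSpectrum R) (M : Submodule R V) (g : V ≃ₗ[K] V') :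
    (localAt p M).map ((g : V →ₗ[K] V').restrictScalars R) =
      localAt p (M.map ((g : V →ₗ[K] V').restrictScalars R)) := by
  ext y
  constructor
  · rintro ⟨x, ⟨r, hr, hx⟩, rfl⟩
    exact ⟨r, hr, r • x, hx, by rw [map_smul]⟩
  · rintro ⟨r, hr, x, hx, hy⟩
    refine ⟨g.symm y, ⟨r, hr, ?_⟩, by simp⟩
    have : r • g.symm y = x := by
      apply g.injective
      have h1 : g (r • g.symm y) = r • g (g.symm y) :=
        map_smul ((g : V →ₗ[K] V').restrictScalars R) r _
      rw [h1, g.apply_symm_apply, ← hy]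
      rfl
    rwa [this]

/-- The map v ↦ v', w ↦ w' carries M onto N, has determinant π(v' ∧ w') and serves at every prime,
which bounds the index from above. For the reverse bound, any other local automorphism differs from
it by one of M₍𝔭₎, and its determinant must still divide π(v' ∧ w') in R₍𝔭₎. -/
theorem moduleIndex_eq {M N : Submodule R V} {𝔞 : (FractionalIdeal R⁰ K)ˣ} {v w v' w' : V}
    (hV : Module.finrank K V = 2)
    (hM : IsSteinitzDecomp M ![1, 𝔞] ![v, w]) (hN : IsSteinitzDecomp N ![1, 𝔞] ![v', w'])
    (hπ : π ![v, w] = 1) :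
    moduleIndex K M N = Submodule.span R {π ![v', w']} := by
  apply le_antisymm
  · let g : V ≃ₗ[K] V := (pairBasis hV hM.1).equiv (pairBasis hV hN.1) (Equiv.refl _)
    have hg0 : g v = v' := by
      have := (pairBasis hV hM.1).equiv_apply 0 (pairBasis hV hN.1) (Equiv.refl _)
      rwa [coe_pairBasis, coe_pairBasis] at this
    have hg1 : g w = w' := by
      have := (pairBasis hV hM.1).equiv_apply 1 (pairBasis hV hN.1) (Equiv.refl _)
      rwa [coe_pairBasis, coe_pairBasis] at this
    have hdet : LinearMap.det (g : V →ₗ[K] V) = π ![v', w'] := by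
      have := alt_map_det π hV (g : V →ₗ[K] V) v w
      rw [hπ, mul_one] at this
      rw [← this, LinearEquiv.coe_coe, hg0, hg1]
    have hgM : M.map ((g : V →ₗ[K] V).restrictScalars R) = N := by
      ext x
      rw [hN.mem_iff]
      constructor
      · rintro ⟨y, hy, rfl⟩
        obtain ⟨s, hs, t, ht, rfl⟩ := (hM.mem_iff y).1 hy
        exact ⟨s, hs, t, ht, by simp [hg0, hg1]⟩
      · rintro ⟨s, hs, t, ht, rfl⟩
        exact ⟨s • v + t • w, (hM.mem_iff _).2 ⟨s, hs, t, ht, rfl⟩, by simp [hg0, hg1]⟩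
    intro x hx
    refine mem_of_forall_localAt fun p => ?_
    simp only [moduleIndex, Submodule.mem_iInf] at hx
    rw [← hdet]
    exact hx p g (by rw [map_localAt, hgM])
  · refine le_iInf fun p => le_iInf fun g => le_iInf fun hg => ?_
    rw [Submodule.span_singleton_le_iff_mem]
    set D := LinearMap.det (g : V →ₗ[K] V) with hD
    -- Only tw' with t ∈ 𝔞 is known to lie in N, not w' itself. The second vector is therefore
    -- tested against products tu with u ∈ 𝔞⁻¹, and 1 ∈ 𝔞𝔞⁻¹ recovers the claim for π(v' ∧ w').
    have h1 : ∀ t ∈ (𝔞 : FractionalIdeal R⁰ K),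
        ∀ u ∈ ((𝔞⁻¹ : (FractionalIdeal R⁰ K)ˣ) : FractionalIdeal R⁰ K),
        (t * u) * π ![v', w'] ∈ localAt p (Submodule.span R {D}) := by
      intro t ht u hu
      have hv' : v' ∈ localAt p N := le_localAt p N ((hN.mem_iff _).2
        ⟨1, by simp, 0, FractionalIdeal.zero_mem _, by module⟩)
      have hw' : t • w' ∈ localAt p N := le_localAt p N ((hN.mem_iff _).2
        ⟨0, FractionalIdeal.zero_mem _, t, ht, by module⟩)
      rw [← hg] at hv' hw'
      obtain ⟨x, ⟨r, hr, hx⟩, hxv⟩ := hv'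
      obtain ⟨y, ⟨r', hr', hy⟩, hyw⟩ := hw'
      refine ⟨r * r', fun h => (p.isPrime.mem_or_mem h).elim hr hr', ?_⟩
      obtain ⟨a, ha, b, hb, hab⟩ := (hM.mem_iff _).1 hx
      obtain ⟨c, hc, d, hd, hcd⟩ := (hM.mem_iff _).1 hy
      have h2 : algebraMap R K r * algebraMap R K r' * π ![x, y] = a * d - b * c := by
        have := alt_comb π a b c d v w
        rw [hπ, mul_one, ← hab, ← hcd, ← algebraMap_smul K r x, ← algebraMap_smul K r' y,
          alt_smul_left, alt_smul_right] at this
        rw [← this]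
        ring
      have h3 : t * π ![v', w'] = D * π ![x, y] := by
        rw [← alt_map_det π hV, ← alt_smul_right]
        rw [← hxv, ← hyw]
        rfl
      have h4 : (a * d - b * c) * u ∈ (1 : FractionalIdeal R⁰ K) := by
        refine mul_mem_of_eq (unit_mul_inv 𝔞) (frac_sub_mem (mul_mem_of_eq ?_ ha hd)
          (mul_mem_of_eq ?_ hb hc)) hu
        · simp
        · simp
      obtain ⟨e, he⟩ := (FractionalIdeal.mem_one_iff R⁰).1 h4
      refine Submodule.mem_span_singleton.2 ⟨e, ?_⟩
      rw [Algebra.smul_def, Algebra.smul_def, he, map_mul, ← h2]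
      linear_combination (-algebraMap R K r * algebraMap R K r' * u) * h3
    have h2 : (1 : K) ∈ (𝔞 : FractionalIdeal R⁰ K) *
        ((𝔞⁻¹ : (FractionalIdeal R⁰ K)ˣ) : FractionalIdeal R⁰ K) := by
      rw [unit_mul_inv]
      exact one_mem_frac_one
    have h3 : ∀ z ∈ (𝔞 : FractionalIdeal R⁰ K) *
        ((𝔞⁻¹ : (FractionalIdeal R⁰ K)ˣ) : FractionalIdeal R⁰ K),
        z * π ![v', w'] ∈ localAt p (Submodule.span R {D}) := by
      intro z hz
      rw [← FractionalIdeal.mem_coe, FractionalIdeal.coe_mul] at hz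
      refine Submodule.mul_induction_on hz h1 fun x y hx hy => ?_
      rw [add_mul]
      exact Submodule.add_mem _ hx hy
    simpa using h3 1 h2

end Wedge

/-! ### Quadratic algebras and the covariant identities -/

section Quadratic

variable {K : Type v} [Field K] {L : Type*} [CommRing L] [Algebra K L]

/-- A `K`-algebra with basis `1, θ` is a quadratic algebra. -/
theorem exists_quadraticAlgebra_equiv (hL : Module.finrank K L = 2) {θ : L}
    (hi : LinearIndependent K ![1, θ]) {A B : K} (h : θ * θ = A • 1 + B • θ) :
    ∃ e : QuadraticAlgebra K A B ≃ₐ[K] L, e QuadraticAlgebra.omega = θ ∧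
      ∀ x, e x = x.re • 1 + x.im • θ := by
  let f : QuadraticAlgebra K A B →ₐ[K] L := QuadraticAlgebra.lift ⟨θ, h⟩
  have hf : ∀ x, f x = x.re • 1 + x.im • θ := by
    intro x
    simp [f, QuadraticAlgebra.lift]
  have hb : Function.Bijective f := by
    constructor
    · refine (injective_iff_map_eq_zero f).2 fun x hx => ?_
      rw [hf] at hx
      obtain ⟨h1, h2⟩ := LinearIndependent.pair_iff.1 hi _ _ hx
      exact QuadraticAlgebra.ext h1 h2
    · intro y
      obtain ⟨a, b, rfl⟩ := exists_coords hL hi y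
      exact ⟨⟨a, b⟩, hf _⟩
  refine ⟨AlgEquiv.ofBijective f hb, ?_, hf⟩
  rw [AlgEquiv.ofBijective_apply, hf]
  simp

theorem QuadraticAlgebra.algebraNorm_eq {A B : K} (x : QuadraticAlgebra K A B) :
    Algebra.norm K x = x.norm := by
  rw [Algebra.norm_apply, ← QuadraticAlgebra.det_toLinearMap_eq_norm]
  congr 1

/-- This is minus the Gram determinant of the bilinear form (u, v) ↦ im(zuv), which scales by the
squared determinant of (x, y). Taking z = αl and z = βl turns the outer Hessian covariants of the
cubic form into multiples of N(α) and N(β). -/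
theorem hessian_of_functional {A B : K} (x y z : QuadraticAlgebra K A B) :
    (z * x * y).im ^ 2 - (z * x ^ 2).im * (z * y ^ 2).im =
      (x.re * y.im - x.im * y.re) ^ 2 * z.norm := by
  simp only [pow_two, QuadraticAlgebra.norm_def, QuadraticAlgebra.im_mul, QuadraticAlgebra.re_mul]
  ring

/-- The companion identity for the mixed covariant, in which the trace Tr(x̄y), the polarization of
the norm, replaces the norm. -/
theorem hessian_middle {A B : K} (x y z : QuadraticAlgebra K A B) :
    (x ^ 2 * y * z).im * (x * y ^ 2 * z).im - (x ^ 3 * z).im * (y ^ 3 * z).im =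
      (x.re * y.im - x.im * y.re) ^ 2 * z.norm * (star x * y).trace := by
  simp only [pow_two, pow_three, QuadraticAlgebra.norm_def, QuadraticAlgebra.im_mul,
    QuadraticAlgebra.re_mul, QuadraticAlgebra.trace_def, QuadraticAlgebra.re_star,
    QuadraticAlgebra.im_star]
  ring

/-- The covariants of the cubic form attached to `α, β, l`. -/
theorem exists_conjugates_quadraticAlgebra {A B : K} {α β l : QuadraticAlgebra K A B} {s a b c d : K}
    (hs : α.re * β.im - α.im * β.re = s) (hl : s ^ 3 * l.norm = 1)
    (ha : a = (α ^ 3 * l).im) (hb : b = (α ^ 2 * β * l).im) (hc : c = (α * β ^ 2 * l).im)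
    (hd : d = (β ^ 3 * l).im) :
    ∃ θ α' β' : QuadraticAlgebra K A B, θ.im = 1 ∧ α * α' = (b ^ 2 - a * c) • 1 ∧ α' * β = θ ∧
      α * β' = (b * c - a * d) • 1 - θ ∧ β * β' = (c ^ 2 - b * d) • 1 := by
  have hs0 : s ≠ 0 := by
    rintro rfl
    simp at hl
  have hp : b ^ 2 - a * c = s⁻¹ * α.norm := by
    have h := hessian_of_functional α β (α * l)
    rw [hs, map_mul] at h
    have h1 : b ^ 2 - a * c = s ^ 2 * (α.norm * l.norm) := by
      rw [← h, ha, hb, hc]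
      ring_nf
    field_simp
    rw [h1]
    linear_combination α.norm * hl
  have hr : c ^ 2 - b * d = s⁻¹ * β.norm := by
    have h := hessian_of_functional α β (β * l)
    rw [hs, map_mul] at h
    have h1 : c ^ 2 - b * d = s ^ 2 * (β.norm * l.norm) := by
      rw [← h, hd, hb, hc]
      ring_nf
    field_simp
    rw [h1]
    linear_combination β.norm * hl
  have hm : b * c - a * d = s⁻¹ * (star α * β).trace := by
    have h := hessian_middle α β l
    rw [← ha, ← hb, ← hc, ← hd, hs] at h
    field_simp
    rw [h]
    linear_combination (star α * β).trace * hl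
  -- The scaling by s⁻¹ makes θ = s⁻¹ᾱβ have ω-coordinate 1, because that of ᾱβ is the determinant s
  -- of (α, β). The balance condition then turns the covariants into s⁻¹N(α), s⁻¹Tr(ᾱβ) and s⁻¹N(β).
  refine ⟨s⁻¹ • (star α * β), s⁻¹ • star α, s⁻¹ • star β, ?_, ?_, ?_, ?_, ?_⟩
  · have : (star α * β).im = s := by
      rw [← hs]
      simp only [QuadraticAlgebra.im_mul, QuadraticAlgebra.re_star, QuadraticAlgebra.im_star]
      ring
    rw [QuadraticAlgebra.im_smul, this, smul_eq_mul, inv_mul_cancel₀ hs0]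
  · rw [hp, mul_smul_comm, ← QuadraticAlgebra.algebraMap_norm_eq_mul_star, mul_smul,
      Algebra.algebraMap_eq_smul_one]
  · rw [smul_mul_assoc]
  · rw [hm, mul_smul_comm, mul_smul, ← smul_sub]
    congr 1
    ext
    · simp [QuadraticAlgebra.trace_def, QuadraticAlgebra.re_one]
      ring
    · simp [QuadraticAlgebra.im_one]
      ring
  · rw [hr, mul_smul_comm, ← QuadraticAlgebra.algebraMap_norm_eq_mul_star, mul_smul,
      Algebra.algebraMap_eq_smul_one]

/-- The norm is by definition the determinant of multiplication by z. This accounts for s' = N(κ)s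
in the equivalence of quadruples. -/
theorem norm_mul_alt (hL : Module.finrank K L = 2) (π : L [⋀^Fin 2]→ₗ[K] K) (z x y : L) :
    π ![z * x, z * y] = Algebra.norm K z * π ![x, y] := by
  rw [Algebra.norm_apply, ← alt_map_det π hL]
  rfl

theorem exists_mul_self_eq (hL : Module.finrank K L = 2) {θ : L}
    (hi : LinearIndependent K ![1, θ]) : ∃ A B : K, θ * θ = A • 1 + B • θ :=
  exists_coords hL hi (θ * θ)

/-- Conjugation is available once L is identified with a quadratic algebra by the basis 1, ξ; the
functional π(1 ∧ ·) then becomes the ω-coordinate. The algebra L may be split, so none of the four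
relations involves division by α or β. -/
theorem exists_conjugates (hL : Module.finrank K L = 2) (π : L [⋀^Fin 2]→ₗ[K] K) {ξ : L}
    (hξ : π ![1, ξ] = 1) {α β l : L} {s a b c d : K} (hs : π ![α, β] = s)
    (hl : s ^ 3 * Algebra.norm K l = 1)
    (ha : a = π ![1, α ^ 3 * l]) (hb : b = π ![1, α ^ 2 * β * l]) (hc : c = π ![1, α * β ^ 2 * l])
    (hd : d = π ![1, β ^ 3 * l]) :
    ∃ θ α' β' : L, π ![1, θ] = 1 ∧ α * α' = (b ^ 2 - a * c) • 1 ∧ α' * β = θ ∧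
      α * β' = (b * c - a * d) • 1 - θ ∧ β * β' = (c ^ 2 - b * d) • 1 := by
  have hi : LinearIndependent K ![1, ξ] := linearIndependent_of_alt_ne_zero π (by simp [hξ])
  obtain ⟨A, B, hAB⟩ := exists_mul_self_eq hL hi
  obtain ⟨e, -, he⟩ := exists_quadraticAlgebra_equiv hL hi hAB
  have hπ : ∀ x y : QuadraticAlgebra K A B, π ![e x, e y] = x.re * y.im - x.im * y.re := by
    intro x y
    rw [he, he, alt_comb, hξ, mul_one]
  have hπ1 : ∀ y : QuadraticAlgebra K A B, π ![1, e y] = y.im := by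
    intro y
    rw [← map_one e, hπ]
    simp [QuadraticAlgebra.re_one, QuadraticAlgebra.im_one]
  obtain ⟨α, rfl⟩ := e.surjective α
  obtain ⟨β, rfl⟩ := e.surjective β
  obtain ⟨l, rfl⟩ := e.surjective l
  rw [← map_pow, ← map_mul, hπ1] at ha hd
  rw [← map_pow, ← map_mul, ← map_mul, hπ1] at hb hc
  rw [hπ] at hs
  rw [Algebra.norm_eq_of_algEquiv, QuadraticAlgebra.algebraNorm_eq] at hl
  obtain ⟨θ, α', β', h1, h2, h3, h4, h5⟩ :=
    exists_conjugates_quadraticAlgebra hs hl ha hb hc hd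
  refine ⟨e θ, e α', e β', by rw [hπ1, h1], ?_, ?_, ?_, ?_⟩
  · rw [← map_mul, h2, map_smul, map_one]
  · rw [← map_mul, h3]
  · rw [← map_mul, h4, map_sub, map_smul, map_one]
  · rw [← map_mul, h5, map_smul, map_one]

/-- The discriminant of a pair of elements of a quadratic algebra. -/
theorem discr_pair (hL : Module.finrank K L = 2) (π : L [⋀^Fin 2]→ₗ[K] K) {θ : L}
    (hθ : π ![1, θ] = 1) {A B : K} (h : θ * θ = A • 1 + B • θ) (ξ : Fin 2 → L) :
    Algebra.discr K ξ = π ![ξ 0, ξ 1] ^ 2 * (B ^ 2 + 4 * A) := by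
  have hi : LinearIndependent K ![1, θ] := linearIndependent_of_alt_ne_zero π (by simp [hθ])
  obtain ⟨e, -, he⟩ := exists_quadraticAlgebra_equiv hL hi h
  have htr : ∀ x : QuadraticAlgebra K A B, Algebra.trace K L (e x) = 2 * x.re + B * x.im := by
    intro x
    rw [Algebra.trace_eq_of_algEquiv, Algebra.trace_eq_matrix_trace (QuadraticAlgebra.basis A B),
      Matrix.trace_fin_two, Algebra.leftMulMatrix_eq_repr_mul, Algebra.leftMulMatrix_eq_repr_mul]
    simp [QuadraticAlgebra.basis]
    ring
  obtain ⟨x, hx⟩ := e.surjective (ξ 0)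
  obtain ⟨y, hy⟩ := e.surjective (ξ 1)
  rw [Algebra.discr_def, Matrix.det_fin_two]
  simp only [Algebra.traceMatrix_apply, Algebra.traceForm_apply, ← hx, ← hy, ← map_mul, htr]
  rw [he, he, alt_comb, hθ]
  simp only [QuadraticAlgebra.re_mul, QuadraticAlgebra.im_mul]
  ring

theorem traceForm_nondegenerate_iff (hL : Module.finrank K L = 2) (π : L [⋀^Fin 2]→ₗ[K] K) {θ : L}
    (hθ : π ![1, θ] = 1) {A B : K} (h : θ * θ = A • 1 + B • θ) :
    (Algebra.traceForm K L).Nondegenerate ↔ B ^ 2 + 4 * A ≠ 0 := by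
  have hi : LinearIndependent K ![1, θ] := linearIndependent_of_alt_ne_zero π (by simp [hθ])
  have h1 := discr_pair hL π hθ h ![1, θ]
  simp only [Matrix.cons_val_zero, Matrix.cons_val_one, hθ, one_pow, one_mul] at h1
  rw [← h1, ← coe_pairBasis hL hi, Algebra.discr_def, Algebra.traceMatrix_of_basis]
  exact LinearMap.BilinForm.nondegenerate_iff_det_ne_zero _

end Quadratic

/-! ### Integrality and decompositions R + 𝔞ξ of an order -/

section Integral

variable {R : Type u} [CommRing R] [IsDedekindDomain R]
  {K : Type v} [Field K] [Algebra R K] [IsFractionRing R K]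
  {L : Type*} [CommRing L] [Algebra K L] [Algebra R L] [IsScalarTower R K L]

theorem mem_one_of_isIntegral [Nontrivial L] {x : K} (hx : IsIntegral R (x • (1 : L))) :
    x ∈ (1 : FractionalIdeal R⁰ K) := by
  rw [← Algebra.algebraMap_eq_smul_one,
    isIntegral_algebraMap_iff (FaithfulSMul.algebraMap_injective K L)] at hx
  obtain ⟨r, rfl⟩ := IsIntegrallyClosed.isIntegral_iff.1 hx
  exact (FractionalIdeal.mem_one_iff R⁰).2 ⟨r, rfl⟩

/-- An order of the form `R v + 𝔞 w` is also of the form `R + 𝔞 ξ`. -/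
theorem IsSteinitzDecomp.exists_one [Nontrivial L] {M : Submodule R L}
    {𝔞 : (FractionalIdeal R⁰ K)ˣ} {v w : L} (h : IsSteinitzDecomp M ![1, 𝔞] ![v, w])
    (h1 : (1 : L) ∈ M) (hint : ∀ x ∈ M, IsIntegral R x) :
    ∃ ξ : L, IsSteinitzDecomp M ![1, 𝔞] ![1, ξ] := by
  obtain ⟨p, hp, q, hq, hpq⟩ := (h.mem_iff 1).1 h1
  rw [Units.val_one] at hp
  -- J is the content of the vector 1 = pv + qw relative to the decomposition. Showing 1 ∈ J means
  -- that 1 can be completed to a decomposition.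
  set J : FractionalIdeal R⁰ K := FractionalIdeal.spanSingleton R⁰ p +
    FractionalIdeal.spanSingleton R⁰ q *
      ((𝔞⁻¹ : (FractionalIdeal R⁰ K)ˣ) : FractionalIdeal R⁰ K) with hJ
  have hpJ : p ∈ J := by
    rw [hJ, FractionalIdeal.mem_add]
    exact ⟨p, FractionalIdeal.mem_spanSingleton_self R⁰ p, 0, FractionalIdeal.zero_mem _, by simp⟩
  have hqJ : ∀ t ∈ ((𝔞⁻¹ : (FractionalIdeal R⁰ K)ˣ) : FractionalIdeal R⁰ K), q * t ∈ J := by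
    intro t ht
    rw [hJ, FractionalIdeal.mem_add]
    exact ⟨0, FractionalIdeal.zero_mem _, q * t, FractionalIdeal.mem_singleton_mul.2 ⟨t, ht, rfl⟩,
      by simp⟩
  have hJ0 : J ≠ 0 := by
    intro h0
    have h2 := hpJ
    rw [h0, FractionalIdeal.mem_zero_iff] at h2
    obtain ⟨t, ht, ht0⟩ := exists_ne_zero_mem 𝔞⁻¹
    have h3 := hqJ t ht
    rw [h0, FractionalIdeal.mem_zero_iff] at h3
    have h4 := (mul_eq_zero.1 h3).resolve_right ht0
    rw [h2, h4, zero_smul, zero_smul, add_zero] at hpq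
    exact one_ne_zero hpq
  -- If x ∈ J⁻¹, then the coordinates of x·1 are admissible, so x·1 lies in M and is integral;
  -- integral closedness gives x ∈ R. Thus J⁻¹ ⊆ R, and multiplying by J gives 1 ∈ J.
  have hJ1 : ((Units.mk0 J hJ0)⁻¹ : (FractionalIdeal R⁰ K)ˣ).val ≤ 1 := by
    intro x hx
    refine mem_one_of_isIntegral (L := L) (hint _ ((h.mem_iff _).2 ⟨x * p, ?_, x * q, ?_, ?_⟩))
    · rw [Units.val_one]
      exact mul_mem_of_eq (inv_mul_unit (Units.mk0 J hJ0)) hx hpJ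
    · have := mem_inv_of_forall (𝔞 := 𝔞⁻¹) (x := x * q) fun t ht => by
        rw [mul_assoc]
        exact mul_mem_of_eq (inv_mul_unit (Units.mk0 J hJ0)) hx (hqJ t ht)
      rwa [inv_inv] at this
    · rw [hpq]
      module
  have h2 : (1 : K) ∈ J := by
    have h3 := mul_le_mul_right hJ1 J
    have h4 := unit_mul_inv (Units.mk0 J hJ0)
    rw [Units.val_mk0] at h4
    rw [h4, mul_one] at h3
    exact h3 one_mem_frac_one
  rw [hJ, FractionalIdeal.mem_add] at h2
  obtain ⟨y, hy, z, hz, hyz⟩ := h2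
  obtain ⟨r, rfl⟩ := (FractionalIdeal.mem_spanSingleton R⁰).1 hy
  obtain ⟨t, ht, rfl⟩ := FractionalIdeal.mem_singleton_mul.1 hz
  have h5 := IsSteinitzDecomp.change h (p := p) (q := q) (r := algebraMap R K r) (t := t)
    (by simpa using hp) hq (by
      rw [inv_one, Units.val_one]
      exact (FractionalIdeal.mem_one_iff R⁰).2 ⟨r, rfl⟩) ht (by
      rw [← hyz, Algebra.smul_def, mul_comm])
  rw [← hpq, one_mul] at h5
  exact ⟨_, h5⟩

theorem singleton_unit (u : Rˣ) : FractionalIdeal.spanSingleton R⁰ (algebraMap R K u) = 1 := by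
  apply le_antisymm
  · rw [FractionalIdeal.spanSingleton_le_iff_mem]
    exact (FractionalIdeal.mem_one_iff R⁰).2 ⟨u, rfl⟩
  · rw [← FractionalIdeal.spanSingleton_one, FractionalIdeal.spanSingleton_le_iff_mem,
      FractionalIdeal.mem_spanSingleton]
    exact ⟨((u⁻¹ : Rˣ) : R), by rw [Algebra.smul_def, ← map_mul, Units.inv_mul, map_one]⟩

/-- The second vector of a decomposition may be multiplied by a unit. -/
theorem IsSteinitzDecomp.unit_smul {V : Type*} [AddCommGroup V] [Module K V] [Module R V]
    [IsScalarTower R K V] {M : Submodule R V} {𝔟 𝔠 : (FractionalIdeal R⁰ K)ˣ} {v w : V}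
    (h : IsSteinitzDecomp M ![𝔟, 𝔠] ![v, w]) (u : Rˣ) :
    IsSteinitzDecomp M ![𝔟, 𝔠] ![v, algebraMap R K u • w] := by
  refine h.rescale ?_ ?_
  · exact (u.isUnit.map (algebraMap R K)).ne_zero
  · rw [singleton_unit, one_mul]

/-- Translating `θ` by a scalar preserves the order as soon as the multiples of both elements
by `𝔞` are integral. -/
theorem IsSteinitzDecomp.translate [Nontrivial L] {M : Submodule R L} {𝔞 : (FractionalIdeal R⁰ K)ˣ}
    {ξ θ : L} (h : IsSteinitzDecomp M ![1, 𝔞] ![1, ξ]) (hint : ∀ x ∈ M, IsIntegral R x) {k : K}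
    (hk : θ = k • 1 + ξ)
    (hθ : ∀ t ∈ (𝔞 : FractionalIdeal R⁰ K), IsIntegral R (t • θ)) :
    IsSteinitzDecomp M ![1, 𝔞] ![1, θ] := by
  -- The scalar tk is tθ − tξ, a difference of integral elements of L, hence lies in R because R is
  -- integrally closed.
  have hk1 : ∀ t ∈ (𝔞 : FractionalIdeal R⁰ K), t * k ∈ (1 : FractionalIdeal R⁰ K) := by
    intro t ht
    refine mem_one_of_isIntegral (L := L) ?_
    have h2 := (hθ t ht).sub (hint (t • ξ) ((h.mem_iff _).2
      ⟨0, FractionalIdeal.zero_mem _, t, ht, by module⟩))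
    have h3 : t • θ - t • ξ = (t * k) • (1 : L) := by
      rw [hk]
      module
    rwa [h3] at h2
  refine IsSteinitzDecomp.mk ?_ fun x => ?_
  · refine LinearIndependent.pair_iff.2 fun s t hst => ?_
    obtain ⟨h1, h2⟩ := LinearIndependent.pair_iff.1 h.1 (s + t * k) t (by
      rw [← hst, hk]
      module)
    rw [h2] at h1
    simp at h1
    exact ⟨h1, h2⟩
  · rw [h.mem_iff, Units.val_one]
    constructor
    · rintro ⟨s, hs, t, ht, rfl⟩
      refine ⟨s - t * k, frac_sub_mem hs (hk1 t ht), t, ht, ?_⟩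
      rw [hk]
      module
    · rintro ⟨s, hs, t, ht, rfl⟩
      refine ⟨s + t * k, frac_add_mem hs (hk1 t ht), t, ht, ?_⟩
      rw [hk]
      module

theorem isIntegral_of_quadratic {x : L} {b c : K} (hb : b ∈ (1 : FractionalIdeal R⁰ K))
    (hc : c ∈ (1 : FractionalIdeal R⁰ K)) (h : x * x = b • x + c • 1) : IsIntegral R x := by
  obtain ⟨b, rfl⟩ := (FractionalIdeal.mem_one_iff R⁰).1 hb
  obtain ⟨c, rfl⟩ := (FractionalIdeal.mem_one_iff R⁰).1 hc
  rw [algebraMap_smul, algebraMap_smul] at h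
  refine ⟨Polynomial.X ^ 2 - (Polynomial.C b * Polynomial.X + Polynomial.C c), ?_, ?_⟩
  · exact Polynomial.monic_X_pow_sub (Polynomial.degree_linear_lt)
  · simp only [Polynomial.eval₂_sub, Polynomial.eval₂_add, Polynomial.eval₂_mul,
      Polynomial.eval₂_C, Polynomial.eval₂_X, Polynomial.eval₂_X_pow]
    rw [pow_two, h, Algebra.smul_def, Algebra.smul_def]
    ring

end Integral

/-! ### Coefficients, discriminant and explicit action on cubic forms -/

section FormAlgebra

variable {K : Type v} [Field K]

open MvPolynomial in
theorem cubicForm_eq_monomial (a b c d : K) :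
    cubicForm a b c d = monomial (Finsupp.single 0 3 + Finsupp.single 1 0) a +
      monomial (Finsupp.single 0 2 + Finsupp.single 1 1) (3 * b) +
      monomial (Finsupp.single 0 1 + Finsupp.single 1 2) (3 * c) +
      monomial (Finsupp.single 0 0 + Finsupp.single 1 3) d := by
  have h : ∀ (i j : ℕ) (x : K), (monomial (Finsupp.single (0 : Fin 2) i + Finsupp.single 1 j) x :
      MvPolynomial (Fin 2) K) = C x * X 0 ^ i * X 1 ^ j := by
    intro i j x
    rw [X_pow_eq_monomial, X_pow_eq_monomial, C_mul_monomial, monomial_mul]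
    simp
  rw [h, h, h, h, cubicForm]
  simp only [map_mul, map_ofNat]
  ring

theorem formCoeff_cubicForm (a b c d : K) :
    formCoeff 3 0 (cubicForm a b c d) = a ∧ formCoeff 2 1 (cubicForm a b c d) = 3 * b ∧
      formCoeff 1 2 (cubicForm a b c d) = 3 * c ∧ formCoeff 0 3 (cubicForm a b c d) = d := by
  rw [cubicForm_eq_monomial]
  refine ⟨?_, ?_, ?_, ?_⟩ <;>
    simp [formCoeff, MvPolynomial.coeff_monomial, Finsupp.ext_iff, Fin.forall_fin_two]

theorem cubicForm_injective (h3 : (3 : K) ≠ 0) {a b c d a' b' c' d' : K}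
    (h : cubicForm a b c d = cubicForm a' b' c' d') : a = a' ∧ b = b' ∧ c = c' ∧ d = d' := by
  obtain ⟨h1, h2, h4, h5⟩ := formCoeff_cubicForm a b c d
  obtain ⟨h1', h2', h4', h5'⟩ := formCoeff_cubicForm a' b' c' d'
  rw [h] at h1 h2 h4 h5
  exact ⟨h1.symm.trans h1', mul_left_cancel₀ h3 (h2.symm.trans h2'),
    mul_left_cancel₀ h3 (h4.symm.trans h4'), h5.symm.trans h5'⟩

/-- Written in the covariants as m² + 4(−pr), so that it matches the expression B² + 4A of
`discr_pair` for θ² = −pr + mθ. -/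
theorem disc_cubicForm (h3 : (3 : K) ≠ 0) (a b c d : K) :
    disc (cubicForm a b c d) =
      (b * c - a * d) ^ 2 + 4 * -((b ^ 2 - a * c) * (c ^ 2 - b * d)) := by
  obtain ⟨h1, h2, h4, h5⟩ := formCoeff_cubicForm a b c d
  have h27 : (27 : K) ≠ 0 := by
    have : (27 : K) = 3 ^ 3 := by norm_num
    rw [this]
    exact pow_ne_zero _ h3
  rw [disc, h1, h2, h4, h5, Cubic.discr]
  field_simp
  ring

theorem act_cubicForm (g : GL (Fin 2) K) (a b c d : K) :
    act g (cubicForm a b c d) =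
      cubicForm
        (g.val.det⁻¹ * (a * g.val 0 0 ^ 3 + 3 * b * g.val 0 0 ^ 2 * g.val 0 1 +
          3 * c * g.val 0 0 * g.val 0 1 ^ 2 + d * g.val 0 1 ^ 3))
        (g.val.det⁻¹ * (a * g.val 0 0 ^ 2 * g.val 1 0 +
          b * (g.val 0 0 ^ 2 * g.val 1 1 + 2 * g.val 0 0 * g.val 0 1 * g.val 1 0) +
          c * (2 * g.val 0 0 * g.val 0 1 * g.val 1 1 + g.val 0 1 ^ 2 * g.val 1 0) +
          d * g.val 0 1 ^ 2 * g.val 1 1))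
        (g.val.det⁻¹ * (a * g.val 0 0 * g.val 1 0 ^ 2 +
          b * (g.val 1 0 ^ 2 * g.val 0 1 + 2 * g.val 0 0 * g.val 1 0 * g.val 1 1) +
          c * (2 * g.val 0 1 * g.val 1 0 * g.val 1 1 + g.val 1 1 ^ 2 * g.val 0 0) +
          d * g.val 0 1 * g.val 1 1 ^ 2))
        (g.val.det⁻¹ * (a * g.val 1 0 ^ 3 + 3 * b * g.val 1 0 ^ 2 * g.val 1 1 +
          3 * c * g.val 1 0 * g.val 1 1 ^ 2 + d * g.val 1 1 ^ 3)) := by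
  have hdet : (g.det⁻¹ : Kˣ).val = g.val.det⁻¹ := by
    rw [Units.val_inv_eq_inv_val]
    rfl
  rw [act, hdet]
  simp only [cubicForm, map_add, map_mul, map_pow, MvPolynomial.bind₁_X_right,
    MvPolynomial.bind₁_C_right, Fin.sum_univ_two, map_ofNat]
  ring

theorem three_ne_zero_of_ringChar {R : Type u} [CommRing R] [IsDomain R] [Algebra R K]
    [FaithfulSMul R K] (hR : ringChar R ≠ 3) : (3 : K) ≠ 0 := by
  intro h
  have h1 : ((3 : ℕ) : R) = 0 := by
    apply FaithfulSMul.algebraMap_injective R K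
    rw [map_natCast, map_zero]
    exact_mod_cast h
  rcases (Nat.dvd_prime Nat.prime_three).1 (ringChar.dvd h1) with h2 | h2
  · have h3 := ringChar.Nat.cast_ringChar (R := R)
    rw [h2] at h3
    simp at h3
  · exact hR h2

end FormAlgebra

/-! ### The order inside its ambient algebra, and orientations -/

section RingLattice

variable {R : Type u} [CommRing R] [IsDedekindDomain R]
  {K : Type v} [Field K] [Algebra R K] [IsFractionRing R K]
  {S : Type*} [CommRing S] [Algebra R S]

theorem mem_ringLattice {x : K ⊗[R] S} : x ∈ ringLattice R K S ↔ ∃ y : S, (1 : K) ⊗ₜ[R] y = x :=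
  Iff.rfl

theorem one_mem_ringLattice : (1 : K ⊗[R] S) ∈ ringLattice R K S := ⟨1, rfl⟩

theorem span_ringLattice : Submodule.span K (ringLattice R K S : Set (K ⊗[R] S)) = ⊤ := by
  refine eq_top_iff.2 fun x _ => ?_
  induction x using TensorProduct.induction_on with
  | zero => exact Submodule.zero_mem _
  | tmul k y =>
    have : k ⊗ₜ[R] y = k • ((1 : K) ⊗ₜ[R] y) := by simp [TensorProduct.smul_tmul']
    rw [this]
    exact Submodule.smul_mem _ _ (Submodule.subset_span ⟨y, rfl⟩)
  | add x y hx hy => exact Submodule.add_mem _ (hx trivial) (hy trivial)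

theorem isIntegral_of_mem_ringLattice [Module.Finite R S] {x : K ⊗[R] S}
    (hx : x ∈ ringLattice R K S) : IsIntegral R x := by
  obtain ⟨y, rfl⟩ := mem_ringLattice.1 hx
  have : IsIntegral R y := Algebra.IsIntegral.isIntegral y
  exact this.map (Algebra.TensorProduct.includeRight : S →ₐ[R] K ⊗[R] S)

/-- Extension of scalars to the fraction field is localization at the nonzero elements. Hence the
kernel of S → L is the torsion of S, and every element of L has a denominator in R. -/
instance isLocalizedModule_mk (M : Type*) [AddCommGroup M] [Module R M] :
    IsLocalizedModule R⁰ (TensorProduct.mk R K M 1) :=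
  (isLocalizedModule_iff_isBaseChange R⁰ K _).2 (TensorProduct.isBaseChange R M K)

theorem includeRight_injective [Module.IsTorsionFree R S] :
    Function.Injective (Algebra.TensorProduct.includeRight : S →ₐ[R] K ⊗[R] S) := by
  refine (injective_iff_map_eq_zero _).2 fun x hx => ?_
  have h1 : TensorProduct.mk R K S 1 x = 0 := hx
  rw [IsLocalizedModule.eq_zero_iff R⁰] at h1
  obtain ⟨c, hc⟩ := h1
  exact (smul_eq_zero.1 hc).resolve_left (nonZeroDivisors.ne_zero c.2)

theorem exists_smul_mem_ringLattice (x : K ⊗[R] S) :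
    ∃ r : R, r ≠ 0 ∧ ∃ y : S, (1 : K) ⊗ₜ[R] y = r • x := by
  obtain ⟨⟨y, r⟩, h⟩ := IsLocalizedModule.surj R⁰ (TensorProduct.mk R K S 1) x
  exact ⟨r, nonZeroDivisors.ne_zero r.2, y, h.symm⟩

/-- An isomorphism of ambient algebras that matches the orders comes from the orders. -/
theorem exists_extendEquiv_eq {S' : Type*} [CommRing S'] [Algebra R S']
    [Module.IsTorsionFree R S] [Module.IsTorsionFree R S']
    (ψ : (K ⊗[R] S) ≃ₐ[K] (K ⊗[R] S'))
    (h : ∀ x, ψ x ∈ ringLattice R K S' ↔ x ∈ ringLattice R K S) :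
    ∃ φ : S ≃ₐ[R] S', extendEquiv K φ = ψ := by
  let i : S →ₐ[R] K ⊗[R] S := Algebra.TensorProduct.includeRight
  let i' : S' →ₐ[R] K ⊗[R] S' := Algebra.TensorProduct.includeRight
  have hi : Function.Injective i := includeRight_injective
  have hi' : Function.Injective i' := includeRight_injective
  have h1 : ∀ x : S, ∃ y : S', i' y = ψ (i x) := fun x => (h (i x)).2 ⟨x, rfl⟩
  choose g hg using h1
  have hψR : ∀ (r : R) (x : K ⊗[R] S), ψ (r • x) = r • ψ x := fun r x => by
    rw [← algebraMap_smul K r x, map_smul, algebraMap_smul]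
  let f : S →ₐ[R] S' := AlgHom.ofLinearMap
    { toFun := g
      map_add' := fun x y => hi' (by simp only [map_add, hg])
      map_smul' := fun r x => hi' (by simp only [map_smul, hg, hψR, RingHom.id_apply]) }
    (hi' (by
      change i' (g 1) = i' 1
      rw [hg, map_one, map_one, map_one]))
    (fun x y => hi' (by
      change i' (g (x * y)) = i' (g x * g y)
      simp only [map_mul, hg]))
  have hf : ∀ x, i' (f x) = ψ (i x) := hg
  have hb : Function.Bijective f := by
    constructor
    · intro x y hxy
      apply hi
      apply ψ.injective
      rw [← hf, ← hf, hxy]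
    · intro y
      obtain ⟨x, hx⟩ := (h (ψ.symm (i' y))).1 (by
        rw [ψ.apply_symm_apply]
        exact ⟨y, rfl⟩)
      refine ⟨x, hi' ?_⟩
      rw [hf]
      have : i x = ψ.symm (i' y) := hx
      rw [this, ψ.apply_symm_apply]
  refine ⟨AlgEquiv.ofBijective f hb, ?_⟩
  ext z
  induction z using TensorProduct.induction_on with
  | zero => simp
  | add a b ha hb => rw [map_add, map_add, ha, hb]
  | tmul k y =>
    have h2 : k ⊗ₜ[R] y = k • i y := by simp [i, TensorProduct.smul_tmul']
    have h3 : extendEquiv K (AlgEquiv.ofBijective f hb) (i y) = i' (f y) := by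
      simp [extendEquiv, i, i']
    rw [h2, map_smul, map_smul, h3, hf]

theorem isOrientation_of_alt_eq_one {𝔞 : (FractionalIdeal R⁰ K)ˣ} {π : (K ⊗[R] S) [⋀^Fin 2]→ₗ[K] K}
    {ξ : K ⊗[R] S} (h : IsSteinitzDecomp (ringLattice R K S) ![1, 𝔞] ![1, ξ])
    (hξ : π ![1, ξ] = 1) : IsOrientation 𝔞 π := by
  rw [IsOrientation, wedge_eq π h, hξ]
  simp

/-- The image of the wedge square is π(1 ∧ ξ)𝔞, so being an orientation means that π(1 ∧ ξ) is a
unit of R, and ξ can absorb it. -/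
theorem IsOrientation.exists_decomp {𝔞 : (FractionalIdeal R⁰ K)ˣ}
    {π : (K ⊗[R] S) [⋀^Fin 2]→ₗ[K] K} (hπ : IsOrientation 𝔞 π) {ξ : K ⊗[R] S}
    (h : IsSteinitzDecomp (ringLattice R K S) ![1, 𝔞] ![1, ξ]) :
    ∃ ξ' : K ⊗[R] S, IsSteinitzDecomp (ringLattice R K S) ![1, 𝔞] ![1, ξ'] ∧ π ![1, ξ'] = 1 := by
  rw [IsOrientation, wedge_eq π h, Units.val_one, one_mul] at hπ
  obtain ⟨u, hu⟩ := exists_unit_of_singleton_mul_eq (FractionalIdeal.coeToSubmodule_injective hπ)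
  refine ⟨_, h.unit_smul u⁻¹, ?_⟩
  rw [alt_smul_right, ← hu, ← map_mul, Units.inv_mul, map_one]

theorem IsOrientation.alt_mem {𝔞 : (FractionalIdeal R⁰ K)ˣ}
    {π : (K ⊗[R] S) [⋀^Fin 2]→ₗ[K] K} (hπ : IsOrientation 𝔞 π) {x y : K ⊗[R] S}
    (hx : x ∈ ringLattice R K S) (hy : y ∈ ringLattice R K S) :
    π ![x, y] ∈ (𝔞 : FractionalIdeal R⁰ K) := by
  rw [← FractionalIdeal.mem_coe, ← hπ]
  exact Submodule.subset_span ⟨x, hx, y, hy, rfl⟩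

theorem IsOrientation.unit_smul {𝔞 : (FractionalIdeal R⁰ K)ˣ}
    {π : (K ⊗[R] S) [⋀^Fin 2]→ₗ[K] K} (hπ : IsOrientation 𝔞 π) {x : K} {u : Rˣ}
    (hu : algebraMap R K u = x) : IsOrientation 𝔞 (x • π) := by
  rw [IsOrientation, ← hπ]
  apply le_antisymm
  · rw [Submodule.span_le]
    rintro _ ⟨x, hx, y, hy, rfl⟩
    rw [AlternatingMap.smul_apply, ← hu, algebraMap_smul]
    exact Submodule.smul_mem _ _ (Submodule.subset_span ⟨x, hx, y, hy, rfl⟩)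
  · rw [Submodule.span_le]
    rintro _ ⟨y, hy, z, hz, rfl⟩
    have : π ![y, z] = (u⁻¹ : Rˣ).val • ((x • π) ![y, z]) := by
      rw [AlternatingMap.smul_apply, ← hu, algebraMap_smul, smul_smul, Units.inv_mul, one_smul]
    rw [this]
    exact Submodule.smul_mem _ _ (Submodule.subset_span ⟨y, hy, z, hz, rfl⟩)

end RingLattice

/-! ### Normal form: multiplication tables governed by the covariants -/

section

variable {R : Type u} [CommRing R] [IsDedekindDomain R]
  {K : Type v} [Field K] [Algebra R K] [IsFractionRing R K]

/-- A pair of lattices `R + 𝔞 θ`, `R α + 𝔞 β` in a quadratic algebra, with multiplication table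
dictated by the covariants of the form `a x³ + 3 b x² y + 3 c x y² + d y³`; here `l` plays the role
of `δ⁻¹`, and `α'`, `β'` are conjugates of `α`, `β` up to a scalar. -/
structure IsNormalForm {L : Type*} [CommRing L] [Algebra K L] [Algebra R L] [IsScalarTower R K L]
    (𝔞 : (FractionalIdeal R⁰ K)ˣ) (S I : Submodule R L) (π : L [⋀^Fin 2]→ₗ[K] K)
    (l α β θ α' β' : L) (a b c d : K) : Prop where
  finrank_eq : Module.finrank K L = 2
  ring_decomp : IsSteinitzDecomp S ![1, 𝔞] ![1, θ]
  ideal_decomp : IsSteinitzDecomp I ![1, 𝔞] ![α, β]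
  alt_one : π ![1, θ] = 1
  mul_α : α * α' = (b ^ 2 - a * c) • 1
  mul_θ : α' * β = θ
  mul_conj : α * β' = (b * c - a * d) • 1 - θ
  mul_β : β * β' = (c ^ 2 - b * d) • 1
  coeff_a : a = π ![1, α ^ 3 * l]
  coeff_b : b = π ![1, α ^ 2 * β * l]
  coeff_c : c = π ![1, α * β ^ 2 * l]
  coeff_d : d = π ![1, β ^ 3 * l]
  mem_a : a ∈ (𝔞 : FractionalIdeal R⁰ K)
  mem_b : b ∈ (1 : FractionalIdeal R⁰ K)
  mem_c : c ∈ ((𝔞⁻¹ : (FractionalIdeal R⁰ K)ˣ) : FractionalIdeal R⁰ K)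
  mem_d : d ∈ ((𝔞⁻¹ ^ 2 : (FractionalIdeal R⁰ K)ˣ) : FractionalIdeal R⁰ K)

section Covariants

variable {𝔞 : (FractionalIdeal R⁰ K)ˣ} {a b c d : K}

theorem first_covariant_mem (ha : a ∈ (𝔞 : FractionalIdeal R⁰ K))
    (hb : b ∈ (1 : FractionalIdeal R⁰ K))
    (hc : c ∈ ((𝔞⁻¹ : (FractionalIdeal R⁰ K)ˣ) : FractionalIdeal R⁰ K)) :
    b ^ 2 - a * c ∈ (1 : FractionalIdeal R⁰ K) := by
  rw [pow_two]
  exact frac_sub_mem (mul_mem_of_eq (one_mul _) hb hb) (mul_mem_of_eq (unit_mul_inv 𝔞) ha hc)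

theorem middle_covariant_mem (ha : a ∈ (𝔞 : FractionalIdeal R⁰ K))
    (hb : b ∈ (1 : FractionalIdeal R⁰ K))
    (hc : c ∈ ((𝔞⁻¹ : (FractionalIdeal R⁰ K)ˣ) : FractionalIdeal R⁰ K))
    (hd : d ∈ ((𝔞⁻¹ ^ 2 : (FractionalIdeal R⁰ K)ˣ) : FractionalIdeal R⁰ K)) :
    b * c - a * d ∈ ((𝔞⁻¹ : (FractionalIdeal R⁰ K)ˣ) : FractionalIdeal R⁰ K) := by
  refine frac_sub_mem (mul_mem_of_eq (one_mul _) hb hc) (mul_mem_of_eq ?_ ha hd)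
  rw [pow_two, Units.val_mul, ← mul_assoc, unit_mul_inv, one_mul]

theorem last_covariant_mem (hb : b ∈ (1 : FractionalIdeal R⁰ K))
    (hc : c ∈ ((𝔞⁻¹ : (FractionalIdeal R⁰ K)ˣ) : FractionalIdeal R⁰ K))
    (hd : d ∈ ((𝔞⁻¹ ^ 2 : (FractionalIdeal R⁰ K)ˣ) : FractionalIdeal R⁰ K)) :
    c ^ 2 - b * d ∈ ((𝔞⁻¹ ^ 2 : (FractionalIdeal R⁰ K)ˣ) : FractionalIdeal R⁰ K) := by
  rw [pow_two c]
  refine frac_sub_mem (mul_mem_of_eq ?_ hc hc) (mul_mem_of_eq (one_mul _) hb hd)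
  rw [pow_two, Units.val_mul]

theorem mul_inv_mem {x t : K} (hx : x ∈ ((𝔞⁻¹ : (FractionalIdeal R⁰ K)ˣ) : FractionalIdeal R⁰ K))
    (ht : t ∈ (𝔞 : FractionalIdeal R⁰ K)) : t * x ∈ (1 : FractionalIdeal R⁰ K) :=
  mul_mem_of_eq (unit_mul_inv 𝔞) ht hx

theorem mul_inv_sq_mem {x t : K}
    (hx : x ∈ ((𝔞⁻¹ ^ 2 : (FractionalIdeal R⁰ K)ˣ) : FractionalIdeal R⁰ K))
    (ht : t ∈ (𝔞 : FractionalIdeal R⁰ K)) :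
    t * x ∈ ((𝔞⁻¹ : (FractionalIdeal R⁰ K)ˣ) : FractionalIdeal R⁰ K) := by
  refine mul_mem_of_eq ?_ ht hx
  rw [pow_two, Units.val_mul, ← mul_assoc, unit_mul_inv, one_mul]

end Covariants

namespace IsNormalForm

variable {L : Type*} [CommRing L] [Algebra K L] [Algebra R L] [IsScalarTower R K L]
    {𝔞 : (FractionalIdeal R⁰ K)ˣ} {S I : Submodule R L} {π : L [⋀^Fin 2]→ₗ[K] K}
    {l α β θ α' β' : L} {a b c d : K}

theorem θ_mul_α (h : IsNormalForm 𝔞 S I π l α β θ α' β' a b c d) :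
    θ * α = (b ^ 2 - a * c) • β := by
  rw [← h.mul_θ, mul_right_comm, mul_comm α', h.mul_α, smul_one_mul]

theorem θ_mul_β (h : IsNormalForm 𝔞 S I π l α β θ α' β' a b c d) :
    θ * β = (b * c - a * d) • β - (c ^ 2 - b * d) • α := by
  have h1 : θ = (b * c - a * d) • 1 - α * β' := by
    rw [h.mul_conj]
    ring
  rw [h1, sub_mul, smul_one_mul, mul_assoc, mul_comm β', h.mul_β, mul_smul_one]

/-- From θ(m − θ) = (α'β)(αβ') = (αα')(ββ') = pr. -/
theorem θ_mul_θ (h : IsNormalForm 𝔞 S I π l α β θ α' β' a b c d) :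
    θ * θ = (-((b ^ 2 - a * c) * (c ^ 2 - b * d))) • 1 + (b * c - a * d) • θ := by
  have h1 : θ * ((b * c - a * d) • 1 - θ) = ((b ^ 2 - a * c) * (c ^ 2 - b * d)) • 1 := by
    rw [← h.mul_conj, mul_smul, ← h.mul_β, ← smul_one_mul, ← h.mul_α, ← h.mul_θ]
    ring
  rw [mul_sub, mul_smul_one] at h1
  rw [neg_smul, ← h1]
  ring

end IsNormalForm

/-! ### A cubic form determines α, β and l up to scaling -/

section Uniqueness

variable {L : Type*} [CommRing L] [Algebra K L]

/-- The pair `α, β` and the scalar `l` are determined by the cubic form up to scaling. -/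
theorem exists_scaling (hL : Module.finrank K L = 2) (π : L [⋀^Fin 2]→ₗ[K] K)
    {θ α β α₁ β₁ l l₁ : L} {p m r : K} (hθ : π ![1, θ] = 1) (hi : LinearIndependent K ![α, β])
    (h0 : ¬ (p = 0 ∧ m = 0 ∧ r = 0))
    (hα : θ * α = p • β) (hβ : θ * β = m • β - r • α)
    (hα₁ : θ * α₁ = p • β₁) (hβ₁ : θ * β₁ = m • β₁ - r • α₁)
    (ha : π ![1, α ^ 3 * l] = π ![1, α₁ ^ 3 * l₁])
    (hb : π ![1, α ^ 2 * β * l] = π ![1, α₁ ^ 2 * β₁ * l₁])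
    (hc : π ![1, α * β ^ 2 * l] = π ![1, α₁ * β₁ ^ 2 * l₁])
    (hd : π ![1, β ^ 3 * l] = π ![1, β₁ ^ 3 * l₁]) :
    ∃ κ : L, κ * α = α₁ ∧ κ * β = β₁ ∧ l = κ ^ 3 * l₁ := by
  obtain ⟨x, y, hxy⟩ := exists_coords hL hi 1
  -- The equality αβ₁ = α₁β replaces equality of the ratios β/α and β₁/α₁, which makes no sense if α
  -- is a zero divisor. The common action of θ shows that p, m and r each annihilate D, and one of
  -- them is nonzero.
  set D := α * β₁ - α₁ * β with hD
  have hp : p • D = 0 := by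
    have : p • D = α * (p • β₁) - α₁ * (p • β) := by
      rw [hD, smul_sub, mul_smul_comm, mul_smul_comm]
    rw [this, ← hα, ← hα₁]
    ring
  have hr : r • D = 0 := by
    have : r • D = β * (m • β₁ - r • α₁) - β₁ * (m • β - r • α) := by
      rw [hD, mul_sub, mul_sub, smul_sub]
      simp only [mul_smul_comm]
      rw [mul_comm β β₁, mul_comm α β₁, mul_comm α₁ β]
      module
    rw [this, ← hβ, ← hβ₁]
    ring
  have hm : m • D = 0 := by
    have h1 : θ * D = 0 := by
      have : θ * D = (θ * α) * β₁ - (θ * α₁) * β := by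
        rw [hD]
        ring
      rw [this, hα, hα₁, smul_mul_assoc, smul_mul_assoc, mul_comm β₁, sub_self]
    have h2 : θ * D = m • D := by
      have : θ * D = α * (θ * β₁) - α₁ * (θ * β) := by
        rw [hD]
        ring
      rw [this, hβ, hβ₁, hD, mul_sub, mul_sub, mul_smul_comm, mul_smul_comm, mul_smul_comm,
        mul_smul_comm, mul_comm α α₁]
      module
    rw [← h2, h1]
  have hD0 : D = 0 := by
    by_contra hD0
    exact h0 ⟨(smul_eq_zero.1 hp).resolve_right hD0, (smul_eq_zero.1 hm).resolve_right hD0,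
      (smul_eq_zero.1 hr).resolve_right hD0⟩
  have hcross : α * β₁ = α₁ * β := sub_eq_zero.1 hD0
  -- Since 1 = xα + yβ, the only candidate for κ is κ(xα + yβ) = xα₁ + yβ₁.
  have hκα : (x • α₁ + y • β₁) * α = α₁ := by
    have : (x • α₁ + y • β₁) * α = α₁ * (x • α + y • β) := by
      simp only [mul_add, add_mul, smul_mul_assoc, mul_smul_comm]
      rw [mul_comm β₁, hcross]
    rw [this, ← hxy, mul_one]
  have hκβ : (x • α₁ + y • β₁) * β = β₁ := by
    have : (x • α₁ + y • β₁) * β = β₁ * (x • α + y • β) := by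
      simp only [mul_add, add_mul, smul_mul_assoc, mul_smul_comm]
      rw [mul_comm β₁ α, hcross]
    rw [this, ← hxy, mul_one]
  refine ⟨x • α₁ + y • β₁, hκα, hκβ, ?_⟩
  set κ := x • α₁ + y • β₁
  have hsub : ∀ u u' : L, π ![1, u - u'] = π ![1, u] - π ![1, u'] := by
    intro u u'
    rw [sub_eq_add_neg, ← neg_one_smul K u', alt_add_right, alt_smul_right]
    ring
  set ε := l - κ ^ 3 * l₁ with hε
  have ea : π ![1, α ^ 3 * ε] = 0 := by
    have : α ^ 3 * ε = α ^ 3 * l - (κ * α) ^ 3 * l₁ := by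
      rw [hε]
      ring
    rw [this, hκα, hsub, ha, sub_self]
  have eb : π ![1, α ^ 2 * β * ε] = 0 := by
    have : α ^ 2 * β * ε = α ^ 2 * β * l - (κ * α) ^ 2 * (κ * β) * l₁ := by
      rw [hε]
      ring
    rw [this, hκα, hκβ, hsub, hb, sub_self]
  have ec : π ![1, α * β ^ 2 * ε] = 0 := by
    have : α * β ^ 2 * ε = α * β ^ 2 * l - (κ * α) * (κ * β) ^ 2 * l₁ := by
      rw [hε]
      ring
    rw [this, hκα, hκβ, hsub, hc, sub_self]
  have ed : π ![1, β ^ 3 * ε] = 0 := by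
    have : β ^ 3 * ε = β ^ 3 * l - (κ * β) ^ 3 * l₁ := by
      rw [hε]
      ring
    rw [this, hκβ, hsub, hd, sub_self]
  -- The functional π(1 ∧ ·ε) vanishes on all cubic monomials in α, β. Multiplying uα + vβ by (xα +
  -- yβ)² = 1 makes it a cubic, so the functional vanishes on all of L; testing it on 1 and θ then
  -- gives ε = 0.
  have hall : ∀ u v : K, π ![1, (u • α + v • β) * ε] = 0 := by
    intro u v
    have : (u • α + v • β) * ε = (u * x ^ 2) • (α ^ 3 * ε) +
        ((2 * u * x * y + v * x ^ 2) • (α ^ 2 * β * ε) +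
        ((u * y ^ 2 + 2 * v * x * y) • (α * β ^ 2 * ε) + (v * y ^ 2) • (β ^ 3 * ε))) := by
      have h1 : (u • α + v • β) * ε = (u • α + v • β) * (x • α + y • β) ^ 2 * ε := by
        rw [← hxy]
        ring
      rw [h1]
      simp only [Algebra.smul_def, map_mul, map_add, map_pow, map_ofNat]
      ring
    rw [this, alt_add_right, alt_add_right, alt_add_right, alt_smul_right, alt_smul_right,
      alt_smul_right, alt_smul_right, ea, eb, ec, ed]
    ring
  have h1 : ∀ z : L, π ![1, z * ε] = 0 := by
    intro z
    obtain ⟨u, v, rfl⟩ := exists_coords hL hi z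
    exact hall u v
  have hi1 : LinearIndependent K ![1, θ] := linearIndependent_of_alt_ne_zero π (by simp [hθ])
  obtain ⟨u, v, huv⟩ := exists_coords hL hi1 ε
  have hv : v = 0 := by
    have := h1 1
    rw [one_mul, huv, alt_add_right, alt_smul_right, alt_smul_right, alt_self, hθ] at this
    simpa using this
  have hu : u = 0 := by
    have := h1 θ
    rw [huv, hv, zero_smul, add_zero, mul_smul_one, alt_smul_right, hθ] at this
    simpa using this
  rw [hu, hv, zero_smul, zero_smul, add_zero] at huv
  exact sub_eq_zero.1 huv

end Uniqueness

/-! ### From a balanced quadruple to its normal form -/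

section Quadruples

variable {𝔞 : (FractionalIdeal R⁰ K)ˣ} (Q : BalancedQuadruple 𝔞)

theorem cube_mem {x y z : K ⊗[R] Q.S} (hx : x ∈ Q.I) (hy : y ∈ Q.I) (hz : z ∈ Q.I) :
    x * y * z * (Q.δ⁻¹).val ∈ ringLattice R K Q.S := by
  have h1 : x * y * z ∈ Q.I ^ 3 := by
    rw [pow_succ, pow_two]
    exact Submodule.mul_mem_mul (Submodule.mul_mem_mul hx hy) hz
  obtain ⟨w, hw, hw'⟩ := Q.cube_le h1
  rw [← hw', LinearMap.mulLeft_apply, mul_right_comm, Units.mul_inv, one_mul]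
  exact hw

theorem norm_inv_eq : (Q.s : K) ^ 3 * Algebra.norm K (Q.δ⁻¹).val = 1 := by
  rw [Q.norm_eq, ← map_mul, Units.mul_inv, map_one]

/-- The inclusion I³ ⊆ δS puts the coefficients in 𝔞, R, 𝔞⁻¹, 𝔞⁻², and s³ = N(δ) supplies the
conjugates. What remains is S = R + 𝔞θ rather than R + 𝔞ξ for some other ξ, which is a matter of
integrality. -/
theorem exists_isNormalForm {π : (K ⊗[R] Q.S) [⋀^Fin 2]→ₗ[K] K} {α β : K ⊗[R] Q.S}
    (hπ : IsOrientation 𝔞 π) (hI : IsSteinitzDecomp Q.I ![1, 𝔞] ![α, β])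
    (hs : π ![α, β] = (Q.s : K)) :
    ∃ θ α' β' : K ⊗[R] Q.S, IsNormalForm 𝔞 (ringLattice R K Q.S) Q.I π (Q.δ⁻¹).val α β θ α' β'
      (π ![1, α ^ 3 * (Q.δ⁻¹).val]) (π ![1, α ^ 2 * β * (Q.δ⁻¹).val])
      (π ![1, α * β ^ 2 * (Q.δ⁻¹).val]) (π ![1, β ^ 3 * (Q.δ⁻¹).val]) := by
  have := Q.finite
  have hL := Q.rank_eq_two
  have : Nontrivial (K ⊗[R] Q.S) := Module.nontrivial_of_finrank_pos (R := K) (by omega)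
  obtain ⟨v, w, hvw⟩ := Q.steinitz_ring.exists_decomp hL span_ringLattice
  obtain ⟨ξ₀, hξ₀⟩ := hvw.exists_one one_mem_ringLattice fun x hx =>
    isIntegral_of_mem_ringLattice hx
  obtain ⟨ξ, hξ, hξ1⟩ := hπ.exists_decomp hξ₀
  set l := (Q.δ⁻¹).val
  have hα : α ∈ Q.I := (hI.mem_iff _).2 ⟨1, by simp, 0, FractionalIdeal.zero_mem _, by module⟩
  have hβ : ∀ t ∈ (𝔞 : FractionalIdeal R⁰ K), t • β ∈ Q.I := fun t ht =>
    (hI.mem_iff _).2 ⟨0, FractionalIdeal.zero_mem _, t, ht, by module⟩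
  have ha : π ![1, α ^ 3 * l] ∈ (𝔞 : FractionalIdeal R⁰ K) := by
    refine hπ.alt_mem one_mem_ringLattice ?_
    rw [pow_succ, pow_two]
    exact cube_mem Q hα hα hα
  have hb : π ![1, α ^ 2 * β * l] ∈ (1 : FractionalIdeal R⁰ K) := by
    refine mem_one_of_forall (𝔞 := 𝔞) fun t ht => ?_
    have := hπ.alt_mem one_mem_ringLattice (cube_mem Q hα hα (hβ t ht))
    rw [mul_smul_comm, smul_mul_assoc, alt_smul_right, ← pow_two] at this
    rwa [mul_comm]
  have hc : π ![1, α * β ^ 2 * l] ∈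
      ((𝔞⁻¹ : (FractionalIdeal R⁰ K)ˣ) : FractionalIdeal R⁰ K) := by
    refine mem_inv_of_forall (𝔞 := 𝔞) fun t ht => ?_
    refine mem_one_of_forall (𝔞 := 𝔞) fun t' ht' => ?_
    have := hπ.alt_mem one_mem_ringLattice (cube_mem Q hα (hβ t ht) (hβ t' ht'))
    rw [mul_smul_comm, mul_smul_comm, smul_mul_assoc, smul_mul_assoc, smul_mul_assoc,
      alt_smul_right, alt_smul_right, mul_assoc α, ← pow_two] at this
    convert this using 1
    ring
  have hd : π ![1, β ^ 3 * l] ∈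
      ((𝔞⁻¹ ^ 2 : (FractionalIdeal R⁰ K)ˣ) : FractionalIdeal R⁰ K) := by
    rw [pow_two, Units.val_mul]
    refine mem_mul_inv_of_forall (𝔞 := 𝔞) fun t ht => ?_
    refine mem_inv_of_forall (𝔞 := 𝔞) fun t' ht' => ?_
    refine mem_one_of_forall (𝔞 := 𝔞) fun t'' ht'' => ?_
    have := hπ.alt_mem one_mem_ringLattice (cube_mem Q (hβ t ht) (hβ t' ht') (hβ t'' ht''))
    simp only [mul_smul_comm, smul_mul_assoc, alt_smul_right] at this
    rw [← pow_two, ← pow_succ] at this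
    convert this using 1
    ring
  obtain ⟨θ, α', β', h1, h2, h3, h4, h5⟩ :=
    exists_conjugates hL π hξ1 hs (norm_inv_eq Q) rfl rfl rfl rfl
  refine ⟨θ, α', β', hL, ?_, hI, h1, h2, h3, h4, h5, rfl, rfl, rfl, rfl, ha, hb, hc, hd⟩
  set a := π ![1, α ^ 3 * l]
  set b := π ![1, α ^ 2 * β * l]
  set c := π ![1, α * β ^ 2 * l]
  set d := π ![1, β ^ 3 * l]
  -- Both θ and ξ pair to 1 with 1 under π, so they differ by a scalar k. Moreover tθ is a root of
  -- X² − tmX + t²pr, whose coefficients lie in R for t ∈ 𝔞.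
  obtain ⟨k, k', hk⟩ := exists_coords hL hξ.1 θ
  have hk' : k' = 1 := by
    rw [hk, alt_add_right, alt_smul_right, alt_smul_right, alt_self, hξ1] at h1
    simpa using h1
  rw [hk', one_smul] at hk
  refine hξ.translate (fun x hx => isIntegral_of_mem_ringLattice hx) hk fun t ht => ?_
  have hmm := middle_covariant_mem ha hb hc hd
  have hpp := first_covariant_mem ha hb hc
  have hrr := last_covariant_mem hb hc hd
  have hq : θ * θ = (b * c - a * d) • θ - ((b ^ 2 - a * c) * (c ^ 2 - b * d)) • 1 := by
    have h6 : θ * ((b * c - a * d) • 1 - θ) = ((b ^ 2 - a * c) * (c ^ 2 - b * d)) • 1 := by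
      rw [← h4, mul_smul, ← h5, ← smul_one_mul, ← h2, ← h3]
      ring
    rw [mul_sub, mul_smul_one] at h6
    rw [← h6]
    ring
  refine isIntegral_of_quadratic (K := K) (b := t * (b * c - a * d))
    (c := -((b ^ 2 - a * c) * (t * (t * (c ^ 2 - b * d))))) (mul_inv_mem hmm ht) ?_ ?_
  · exact frac_neg_mem (mul_mem_of_eq (one_mul _) hpp (mul_inv_mem (mul_inv_sq_mem hrr ht) ht))
  · rw [smul_mul_smul_comm, hq]
    module

end Quadruples

end

/-! ### The forms attached to one quadruple make up one orbit -/

section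

variable {R : Type u} [CommRing R] [IsDedekindDomain R]
  {K : Type v} [Field K] [Algebra R K] [IsFractionRing R K]
variable {R : Type u} [CommRing R] [IsDedekindDomain R]
  {K : Type v} [Field K] [Algebra R K] [IsFractionRing R K]
  {𝔞 : (FractionalIdeal R⁰ K)ˣ}

theorem Corresponds.exists_isNormalForm {f : MvPolynomial (Fin 2) K} {Q : BalancedQuadruple 𝔞}
    (h : Corresponds f Q) :
    ∃ (π : (K ⊗[R] Q.S) [⋀^Fin 2]→ₗ[K] K) (α β θ α' β' : K ⊗[R] Q.S) (a b c d : K),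
      IsOrientation 𝔞 π ∧ π ![α, β] = (Q.s : K) ∧ f = cubicForm a b c d ∧
      IsNormalForm 𝔞 (ringLattice R K Q.S) Q.I π (Q.δ⁻¹).val α β θ α' β' a b c d := by
  obtain ⟨π, α, β, hπ, hI, hs, rfl⟩ := h
  obtain ⟨θ, α', β', hn⟩ := TripSymCubic.exists_isNormalForm Q hπ hI hs
  exact ⟨π, α, β, θ, α', β', _, _, _, _, hπ, hs, rfl, hn⟩

theorem IsNormalForm.disc_ne_zero {L : Type*} [CommRing L] [Algebra K L] [Algebra R L]
    [IsScalarTower R K L] {S I : Submodule R L} {π : L [⋀^Fin 2]→ₗ[K] K}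
    {l α β θ α' β' : L} {a b c d : K} (h : IsNormalForm 𝔞 S I π l α β θ α' β' a b c d)
    (hL : (Algebra.traceForm K L).Nondegenerate) :
    (b * c - a * d) ^ 2 + 4 * -((b ^ 2 - a * c) * (c ^ 2 - b * d)) ≠ 0 :=
  (traceForm_nondegenerate_iff h.finrank_eq π h.alt_one h.θ_mul_θ).1 hL

theorem exists_unit_of_span_eq {x y : K} (hy : y ≠ 0)
    (h : Submodule.span R {x} = Submodule.span R {y}) : ∃ u : Rˣ, algebraMap R K u * x = y := by
  obtain ⟨r, hr⟩ := Submodule.mem_span_singleton.1 (h ▸ Submodule.mem_span_singleton_self x)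
  obtain ⟨t, ht⟩ := Submodule.mem_span_singleton.1 (h.symm ▸ Submodule.mem_span_singleton_self y)
  rw [Algebra.smul_def] at hr ht
  have h1 : t * r = 1 := by
    apply FaithfulSMul.algebraMap_injective R K
    apply mul_right_cancel₀ hy
    rw [map_mul, mul_assoc, hr, ht, map_one, one_mul]
  exact ⟨⟨t, r, h1, by rw [mul_comm, h1]⟩, ht⟩

theorem exists_corresponds (h3 : (3 : K) ≠ 0) (Q : BalancedQuadruple 𝔞) :
    ∃ f : NondegForm 𝔞, Corresponds f.1 Q := by
  have := Q.finite
  have hL := Q.rank_eq_two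
  have : Nontrivial (K ⊗[R] Q.S) := Module.nontrivial_of_finrank_pos (R := K) (by omega)
  obtain ⟨v, w, hvw⟩ := Q.steinitz_ring.exists_decomp hL span_ringLattice
  obtain ⟨ξ, hξ⟩ := hvw.exists_one one_mem_ringLattice fun x hx =>
    isIntegral_of_mem_ringLattice hx
  obtain ⟨π, hπ⟩ := exists_alt_eq_one hL hξ.1
  obtain ⟨α, β, hI⟩ := Q.steinitz_ideal.exists_decomp hL Q.isFracIdeal.span_eq_top
  have h1 := moduleIndex_eq π hL hξ hI hπ
  rw [Q.index_eq] at h1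
  -- The equality [S : I] = sR fixes π(α ∧ β) only up to a unit of R; rescaling β by that unit makes
  -- it exactly s.
  obtain ⟨u, hu⟩ := exists_unit_of_span_eq Q.s.ne_zero h1.symm
  have hI' := hI.unit_smul u
  have hs : π ![α, algebraMap R K u • β] = (Q.s : K) := by rw [alt_smul_right, hu]
  have hπ' := isOrientation_of_alt_eq_one hξ hπ
  obtain ⟨θ, α', β', hn⟩ := TripSymCubic.exists_isNormalForm Q hπ' hI' hs
  refine ⟨⟨_, ⟨_, hn.mem_a, _, hn.mem_b, _, hn.mem_c, _, hn.mem_d, rfl⟩, ?_⟩,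
    π, α, _, hπ', hI', hs, rfl⟩
  rw [disc_cubicForm h3]
  exact hn.disc_ne_zero Q.nondegenerate

theorem alt_one_cubic {L : Type*} [CommRing L] [Algebra K L] (π : L [⋀^Fin 2]→ₗ[K] K)
    (α β l : L) (x y x' y' x'' y'' : K) :
    π ![1, (x • α + y • β) * (x' • α + y' • β) * (x'' • α + y'' • β) * l] =
      x * x' * x'' * π ![1, α ^ 3 * l] +
      ((x * x' * y'' + x * y' * x'' + y * x' * x'') * π ![1, α ^ 2 * β * l] +
      ((x * y' * y'' + y * x' * y'' + y * y' * x'') * π ![1, α * β ^ 2 * l] +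
      y * y' * y'' * π ![1, β ^ 3 * l])) := by
  rw [← alt_smul_right, ← alt_smul_right, ← alt_smul_right, ← alt_smul_right, ← alt_add_right,
    ← alt_add_right, ← alt_add_right]
  have : (x • α + y • β) * (x' • α + y' • β) * (x'' • α + y'' • β) * l =
      (x * x' * x'') • (α ^ 3 * l) +
      ((x * x' * y'' + x * y' * x'' + y * x' * x'') • (α ^ 2 * β * l) +
      ((x * y' * y'' + y * x' * y'' + y * y' * x'') • (α * β ^ 2 * l) +
      (y * y' * y'') • (β ^ 3 * l))) := by
    simp only [Algebra.smul_def, map_mul, map_add]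
    ring
  rw [this]

/-- The form attached to a transformed basis is the transformed form. -/
theorem act_cubicForm_alt {L : Type*} [CommRing L] [Algebra K L] (π : L [⋀^Fin 2]→ₗ[K] K)
    (α β l : L) (g : GL (Fin 2) K) {α₁ β₁ : L} (hα : α₁ = g.val 0 0 • α + g.val 0 1 • β)
    (hβ : β₁ = g.val 1 0 • α + g.val 1 1 • β) {π₁ : L [⋀^Fin 2]→ₗ[K] K}
    (hπ : ∀ x, π₁ ![1, x] = g.val.det⁻¹ * π ![1, x]) :
    act g (cubicForm (π ![1, α ^ 3 * l]) (π ![1, α ^ 2 * β * l]) (π ![1, α * β ^ 2 * l])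
        (π ![1, β ^ 3 * l])) =
      cubicForm (π₁ ![1, α₁ ^ 3 * l]) (π₁ ![1, α₁ ^ 2 * β₁ * l]) (π₁ ![1, α₁ * β₁ ^ 2 * l])
        (π₁ ![1, β₁ ^ 3 * l]) := by
  have e1 : α₁ ^ 3 * l = α₁ * α₁ * α₁ * l := by ring
  have e2 : α₁ ^ 2 * β₁ * l = α₁ * α₁ * β₁ * l := by ring
  have e3 : α₁ * β₁ ^ 2 * l = α₁ * β₁ * β₁ * l := by ring
  have e4 : β₁ ^ 3 * l = β₁ * β₁ * β₁ * l := by ring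
  rw [act_cubicForm, e1, e2, e3, e4, hπ, hπ, hπ, hπ, hα, hβ, alt_one_cubic, alt_one_cubic,
    alt_one_cubic, alt_one_cubic]
  congr 1 <;> ring

theorem GL_det_ne_zero (g : GL (Fin 2) K) : g.val.det ≠ 0 :=
  ((Matrix.isUnit_iff_isUnit_det _).1 g.isUnit).ne_zero

/-- Apply g to the pair (α, β) and replace π by det(g)⁻¹π. The two changes cancel in π(α ∧ β) = s,
and the second one is the determinant twist of the action. -/
theorem Corresponds.act {f : MvPolynomial (Fin 2) K} {Q : BalancedQuadruple 𝔞}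
    (h : Corresponds f Q) {g : GL (Fin 2) K} (hg : g ∈ GLa 𝔞) : Corresponds (act g f) Q := by
  obtain ⟨π, α, β, hπ, hI, hs, rfl⟩ := h
  obtain ⟨g1, g2, g3, g4, u, hu⟩ := hg
  have hd : g.val.det ≠ 0 := GL_det_ne_zero g
  have hinv : algebraMap R K (u⁻¹ : Rˣ) = g.val.det⁻¹ := by
    refine eq_inv_of_mul_eq_one_left ?_
    rw [← hu, ← map_mul, Units.inv_mul, map_one]
  have h2 : g.val.det = g.val 0 0 * g.val 1 1 - g.val 0 1 * g.val 1 0 := Matrix.det_fin_two _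
  have hm : ∀ {J : FractionalIdeal R⁰ K} {x : K}, x ∈ J → g.val.det⁻¹ * x ∈ J := by
    intro J x hx
    rw [← hinv, ← Algebra.smul_def]
    exact Submodule.smul_mem (J : Submodule R K) _ hx
  -- A change of decomposition has determinant 1, so the second row of g is first divided by det(g);
  -- as det(g) is a unit of R, it is restored afterwards.
  have hI1 := IsSteinitzDecomp.change hI (p := g.val 0 0) (q := g.val 0 1)
    (r := g.val.det⁻¹ * g.val 1 1) (t := -(g.val.det⁻¹ * g.val 1 0)) (by simpa using g1) g3
    (by simpa using hm g2) (frac_neg_mem (hm g4)) (by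
      field_simp
      rw [h2]
      ring)
  have hI2 := hI1.unit_smul u
  rw [one_mul] at hI2
  have hβ : algebraMap R K u • (-(-(g.val.det⁻¹ * g.val 1 0)) • α +
      (g.val.det⁻¹ * g.val 1 1) • β) = g.val 1 0 • α + g.val 1 1 • β := by
    rw [hu, smul_add, smul_smul, smul_smul, neg_neg, mul_inv_cancel_left₀ hd,
      mul_inv_cancel_left₀ hd]
  rw [hβ] at hI2
  refine ⟨g.val.det⁻¹ • π, _, _, hπ.unit_smul hinv, hI2, ?_, ?_⟩
  · rw [AlternatingMap.smul_apply, alt_comb, ← h2, hs, smul_eq_mul, inv_mul_cancel_left₀ hd]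
  · exact act_cubicForm_alt π α β _ g rfl rfl fun x => rfl

/-- The two bases of I are related by a matrix whose entries lie in the right ideals. Alternating
forms on a plane are proportional, and since both orientations give the value s on their own basis,
the proportionality factor must be the inverse determinant. -/
theorem Corresponds.exists_act_eq {f f' : MvPolynomial (Fin 2) K} {Q : BalancedQuadruple 𝔞}
    (h : Corresponds f Q) (h' : Corresponds f' Q) : ∃ g ∈ GLa 𝔞, f' = TripSymCubic.act g f := by
  obtain ⟨π, α, β, hπ, hI, hs, rfl⟩ := h
  obtain ⟨π₁, α₁, β₁, hπ₁, hI₁, hs₁, rfl⟩ := h'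
  obtain ⟨θ, α', β', hn⟩ := TripSymCubic.exists_isNormalForm Q hπ hI hs
  have hL := hn.finrank_eq
  obtain ⟨r, hr, s, hs', hα⟩ := (hI.mem_iff α₁).1
    ((hI₁.mem_iff _).2 ⟨1, by simp, 0, FractionalIdeal.zero_mem _, by module⟩)
  obtain ⟨t, u, hβ⟩ := exists_coords hL hI.1 β₁
  have htu : ∀ x ∈ (𝔞 : FractionalIdeal R⁰ K),
      x * t ∈ (1 : FractionalIdeal R⁰ K) ∧ x * u ∈ (𝔞 : FractionalIdeal R⁰ K) := by
    intro x hx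
    obtain ⟨t', ht', u', hu', h1⟩ := (hI.mem_iff (x • β₁)).1
      ((hI₁.mem_iff _).2 ⟨0, FractionalIdeal.zero_mem _, x, hx, by module⟩)
    obtain ⟨h2, h3⟩ := LinearIndependent.pair_iff.1 hI.1 (x * t - t') (x * u - u') (by
      have : x • β₁ - x • β₁ = 0 := sub_self _
      nth_rewrite 1 [hβ] at this
      rw [h1] at this
      rw [← this]
      module)
    rw [sub_eq_zero] at h2 h3
    rw [h2, h3]
    exact ⟨by simpa using ht', hu'⟩
  have ht : t ∈ ((𝔞⁻¹ : (FractionalIdeal R⁰ K)ˣ) : FractionalIdeal R⁰ K) :=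
    mem_inv_of_forall fun x hx => by
      rw [mul_comm]
      exact (htu x hx).1
  have hu : u ∈ (1 : FractionalIdeal R⁰ K) :=
    mem_one_of_forall fun x hx => by
      rw [mul_comm]
      exact (htu x hx).2
  have hs0 : (Q.s : K) ≠ 0 := Q.s.ne_zero
  have hdet : π ![α₁, β₁] = (r * u - s * t) * (Q.s : K) := by
    rw [hα, hβ, alt_comb, hs]
  -- The wedge square of I, computed in both bases, shows that the determinant multiplies 𝔞 onto
  -- itself.
  obtain ⟨e, he⟩ : ∃ e : Rˣ, algebraMap R K e = r * u - s * t := by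
    refine exists_unit_of_singleton_mul_eq (𝔞 := 𝔞) ?_
    have h1 := wedge_eq_wedge π hI hI₁
    rw [hdet, hs, Units.val_one, one_mul, mul_comm (r * u - s * t),
      ← FractionalIdeal.spanSingleton_mul_spanSingleton, mul_assoc] at h1
    have h2 := congrArg (FractionalIdeal.spanSingleton R⁰ ((Q.s : K)⁻¹) * ·) h1
    simp only [← mul_assoc, FractionalIdeal.spanSingleton_mul_spanSingleton,
      inv_mul_cancel₀ hs0, one_mul, FractionalIdeal.spanSingleton_one] at h2
    exact h2.symm
  have he0 : r * u - s * t ≠ 0 := he ▸ (e.isUnit.map (algebraMap R K)).ne_zero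
  have hdet' : (!![r, s; t, u] : Matrix (Fin 2) (Fin 2) K).det ≠ 0 := by
    rwa [Matrix.det_fin_two_of]
  have hπ' : ∀ x y, π₁ ![x, y] = π₁ ![1, θ] * π ![x, y] := fun x y =>
    alt_ext (π := π₁) (π' := π₁ ![1, θ] • π) hL hn.ring_decomp.1
      (by rw [AlternatingMap.smul_apply, hn.alt_one, smul_eq_mul, mul_one]) x y
  have hc : π₁ ![1, θ] = (r * u - s * t)⁻¹ := by
    refine eq_inv_of_mul_eq_one_left ?_
    apply mul_right_cancel₀ hs0
    rw [mul_assoc, ← hdet, ← hπ', hs₁, one_mul]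
  obtain ⟨g, hg⟩ : ∃ g : GL (Fin 2) K, g.val = !![r, s; t, u] :=
    ⟨Matrix.GeneralLinearGroup.mkOfDetNeZero !![r, s; t, u] hdet', rfl⟩
  have hgd : g.val.det = r * u - s * t := by rw [hg, Matrix.det_fin_two_of]
  have h00 : g.val 0 0 = r := by rw [hg]; rfl
  have h01 : g.val 0 1 = s := by rw [hg]; rfl
  have h10 : g.val 1 0 = t := by rw [hg]; rfl
  have h11 : g.val 1 1 = u := by rw [hg]; rfl
  refine ⟨g, ⟨?_, ?_, ?_, ?_, e, ?_⟩, ?_⟩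
  · simpa [h00] using hr
  · rwa [h11]
  · rwa [h01]
  · rwa [h10]
  · rw [he, hgd]
  · refine (act_cubicForm_alt π α β _ g (by rw [h00, h01]; exact hα) (by rw [h10, h11]; exact hβ)
      fun x => ?_).symm
    rw [hπ', hc, hgd]

end

/-! ### Invariance under equivalence, injectivity, and the discriminant ideal -/

section

variable {R : Type u} [CommRing R] [IsDedekindDomain R]
  {K : Type v} [Field K] [Algebra R K] [IsFractionRing R K]
variable {R : Type u} [CommRing R] [IsDedekindDomain R]
  {K : Type v} [Field K] [Algebra R K] [IsFractionRing R K]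
  {𝔞 : (FractionalIdeal R⁰ K)ˣ}

theorem extendEquiv_mem_ringLattice {S S' : Type*} [CommRing S] [Algebra R S] [CommRing S']
    [Algebra R S'] (φ : S ≃ₐ[R] S') {x : K ⊗[R] S} (hx : x ∈ ringLattice R K S) :
    extendEquiv K φ x ∈ ringLattice R K S' := by
  obtain ⟨y, rfl⟩ := mem_ringLattice.1 hx
  exact ⟨φ y, by simp [extendEquiv]⟩

theorem GenEquivalent.isUnit {Q Q' : BalancedQuadruple 𝔞} {φ : Q.S ≃ₐ[R] Q'.S}
    {κ : K ⊗[R] Q'.S}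
    (h : (Q'.δ : K ⊗[R] Q'.S) = κ ^ 3 * extendEquiv K φ (Q.δ : K ⊗[R] Q.S)) : IsUnit κ := by
  have h1 : IsUnit (κ ^ 3 * extendEquiv K φ (Q.δ : K ⊗[R] Q.S)) := h ▸ Q'.δ.isUnit
  exact (isUnit_pow_iff three_ne_zero).1 (isUnit_of_mul_isUnit_left h1)

/-- Transport π along φ and use the basis κφ(α), κφ(β): the factor κ³ from the cube cancels the one
in δ', and N(κ) accounts for s'. -/
theorem Corresponds.of_genEquivalent {f : MvPolynomial (Fin 2) K} {Q Q' : BalancedQuadruple 𝔞}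
    (h : Corresponds f Q) (hQ : GenEquivalent Q Q') : Corresponds f Q' := by
  obtain ⟨π, α, β, hπ, hI, hs, rfl⟩ := h
  obtain ⟨φ, κ, hI', hδ, hs'⟩ := hQ
  have hκ := GenEquivalent.isUnit hδ
  set e := extendEquiv K φ with he
  let π' : (K ⊗[R] Q'.S) [⋀^Fin 2]→ₗ[K] K := π.compLinearMap e.symm.toLinearMap
  have hπ' : ∀ x y, π' ![e x, e y] = π ![x, y] := by
    intro x y
    rw [AlternatingMap.compLinearMap_apply]
    congr 1
    funext i
    fin_cases i
    · exact e.symm_apply_apply x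
    · exact e.symm_apply_apply y
  have hl : κ ^ 3 * (Q'.δ⁻¹).val = e (Q.δ⁻¹).val := by
    have h1 : e (Q.δ : K ⊗[R] Q.S) * e (Q.δ⁻¹).val = 1 := by
      rw [← map_mul, Units.mul_inv, map_one]
    have h2 : (Q'.δ : K ⊗[R] Q'.S) * (Q'.δ⁻¹).val = 1 := Units.mul_inv _
    rw [hδ] at h2
    linear_combination (-(κ ^ 3 * (Q'.δ⁻¹).val)) * h1 + e (Q.δ⁻¹).val * h2
  have hcoef : ∀ x y z : K ⊗[R] Q.S,
      π' ![1, (κ * e x) * (κ * e y) * (κ * e z) * (Q'.δ⁻¹).val] =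
        π ![1, x * y * z * (Q.δ⁻¹).val] := by
    intro x y z
    rw [← hπ', map_one]
    congr 3
    rw [map_mul, map_mul, map_mul, ← hl]
    ring
  have e1 : ∀ (α β l : K ⊗[R] Q.S), α ^ 3 * l = α * α * α * l ∧ α ^ 2 * β * l = α * α * β * l ∧
      α * β ^ 2 * l = α * β * β * l := fun α β l => ⟨by ring, by ring, by ring⟩
  have e2 : ∀ (α β l : K ⊗[R] Q'.S), α ^ 3 * l = α * α * α * l ∧ α ^ 2 * β * l = α * α * β * l ∧
      α * β ^ 2 * l = α * β * β * l := fun α β l => ⟨by ring, by ring, by ring⟩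
  refine ⟨π', κ * e α, κ * e β, ?_, ?_, ?_, ?_⟩
  · rw [IsOrientation, ← hπ]
    congr 1
    ext t
    constructor
    · rintro ⟨x, hx, y, hy, rfl⟩
      refine ⟨e.symm x, extendEquiv_mem_ringLattice φ.symm hx, e.symm y,
        extendEquiv_mem_ringLattice φ.symm hy, ?_⟩
      rw [← hπ', e.apply_symm_apply, e.apply_symm_apply]
    · rintro ⟨x, hx, y, hy, rfl⟩
      exact ⟨e x, extendEquiv_mem_ringLattice φ hx, e y, extendEquiv_mem_ringLattice φ hy,
        (hπ' x y).symm⟩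
  · have h1 := hI.map ((LinearMap.mulLeft K κ) ∘ₗ e.toLinearMap) (by
      intro x y hxy
      exact e.injective (hκ.mul_left_cancel hxy))
    have h2 : Q'.I = Q.I.map (((LinearMap.mulLeft K κ) ∘ₗ e.toLinearMap).restrictScalars R) := by
      rw [hI', scale, ← Submodule.map_comp]
      rfl
    rw [h2]
    convert h1 using 1
    funext i
    fin_cases i <;> rfl
  · rw [norm_mul_alt Q'.rank_eq_two, hπ', hs, hs']
  · rw [(e1 α β _).1, (e1 α β _).2.1, (e1 α β _).2.2, (e1 β α _).1, ← hcoef, ← hcoef, ← hcoef,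
      ← hcoef, (e2 (κ * e α) (κ * e β) _).1, (e2 (κ * e α) (κ * e β) _).2.1,
      (e2 (κ * e α) (κ * e β) _).2.2, (e2 (κ * e β) (κ * e α) _).1]

/-- Equal forms have equal covariants, hence equal tables for θ and for its action on the ideals.
This identifies the rings, and the pairs (α, β) then differ by a single κ. -/
theorem Corresponds.genEquivalent (h3 : (3 : K) ≠ 0) {f : MvPolynomial (Fin 2) K}
    {Q Q' : BalancedQuadruple 𝔞} (h : Corresponds f Q) (h' : Corresponds f Q') :
    GenEquivalent Q Q' := by
  have := Q.torsionFree
  have := Q'.torsionFree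
  obtain ⟨π, α, β, θ, _, _, a, b, c, d, -, hs, hf, hn⟩ := h.exists_isNormalForm
  obtain ⟨π₁, α₁, β₁, θ₁, _, _, a₁, b₁, c₁, d₁, -, hs₁, hf₁, hn₁⟩ := h'.exists_isNormalForm
  obtain ⟨rfl, rfl, rfl, rfl⟩ := cubicForm_injective h3 (hf.symm.trans hf₁)
  obtain ⟨e, heθ, he⟩ := exists_quadraticAlgebra_equiv hn.finrank_eq hn.ring_decomp.1 hn.θ_mul_θ
  obtain ⟨e₁, heθ₁, he₁⟩ :=
    exists_quadraticAlgebra_equiv hn₁.finrank_eq hn₁.ring_decomp.1 hn₁.θ_mul_θ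
  -- Both ambient algebras are K[X]/(X² − mX + pr), so θ ↦ θ₁ is an isomorphism; it matches the
  -- orders R + 𝔞θ and R + 𝔞θ₁.
  let ψ := e.symm.trans e₁
  have hψθ : ψ θ = θ₁ := by
    rw [AlgEquiv.trans_apply, ← heθ, e.symm_apply_apply, heθ₁]
  have hring : ∀ x, ψ x ∈ ringLattice R K Q'.S ↔ x ∈ ringLattice R K Q.S := by
    intro x
    rw [hn.ring_decomp.mem_iff, hn₁.ring_decomp.mem_iff]
    refine exists_congr fun s => and_congr_right fun _ => exists_congr fun t =>
      and_congr_right fun _ => ?_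
    rw [← ψ.injective.eq_iff (b := s • 1 + t • θ), map_add, map_smul, map_smul, map_one, hψθ]
  obtain ⟨φ, hφ⟩ := exists_extendEquiv_eq ψ hring
  have hπ : ∀ x y, π₁ ![ψ x, ψ y] = π ![x, y] := by
    intro x y
    obtain ⟨s, t, rfl⟩ := exists_coords hn.finrank_eq hn.ring_decomp.1 x
    obtain ⟨s', t', rfl⟩ := exists_coords hn.finrank_eq hn.ring_decomp.1 y
    simp only [map_add, map_smul, map_one, hψθ]
    rw [alt_comb, alt_comb, hn.alt_one, hn₁.alt_one]
  have hπ1 : ∀ y, π₁ ![1, ψ y] = π ![1, y] := fun y => by rw [← hπ, map_one]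
  have hi : LinearIndependent K ![ψ α, ψ β] := by
    refine linearIndependent_of_alt_ne_zero π₁ ?_
    rw [hπ, hs]
    exact Q.s.ne_zero
  -- If all covariants vanished, so would m² − 4pr, contradicting nondegeneracy of S.
  have h0 : ¬ (b ^ 2 - a * c = 0 ∧ b * c - a * d = 0 ∧ c ^ 2 - b * d = 0) := by
    rintro ⟨h1, h2, h4⟩
    refine hn.disc_ne_zero Q.nondegenerate ?_
    rw [h1, h2]
    ring
  obtain ⟨κ, hκα, hκβ, hκl⟩ := exists_scaling (l := ψ (Q.δ⁻¹).val) hn₁.finrank_eq π₁ hn₁.alt_one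
    hi h0
    (by rw [← hψθ, ← map_mul, hn.θ_mul_α, map_smul])
    (by rw [← hψθ, ← map_mul, hn.θ_mul_β, map_sub, map_smul, map_smul])
    hn₁.θ_mul_α hn₁.θ_mul_β
    (by rw [← hn₁.coeff_a, ← map_pow, ← map_mul, hπ1, ← hn.coeff_a])
    (by rw [← hn₁.coeff_b, ← map_pow, ← map_mul, ← map_mul, hπ1, ← hn.coeff_b])
    (by rw [← hn₁.coeff_c, ← map_pow, ← map_mul, ← map_mul, hπ1, ← hn.coeff_c])
    (by rw [← hn₁.coeff_d, ← map_pow, ← map_mul, hπ1, ← hn.coeff_d])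
  refine ⟨φ, κ, ?_, ?_, ?_⟩
  · rw [hφ]
    ext x
    rw [hn₁.ideal_decomp.mem_iff]
    constructor
    · rintro ⟨s, hs, t, ht, rfl⟩
      refine ⟨ψ (s • α + t • β), ⟨_, (hn.ideal_decomp.mem_iff _).2 ⟨s, hs, t, ht, rfl⟩, rfl⟩, ?_⟩
      rw [LinearMap.mulLeft_apply, map_add, map_smul, map_smul, mul_add, mul_smul_comm,
        mul_smul_comm, hκα, hκβ]
    · rintro ⟨_, ⟨y, hy, rfl⟩, rfl⟩
      obtain ⟨s, hs, t, ht, rfl⟩ := (hn.ideal_decomp.mem_iff y).1 hy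
      refine ⟨s, hs, t, ht, ?_⟩
      change κ * ψ (s • α + t • β) = _
      rw [map_add, map_smul, map_smul, mul_add, mul_smul_comm, mul_smul_comm, hκα, hκβ]
  · rw [hφ]
    have h1 : ψ (Q.δ : K ⊗[R] Q.S) * ψ (Q.δ⁻¹).val = 1 := by
      rw [← map_mul, Units.mul_inv, map_one]
    have h2 : (Q'.δ : K ⊗[R] Q'.S) * (Q'.δ⁻¹).val = 1 := Units.mul_inv _
    linear_combination (κ ^ 3 * ψ (Q.δ : K ⊗[R] Q.S)) * h2 -
      (Q'.δ : K ⊗[R] Q'.S) * h1 + (Q'.δ : K ⊗[R] Q'.S) * ψ (Q.δ : K ⊗[R] Q.S) * hκl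
  · rw [← hs₁, ← hκα, ← hκβ, norm_mul_alt hn₁.finrank_eq, hπ, hs]

/-- On R + 𝔞θ the discriminant is (m² − 4pr)𝔞². For any other decomposition, the determinant squared
from `discr_pair` is compensated by the change in the coefficient ideals. -/
theorem Corresponds.isDiscriminantIdeal (h3 : (3 : K) ≠ 0) {f : MvPolynomial (Fin 2) K}
    {Q : BalancedQuadruple 𝔞} (h : Corresponds f Q) :
    IsDiscriminantIdeal Q.S
      (FractionalIdeal.spanSingleton R⁰ (disc f) * (𝔞 : FractionalIdeal R⁰ K) ^ 2) := by
  obtain ⟨π, α, β, θ, _, _, a, b, c, d, -, hs, rfl, hn⟩ := h.exists_isNormalForm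
  refine ⟨⟨2, _, _, hn.ring_decomp⟩, fun n 𝔟 ξ hξ => ?_⟩
  obtain rfl := hξ.eq_two hn.finrank_eq span_ringLattice
  rw [discr_pair hn.finrank_eq π hn.alt_one hn.θ_mul_θ, disc_cubicForm h3, Fin.prod_univ_two]
  have h1 := wedge_eq_wedge π hn.ring_decomp hξ.to_pair
  rw [hn.alt_one, FractionalIdeal.spanSingleton_one, one_mul, Units.val_one, one_mul] at h1
  rw [h1, mul_pow, FractionalIdeal.spanSingleton_pow, mul_comm (π ![ξ 0, ξ 1] ^ 2),
    ← FractionalIdeal.spanSingleton_mul_spanSingleton, mul_assoc]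

end

/-! ### Projective forms and invertible ideals -/

section

variable {R : Type u} [CommRing R] [IsDedekindDomain R]
  {K : Type v} [Field K] [Algebra R K] [IsFractionRing R K]
variable {R : Type u} [CommRing R] [IsDedekindDomain R]
  {K : Type v} [Field K] [Algebra R K] [IsFractionRing R K]
  {𝔞 : (FractionalIdeal R⁰ K)ˣ}

/-- The lattice `R v + 𝔞 w`. -/
def pairLattice {V : Type*} [AddCommGroup V] [Module K V] [Module R V] [IsScalarTower R K V]
    (𝔞 : (FractionalIdeal R⁰ K)ˣ) (v w : V) : Submodule R V :=
  ⨆ i, Submodule.map ((LinearMap.toSpanSingleton K V (![v, w] i)).restrictScalars R)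
      ((![1, 𝔞] i : (FractionalIdeal R⁰ K)ˣ) : FractionalIdeal R⁰ K)

section PairLattice

variable {V : Type*} [AddCommGroup V] [Module K V] [Module R V] [IsScalarTower R K V] {v w : V}

theorem pairLattice_decomp (h : LinearIndependent K ![v, w]) :
    IsSteinitzDecomp (pairLattice 𝔞 v w) ![1, 𝔞] ![v, w] :=
  ⟨h, rfl⟩

theorem IsSteinitzDecomp.fg {n : ℕ} {M : Submodule R V} {𝔟 : Fin n → (FractionalIdeal R⁰ K)ˣ}
    {x : Fin n → V} (h : IsSteinitzDecomp M 𝔟 x) : M.FG := by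
  rw [h.2]
  refine Submodule.fg_iSup _ fun i => Submodule.FG.map _ ?_
  exact FractionalIdeal.fg_of_isUnit _ (𝔟 i).isUnit

theorem IsSteinitzDecomp.span_eq_top {M : Submodule R V} (hV : Module.finrank K V = 2)
    (h : IsSteinitzDecomp M ![1, 𝔞] ![v, w]) : Submodule.span K (M : Set V) = ⊤ := by
  obtain ⟨t, ht, ht0⟩ := exists_ne_zero_mem 𝔞
  refine eq_top_iff.2 fun x _ => ?_
  obtain ⟨a, b, rfl⟩ := exists_coords hV h.1 x
  have h1 : v ∈ M := (h.mem_iff _).2 ⟨1, by simp, 0, FractionalIdeal.zero_mem _, by module⟩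
  have h2 : t • w ∈ M := (h.mem_iff _).2 ⟨0, FractionalIdeal.zero_mem _, t, ht, by module⟩
  have h3 : b • w = (b * t⁻¹) • (t • w) := by rw [smul_smul, inv_mul_cancel_right₀ ht0]
  rw [h3]
  exact Submodule.add_mem _ (Submodule.smul_mem _ _ (Submodule.subset_span h1))
    (Submodule.smul_mem _ _ (Submodule.subset_span h2))

end PairLattice

/-- The three covariants of a projective form generate the unit ideal. -/
theorem IsProjectiveForm.sum_eq_one {a b c d : K} (ha : a ∈ (𝔞 : FractionalIdeal R⁰ K))
    (hb : b ∈ (1 : FractionalIdeal R⁰ K))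
    (hc : c ∈ ((𝔞⁻¹ : (FractionalIdeal R⁰ K)ˣ) : FractionalIdeal R⁰ K))
    (hd : d ∈ ((𝔞⁻¹ ^ 2 : (FractionalIdeal R⁰ K)ˣ) : FractionalIdeal R⁰ K))
    (h : IsProjectiveForm 𝔞 (cubicForm a b c d)) :
    FractionalIdeal.spanSingleton R⁰ (b ^ 2 - a * c) +
      FractionalIdeal.spanSingleton R⁰ (a * d - b * c) * (𝔞 : FractionalIdeal R⁰ K) +
      FractionalIdeal.spanSingleton R⁰ (c ^ 2 - b * d) * (𝔞 : FractionalIdeal R⁰ K) ^ 2 = 1 := by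
  have h1 : FractionalIdeal.spanSingleton R⁰ (b ^ 2 - a * c) ≤ (1 : FractionalIdeal R⁰ K) :=
    FractionalIdeal.spanSingleton_le_iff_mem.2 (first_covariant_mem ha hb hc)
  have h2 : FractionalIdeal.spanSingleton R⁰ (a * d - b * c) * (𝔞 : FractionalIdeal R⁰ K) ≤ 1 := by
    rw [← inv_mul_unit 𝔞]
    refine mul_le_mul_left (FractionalIdeal.spanSingleton_le_iff_mem.2 ?_) _
    rw [← neg_sub]
    exact frac_neg_mem (middle_covariant_mem ha hb hc hd)
  have h3 : FractionalIdeal.spanSingleton R⁰ (c ^ 2 - b * d) *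
      (𝔞 : FractionalIdeal R⁰ K) ^ 2 ≤ 1 := by
    have : ((𝔞⁻¹ ^ 2 : (FractionalIdeal R⁰ K)ˣ) : FractionalIdeal R⁰ K) *
        (𝔞 : FractionalIdeal R⁰ K) ^ 2 = 1 := by
      rw [Units.val_pow_eq_pow_val, ← mul_pow, inv_mul_unit, one_pow]
    rw [← this]
    exact mul_le_mul_left (FractionalIdeal.spanSingleton_le_iff_mem.2
      (last_covariant_mem hb hc hd)) _
  obtain ⟨A, hA⟩ := FractionalIdeal.le_one_iff_exists_coeIdeal.1 (sup_le (sup_le h1 h2) h3)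
  by_cases hA1 : A = ⊤
  · rw [hA1, FractionalIdeal.coeIdeal_top] at hA
    exact hA.symm
  · obtain ⟨P, hP, hAP⟩ := Ideal.exists_le_maximal A hA1
    have hAP' : (A : FractionalIdeal R⁰ K) ≤ P := FractionalIdeal.coeIdeal_le_coeIdeal K |>.2 hAP
    rw [hA] at hAP'
    obtain ⟨h4, h5⟩ := sup_le_iff.1 hAP'
    obtain ⟨h6, h7⟩ := sup_le_iff.1 h4
    exact absurd ⟨P, hP.isPrime, h6, h7, h5⟩ (h a b c d rfl)

section Invertible

variable {f : MvPolynomial (Fin 2) K} {Q : BalancedQuadruple 𝔞}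

/-- The inverse is the conjugate of I up to the scalar s, namely J = Rα' + 𝔞β'. The products of
generators are p, θ, m − θ and r, so IJ ⊆ S, and IJ contains the ideal generated by p, m𝔞 and r𝔞²,
which is R for a projective form. -/
theorem Corresponds.isInvertible_of_isProjective (h : Corresponds f Q)
    (hf : IsProjectiveForm 𝔞 f) : IsInvertibleIdeal Q.I := by
  obtain ⟨π, α, β, θ, α', β', a, b, c, d, -, -, rfl, hn⟩ := h.exists_isNormalForm
  have hsum := hf.sum_eq_one hn.mem_a hn.mem_b hn.mem_c hn.mem_d
  have hpp := first_covariant_mem hn.mem_a hn.mem_b hn.mem_c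
  have hmm := middle_covariant_mem hn.mem_a hn.mem_b hn.mem_c hn.mem_d
  have hrr := last_covariant_mem hn.mem_b hn.mem_c hn.mem_d
  set p := b ^ 2 - a * c with hp
  set m := b * c - a * d with hm
  set r := c ^ 2 - b * d with hr
  have h1θ := LinearIndependent.pair_iff.1 hn.ring_decomp.1
  -- A relation xα' + yβ' = 0 becomes xθ + yr = 0 after multiplication by β, so x = 0;
  -- multiplication by α then gives y(m − θ) = 0, so y = 0.
  have hi : LinearIndependent K ![α', β'] := by
    refine LinearIndependent.pair_iff.2 fun x y hxy => ?_
    have h1 : x • θ + (y * r) • 1 = 0 := by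
      have := congrArg (· * β) hxy
      simp only [add_mul, smul_mul_assoc, zero_mul] at this
      rwa [hn.mul_θ, mul_comm β', hn.mul_β, smul_smul] at this
    obtain ⟨-, hx⟩ := h1θ (y * r) x (by rw [← h1]; module)
    have h2 : (y * m) • (1 : K ⊗[R] Q.S) + (-y) • θ = 0 := by
      have := congrArg (α * ·) hxy
      simp only [mul_smul_comm, mul_zero, hx, zero_smul, zero_add] at this
      rw [hn.mul_conj] at this
      rw [← this]
      module
    obtain ⟨-, hy⟩ := h1θ _ _ h2
    exact ⟨hx, neg_eq_zero.1 hy⟩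
  have hJ := pairLattice_decomp (𝔞 := 𝔞) hi
  set J := pairLattice 𝔞 α' β'
  have hθα : θ * α' = m • α' - p • β' := by
    have h1 : θ = m • 1 - α * β' := by
      rw [hn.mul_conj]
      ring
    rw [h1, sub_mul, smul_one_mul, mul_right_comm, hn.mul_α, smul_one_mul]
  have hθβ : θ * β' = r • α' := by
    rw [← hn.mul_θ, mul_assoc, hn.mul_β, mul_smul_one]
  have hJf : IsFracIdeal J := by
    refine ⟨fun x y hy => ?_, hJ.fg, hJ.span_eq_top hn.finrank_eq⟩
    obtain ⟨s, hs, t, ht, hst⟩ := (hn.ring_decomp.mem_iff _).1 (mem_ringLattice.2 ⟨x, rfl⟩)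
    obtain ⟨u, hu, v, hv, rfl⟩ := (hJ.mem_iff y).1 hy
    rw [Units.val_one] at hs hu
    refine (hJ.mem_iff _).2 ⟨s * u + t * m * u + t * (v * r), ?_, s * v - t * (u * p), ?_, ?_⟩
    · rw [Units.val_one]
      refine frac_add_mem (frac_add_mem (mul_mem_of_eq (one_mul _) hs hu)
        (mul_mem_of_eq (one_mul _) (mul_inv_mem hmm ht) hu)) ?_
      exact mul_inv_mem (mul_inv_sq_mem hrr hv) ht
    · exact frac_sub_mem (mul_mem_of_eq (one_mul _) hs hv)
        (mul_mem_of_eq (mul_one _) ht (mul_mem_of_eq (one_mul _) hu hpp))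
    · rw [hst, add_mul, smul_one_mul, smul_mul_assoc, mul_add, mul_smul_comm, mul_smul_comm, hθα,
        hθβ]
      module
  have hαI : α ∈ Q.I := (hn.ideal_decomp.mem_iff _).2
    ⟨1, by simp, 0, FractionalIdeal.zero_mem _, by module⟩
  have hβI : ∀ t ∈ (𝔞 : FractionalIdeal R⁰ K), t • β ∈ Q.I := fun t ht =>
    (hn.ideal_decomp.mem_iff _).2 ⟨0, FractionalIdeal.zero_mem _, t, ht, by module⟩
  have hαJ : α' ∈ J := (hJ.mem_iff _).2
    ⟨1, by simp, 0, FractionalIdeal.zero_mem _, by module⟩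
  have hβJ : ∀ t ∈ (𝔞 : FractionalIdeal R⁰ K), t • β' ∈ J := fun t ht =>
    (hJ.mem_iff _).2 ⟨0, FractionalIdeal.zero_mem _, t, ht, by module⟩
  refine ⟨J, hJf, le_antisymm ?_ ?_⟩
  · rw [Submodule.mul_le]
    intro x hx y hy
    obtain ⟨s, hs, t, ht, rfl⟩ := (hn.ideal_decomp.mem_iff x).1 hx
    obtain ⟨u, hu, v, hv, rfl⟩ := (hJ.mem_iff y).1 hy
    rw [Units.val_one] at hs hu
    refine (hn.ring_decomp.mem_iff _).2
      ⟨s * u * p + s * (v * m) + t * (v * r), ?_, t * u - s * v, ?_, ?_⟩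
    · rw [Units.val_one]
      refine frac_add_mem (frac_add_mem (mul_mem_of_eq (one_mul _)
        (mul_mem_of_eq (one_mul _) hs hu) hpp) (mul_mem_of_eq (one_mul _) hs
        (mul_inv_mem hmm hv))) (mul_inv_mem (mul_inv_sq_mem hrr hv) ht)
    · exact frac_sub_mem (mul_mem_of_eq (mul_one _) ht hu) (mul_mem_of_eq (one_mul _) hs hv)
    · have h1 : β * α' = θ := by rw [mul_comm, hn.mul_θ]
      simp only [add_mul, mul_add, smul_mul_assoc, mul_smul_comm]
      rw [hn.mul_α, hn.mul_conj, h1, hn.mul_β]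
      module
  · have hone : (1 : K ⊗[R] Q.S) ∈ Q.I * J := by
      let F : K →ₗ[R] K ⊗[R] Q.S := (LinearMap.toSpanSingleton K _ 1).restrictScalars R
      have hp' : ∀ x ∈ FractionalIdeal.spanSingleton R⁰ p, F x ∈ Q.I * J := by
        intro x hx
        obtain ⟨z, rfl⟩ := (FractionalIdeal.mem_spanSingleton R⁰).1 hx
        rw [map_smul]
        refine Submodule.smul_mem _ _ ?_
        change p • (1 : K ⊗[R] Q.S) ∈ _
        rw [← hn.mul_α]
        exact Submodule.mul_mem_mul hαI hαJ
      have hm' : ∀ x ∈ FractionalIdeal.spanSingleton R⁰ (a * d - b * c) *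
          (𝔞 : FractionalIdeal R⁰ K), F x ∈ Q.I * J := by
        intro x hx
        obtain ⟨t, ht, rfl⟩ := FractionalIdeal.mem_singleton_mul.1 hx
        change ((a * d - b * c) * t) • (1 : K ⊗[R] Q.S) ∈ _
        -- In αβ' + βα' = (m − θ) + θ the θ cancels; the outer sign appears because the projectivity
        -- condition uses ad − bc = −m.
        have : ((a * d - b * c) * t) • (1 : K ⊗[R] Q.S) =
            -(α * (t • β') + (t • β) * α') := by
          rw [mul_smul_comm, smul_mul_assoc, hn.mul_conj, mul_comm β, hn.mul_θ]
          module
        rw [this]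
        exact Submodule.neg_mem _ (Submodule.add_mem _ (Submodule.mul_mem_mul hαI (hβJ t ht))
          (Submodule.mul_mem_mul (hβI t ht) hαJ))
      have hr' : ∀ x ∈ FractionalIdeal.spanSingleton R⁰ r *
          (𝔞 : FractionalIdeal R⁰ K) ^ 2, F x ∈ Q.I * J := by
        intro x hx
        obtain ⟨y, hy, rfl⟩ := FractionalIdeal.mem_singleton_mul.1 hx
        rw [pow_two, ← FractionalIdeal.mem_coe, FractionalIdeal.coe_mul] at hy
        refine Submodule.mul_induction_on hy ?_ ?_
        · intro t ht t' ht'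
          change (r * (t * t')) • (1 : K ⊗[R] Q.S) ∈ _
          have : (r * (t * t')) • (1 : K ⊗[R] Q.S) = (t • β) * (t' • β') := by
            rw [mul_smul_comm, smul_mul_assoc, hn.mul_β]
            module
          rw [this]
          exact Submodule.mul_mem_mul (hβI t ht) (hβJ t' ht')
        · intro x y hx hy
          rw [mul_add, map_add]
          exact Submodule.add_mem _ hx hy
      have h1 : (1 : K) ∈ (1 : FractionalIdeal R⁰ K) := one_mem_frac_one
      rw [← hsum, FractionalIdeal.mem_add] at h1
      obtain ⟨y, hy, z, hz, hyz⟩ := h1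
      rw [FractionalIdeal.mem_add] at hy
      obtain ⟨y', hy', y'', hy'', hyy⟩ := hy
      have h2 : F 1 = 1 := by simp [F]
      rw [← h2, ← hyz, ← hyy, map_add, map_add]
      exact Submodule.add_mem _ (Submodule.add_mem _
        (hp' _ hy') (hm' _ hy'')) (hr' _ hz)
    have hstab : ∀ (x : Q.S), ∀ z ∈ Q.I * J, ((1 : K) ⊗ₜ[R] x) * z ∈ Q.I * J := by
      intro x z hz
      refine Submodule.mul_induction_on hz ?_ ?_
      · intro i hi j hj
        rw [← mul_assoc]
        exact Submodule.mul_mem_mul (Q.isFracIdeal.smul_mem x i hi) hj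
      · intro y z hy hz
        rw [mul_add]
        exact Submodule.add_mem _ hy hz
    intro x hx
    obtain ⟨y, rfl⟩ := mem_ringLattice.1 hx
    have := hstab y 1 hone
    rwa [mul_one] at this

/-- If P divides all covariants, then θα = pβ and θβ = mβ − rα give 𝔞θI ⊆ PI. Multiplying by the
inverse of I yields 𝔞θ ⊆ PS, and comparing θ-coordinates, 𝔞 ⊆ P𝔞, so P = R. -/
theorem Corresponds.isProjective_of_isInvertible (h3 : (3 : K) ≠ 0) (h : Corresponds f Q)
    (hI : IsInvertibleIdeal Q.I) : IsProjectiveForm 𝔞 f := by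
  obtain ⟨π, α, β, θ, α', β', a, b, c, d, -, -, rfl, hn⟩ := h.exists_isNormalForm
  intro a₁ b₁ c₁ d₁ hf
  obtain ⟨rfl, rfl, rfl, rfl⟩ := cubicForm_injective h3 hf
  rintro ⟨P, hP, hp, hm, hr⟩
  obtain ⟨J, -, hIJ⟩ := hI
  have hp' : b ^ 2 - a * c ∈ (P : FractionalIdeal R⁰ K) :=
    FractionalIdeal.spanSingleton_le_iff_mem.1 hp
  have hm' : ∀ t ∈ (𝔞 : FractionalIdeal R⁰ K),
      t * (b * c - a * d) ∈ (P : FractionalIdeal R⁰ K) := by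
    intro t ht
    have := frac_neg_mem (hm (FractionalIdeal.mem_singleton_mul.2 ⟨t, ht, rfl⟩))
    convert this using 1
    ring
  have hr' : ∀ t ∈ (𝔞 : FractionalIdeal R⁰ K), ∀ t' ∈ (𝔞 : FractionalIdeal R⁰ K),
      t * t' * (c ^ 2 - b * d) ∈ (P : FractionalIdeal R⁰ K) := by
    intro t ht t' ht'
    have := hr (FractionalIdeal.mem_singleton_mul.2
      ⟨t * t', mul_mem_of_eq (pow_two _).symm ht ht', rfl⟩)
    rwa [mul_comm]
  have hPle : (P : FractionalIdeal R⁰ K) ≤ 1 := FractionalIdeal.coeIdeal_le_one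
  -- N is PS = P + P𝔞θ, written in coordinates so that the coefficient of θ can be read off.
  let N : Submodule R (K ⊗[R] Q.S) :=
    Submodule.map ((LinearMap.toSpanSingleton K _ 1).restrictScalars R)
      ((P : FractionalIdeal R⁰ K) : Submodule R K) ⊔
    Submodule.map ((LinearMap.toSpanSingleton K _ θ).restrictScalars R)
      ((P * 𝔞 : FractionalIdeal R⁰ K) : Submodule R K)
  have hN : ∀ x, x ∈ N ↔ ∃ s ∈ (P : FractionalIdeal R⁰ K),
      ∃ t ∈ (P * 𝔞 : FractionalIdeal R⁰ K), x = s • 1 + t • θ := by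
    intro x
    rw [Submodule.mem_sup]
    constructor
    · rintro ⟨_, ⟨s, hs, rfl⟩, _, ⟨t, ht, rfl⟩, rfl⟩
      exact ⟨s, hs, t, ht, rfl⟩
    · rintro ⟨s, hs, t, ht, rfl⟩
      exact ⟨_, ⟨s, hs, rfl⟩, _, ⟨t, ht, rfl⟩, rfl⟩
  have hPS : ∀ x ∈ (P : FractionalIdeal R⁰ K), ∀ y ∈ ringLattice R K Q.S, x • y ∈ N := by
    intro x hx y hy
    obtain ⟨s, hs, t, ht, rfl⟩ := (hn.ring_decomp.mem_iff y).1 hy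
    rw [Units.val_one] at hs
    exact (hN _).2 ⟨x * s, mul_mem_of_eq (mul_one _) hx hs, x * t, mul_mem_of_eq rfl hx ht,
      by module⟩
  have hαI : α ∈ Q.I := (hn.ideal_decomp.mem_iff _).2
    ⟨1, by simp, 0, FractionalIdeal.zero_mem _, by module⟩
  have hβI : ∀ t ∈ (𝔞 : FractionalIdeal R⁰ K), t • β ∈ Q.I := fun t ht =>
    (hn.ideal_decomp.mem_iff _).2 ⟨0, FractionalIdeal.zero_mem _, t, ht, by module⟩
  have hβN : ∀ y ∈ (P * 𝔞 : FractionalIdeal R⁰ K), ∀ j ∈ J, y • (β * j) ∈ N := by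
    intro y hy j hj
    rw [← FractionalIdeal.mem_coe, FractionalIdeal.coe_mul] at hy
    refine Submodule.mul_induction_on hy ?_ ?_
    · intro x hx t ht
      have := hPS x hx ((t • β) * j) (hIJ ▸ Submodule.mul_mem_mul (hβI t ht) hj)
      rwa [smul_mul_assoc, smul_smul] at this
    · intro x y hx hy
      rw [add_smul]
      exact N.add_mem hx hy
  have key : ∀ t ∈ (𝔞 : FractionalIdeal R⁰ K), ∀ z ∈ Q.I * J, t • (θ * z) ∈ N := by
    intro t ht z hz
    refine Submodule.mul_induction_on hz ?_ ?_
    · intro i hi j hj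
      obtain ⟨u, hu, v, hv, rfl⟩ := (hn.ideal_decomp.mem_iff i).1 hi
      rw [Units.val_one] at hu
      have h1 : t • (θ * ((u • α + v • β) * j)) = (-(t * v * (c ^ 2 - b * d))) • (α * j) +
          ((b ^ 2 - a * c) * (t * u) + t * (b * c - a * d) * v) • (β * j) := by
        have : θ * ((u • α + v • β) * j) = (u • (θ * α) + v • (θ * β)) * j := by
          rw [← mul_assoc, mul_add, mul_smul_comm, mul_smul_comm]
        rw [this, hn.θ_mul_α, hn.θ_mul_β]
        simp only [add_mul, sub_mul, smul_mul_assoc, smul_sub, smul_add]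
        module
      rw [h1]
      refine N.add_mem (hPS _ (frac_neg_mem (hr' t ht v hv)) _
        (hIJ ▸ Submodule.mul_mem_mul hαI hj)) (hβN _ ?_ j hj)
      exact frac_add_mem (mul_mem_of_eq rfl hp' (mul_mem_of_eq (mul_one _) ht hu))
        (mul_mem_of_eq rfl (hm' t ht) hv)
    · intro x y hx hy
      rw [mul_add, smul_add]
      exact N.add_mem hx hy
  have hle : (𝔞 : FractionalIdeal R⁰ K) ≤ P * 𝔞 := by
    intro t ht
    have h1 := key t ht 1 (hIJ ▸ one_mem_ringLattice)
    rw [mul_one] at h1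
    obtain ⟨s, hs, t', ht', h2⟩ := (hN _).1 h1
    obtain ⟨-, h4⟩ := LinearIndependent.pair_iff.1 hn.ring_decomp.1 s (t' - t) (by
      rw [sub_smul, h2]
      module)
    rwa [← sub_eq_zero.1 h4]
  have h1P := mul_le_mul_left hle ((𝔞⁻¹ : (FractionalIdeal R⁰ K)ˣ) : FractionalIdeal R⁰ K)
  rw [mul_assoc, unit_mul_inv, mul_one] at h1P
  have h1 : (1 : K) ∈ (P : FractionalIdeal R⁰ K) := h1P one_mem_frac_one
  obtain ⟨x, hx, hx1⟩ := (FractionalIdeal.mem_coeIdeal R⁰).1 h1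
  have : x = 1 := FaithfulSMul.algebraMap_injective R K (by rw [hx1, map_one])
  exact hP.ne_top ((Ideal.eq_top_iff_one P).2 (this ▸ hx))

end Invertible

end

/-! ### Realizing an order as a ring, and the model algebra of a form -/

section

variable {R : Type u} [CommRing R] [IsDedekindDomain R]
  {K : Type v} [Field K] [Algebra R K] [IsFractionRing R K]
variable {R : Type u} [CommRing R] [IsDedekindDomain R]
  {K : Type v} [Field K] [Algebra R K] [IsFractionRing R K]
  {𝔞 : (FractionalIdeal R⁰ K)ˣ}

/-- The ring of a quadruple must live in the universe of R, while K may live in another one; this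
lets an order built over K be moved to the universe of R. -/
theorem small_fractionField (R : Type u) (K : Type v) [CommRing R] [IsDomain R] [Field K]
    [Algebra R K] [IsFractionRing R K] : Small.{u} K :=
  Small.mk' (FractionRing.algEquiv R K).symm.toEquiv

/-- An order in a finite-dimensional algebra is realised by a ring in the universe of the
base ring. -/
theorem exists_ring_of_subalgebra {L : Type*} [CommRing L] [Algebra K L] [Algebra R L]
    [IsScalarTower R K L] [Module.Finite K L] (T : Subalgebra R L)
    (hT : (Subalgebra.toSubmodule T).FG) (hspan : Submodule.span K (T : Set L) = ⊤) :
    ∃ (S : Type u) (_ : CommRing S) (_ : Algebra R S), Module.Finite R S ∧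
      Module.IsTorsionFree R S ∧
      ∃ e : (K ⊗[R] S) ≃ₐ[K] L, ∀ x, x ∈ ringLattice R K S ↔ e x ∈ T := by
  have : Small.{u} K := small_fractionField R K
  have : Small.{u} L := small_map (Module.finBasis K L).equivFun.toEquiv
  have : Small.{u} T := small_subtype L _
  let i : Shrink.{u} T ≃ₐ[R] T := Shrink.algEquiv R T
  let j : Shrink.{u} T →ₐ[R] L := T.val.comp i.toAlgHom
  have hj : Function.Injective j := Subtype.val_injective.comp i.injective
  have hjT : ∀ z : L, z ∈ T ↔ ∃ x, j x = z := by
    intro z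
    constructor
    · intro hz
      refine ⟨i.symm ⟨z, hz⟩, ?_⟩
      change (i (i.symm ⟨z, hz⟩)).val = z
      rw [i.apply_symm_apply]
    · rintro ⟨x, rfl⟩
      exact (i x).2
  have hfT : Module.Finite R T := Module.Finite.iff_fg.2 hT
  have hRL : Module.IsTorsionFree R L := Module.IsTorsionFree.trans_faithfulSMul R K L
  let F : K ⊗[R] Shrink.{u} T →ₐ[K] L :=
    Algebra.TensorProduct.productLeftAlgHom (Algebra.ofId K L) j
  have hF : ∀ x, F ((1 : K) ⊗ₜ[R] x) = j x := by
    intro x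
    simp [F]
  have hFR : ∀ (r : R) (x : K ⊗[R] Shrink.{u} T), F (r • x) = r • F x := fun r x => by
    rw [← algebraMap_smul K r x, map_smul, algebraMap_smul]
  have hFb : Function.Bijective F := by
    constructor
    · refine (injective_iff_map_eq_zero F).2 fun x hx => ?_
      -- Clearing denominators puts a kernel element into the image of the order, where the map is
      -- the inclusion and hence injective.
      obtain ⟨r, hr, y, hy⟩ := exists_smul_mem_ringLattice x
      have h1 : j y = 0 := by rw [← hF, hy, hFR, hx, smul_zero]
      rw [hj (h1.trans (map_zero j).symm), TensorProduct.tmul_zero, ← algebraMap_smul K r x] at hy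
      exact (smul_eq_zero.1 hy.symm).resolve_left (by simpa using hr)
    · have h1 : (⊤ : Submodule K L) ≤ LinearMap.range F.toLinearMap := by
        rw [← hspan, Submodule.span_le]
        intro z hz
        obtain ⟨x, rfl⟩ := (hjT z).1 hz
        exact ⟨(1 : K) ⊗ₜ[R] x, hF x⟩
      intro z
      exact h1 (Submodule.mem_top (x := z))
  refine ⟨Shrink.{u} T, inferInstance, inferInstance, Module.Finite.equiv i.symm.toLinearEquiv,
    Function.Injective.moduleIsTorsionFree j hj fun r x => map_smul j r x,
    AlgEquiv.ofBijective F hFb, fun x => ?_⟩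
  rw [AlgEquiv.ofBijective_apply, hjT, mem_ringLattice]
  refine exists_congr fun y => ?_
  rw [← hF, hFb.1.eq_iff]

section Powers

/-- With all ideals written as powers of 𝔞, membership of a product becomes addition of exponents.
-/
theorem zpow_mul_mem {i j k : ℤ} {x y : K}
    (hx : x ∈ ((𝔞 ^ i : (FractionalIdeal R⁰ K)ˣ) : FractionalIdeal R⁰ K))
    (hy : y ∈ ((𝔞 ^ j : (FractionalIdeal R⁰ K)ˣ) : FractionalIdeal R⁰ K)) (h : i + j = k) :
    x * y ∈ ((𝔞 ^ k : (FractionalIdeal R⁰ K)ˣ) : FractionalIdeal R⁰ K) :=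
  mul_mem_of_eq (by rw [← Units.val_mul, ← zpow_add, h]) hx hy

end Powers

section Model

/-- The order `R + 𝔞 ω` in a quadratic algebra. -/
def modelOrder (𝔞 : (FractionalIdeal R⁰ K)ˣ) {A B : K}
    (hA : ∀ s ∈ (𝔞 : FractionalIdeal R⁰ K), ∀ t ∈ (𝔞 : FractionalIdeal R⁰ K),
      A * s * t ∈ (1 : FractionalIdeal R⁰ K))
    (hB : B ∈ ((𝔞⁻¹ : (FractionalIdeal R⁰ K)ˣ) : FractionalIdeal R⁰ K)) :
    Subalgebra R (QuadraticAlgebra K A B) where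
  carrier := {z | z.re ∈ (1 : FractionalIdeal R⁰ K) ∧ z.im ∈ (𝔞 : FractionalIdeal R⁰ K)}
  mul_mem' := by
    rintro x y ⟨hx, hx'⟩ ⟨hy, hy'⟩
    refine ⟨?_, ?_⟩
    · rw [QuadraticAlgebra.re_mul]
      exact frac_add_mem (mul_mem_of_eq (one_mul _) hx hy) (hA _ hx' _ hy')
    · rw [QuadraticAlgebra.im_mul]
      refine frac_add_mem (frac_add_mem (mul_mem_of_eq (one_mul _) hx hy')
        (mul_mem_of_eq (mul_one _) hx' hy)) (mul_mem_of_eq ?_ (mul_mem_of_eq rfl hB hx') hy')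
      rw [inv_mul_unit, one_mul]
  add_mem' := by
    rintro x y ⟨hx, hx'⟩ ⟨hy, hy'⟩
    exact ⟨frac_add_mem hx hy, frac_add_mem hx' hy'⟩
  algebraMap_mem' := by
    intro r
    rw [IsScalarTower.algebraMap_apply R K, QuadraticAlgebra.algebraMap_eq]
    exact ⟨(FractionalIdeal.mem_one_iff R⁰).2 ⟨r, rfl⟩, FractionalIdeal.zero_mem _⟩

variable {a b c d : K}

/-- A pair `α, β` and a scalar `l` in the quadratic algebra attached to a nondegenerate form that
recover the form. -/
theorem exists_model {p m r : K} (hp : p = b ^ 2 - a * c) (hm : m = b * c - a * d)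
    (hr : r = c ^ 2 - b * d) (h0 : m ^ 2 + 4 * -(p * r) ≠ 0) :
    ∃ (q : K) (α β l : QuadraticAlgebra K (-(p * r)) m), q ≠ 0 ∧
      α.re * β.im - α.im * β.re = q ∧ q ^ 3 * l.norm = 1 ∧
      QuadraticAlgebra.omega * α = p • β ∧ QuadraticAlgebra.omega * β = m • β - r • α ∧
      α ^ 3 * l = ⟨p * b - a * m, a⟩ ∧ α ^ 2 * β * l = ⟨-(a * r), b⟩ ∧
      α * β ^ 2 * l = ⟨-(b * r), c⟩ ∧ β ^ 3 * l = ⟨-(c * r), d⟩ := by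
  -- The Hessian x²p + xym + y²r takes a nonzero value at (1,0), (0,1) or (1,1), for otherwise p = m
  -- = r = 0 and the discriminant vanishes.
  obtain ⟨x, y, hq⟩ : ∃ x y : K, x ^ 2 * p + x * y * m + y ^ 2 * r ≠ 0 := by
    by_contra! h
    have h1 := h 1 0
    have h2 := h 0 1
    have h3 := h 1 1
    have hp0 : p = 0 := by linear_combination h1
    have hr0 : r = 0 := by linear_combination h2
    have hm0 : m = 0 := by linear_combination h3 - h1 - h2
    exact h0 (by rw [hp0, hm0]; ring)
  set q := x ^ 2 * p + x * y * m + y ^ 2 * r with hqd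
  -- A solution of ωα = pβ, ωβ = mβ − rα, normalized so that xα + yβ is the nonzero scalar q.
  let α : QuadraticAlgebra K (-(p * r)) m := ⟨x * p + y * m, -y⟩
  let β : QuadraticAlgebra K (-(p * r)) m := ⟨y * r, x⟩
  -- Aᵢ is to be αⁱβ³⁻ⁱl. Its ω-coordinate is the given coefficient of the form; its first
  -- coordinate is forced by comparing ω-coordinates in ωA₃ = pA₂, ωA₂ = pA₁, ωA₁ = mA₁ − rA₂ and
  -- ωA₀ = mA₀ − rA₁.
  let A₃ : QuadraticAlgebra K (-(p * r)) m := ⟨p * b - a * m, a⟩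
  let A₂ : QuadraticAlgebra K (-(p * r)) m := ⟨-(a * r), b⟩
  let A₁ : QuadraticAlgebra K (-(p * r)) m := ⟨-(b * r), c⟩
  let A₀ : QuadraticAlgebra K (-(p * r)) m := ⟨-(c * r), d⟩
  have h23 : α * A₂ = β * A₃ := by
    ext
    · simp only [α, β, A₂, A₃, QuadraticAlgebra.re_mul]
      rw [hp, hm, hr]
      ring
    · simp only [α, β, A₂, A₃, QuadraticAlgebra.im_mul]
      rw [hp, hm, hr]
      ring
  have h12 : α * A₁ = β * A₂ := by
    ext
    · simp only [α, β, A₂, A₁, QuadraticAlgebra.re_mul]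
      rw [hp, hm, hr]
      ring
    · simp only [α, β, A₂, A₁, QuadraticAlgebra.im_mul]
      rw [hp, hm, hr]
      ring
  have h01 : α * A₀ = β * A₁ := by
    ext
    · simp only [α, β, A₀, A₁, QuadraticAlgebra.re_mul]
      rw [hp, hm, hr]
      ring
    · simp only [α, β, A₀, A₁, QuadraticAlgebra.im_mul]
      rw [hp, hm, hr]
      ring
  let X := algebraMap K (QuadraticAlgebra K (-(p * r)) m) x
  let Y := algebraMap K (QuadraticAlgebra K (-(p * r)) m) y
  let q' := algebraMap K (QuadraticAlgebra K (-(p * r)) m) q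
  let qi := algebraMap K (QuadraticAlgebra K (-(p * r)) m) q⁻¹
  have hqq : qi * q' = 1 := by
    rw [← map_mul, inv_mul_cancel₀ hq, map_one]
  have hone : X * α + Y * β = q' := by
    ext
    · simp only [X, Y, q', α, β, QuadraticAlgebra.re_add, QuadraticAlgebra.re_mul,
        QuadraticAlgebra.algebraMap_re, QuadraticAlgebra.algebraMap_im]
      rw [hqd]
      ring
    · simp only [X, Y, q', α, β, QuadraticAlgebra.im_add, QuadraticAlgebra.im_mul,
        QuadraticAlgebra.algebraMap_re, QuadraticAlgebra.algebraMap_im]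
      ring
  -- Expand q³l = (xα + yβ)³l and substitute Aᵢ for αⁱβ³⁻ⁱl.
  let l := qi ^ 3 * (X ^ 3 * A₃ + 3 * X ^ 2 * Y * A₂ + 3 * X * Y ^ 2 * A₁ + Y ^ 3 * A₀)
  have hc : qi ^ 3 * (X * α + Y * β) ^ 3 = 1 := by
    rw [hone, ← mul_pow, hqq, one_pow]
  have e₃ : α ^ 3 * l = A₃ := by
    linear_combination A₃ * hc + qi ^ 3 * ((3 * X ^ 2 * Y * α ^ 2) * h23 +
      3 * X * Y ^ 2 * (α ^ 2 * h12 + α * β * h23) +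
      Y ^ 3 * (α ^ 2 * h01 + α * β * h12 + β ^ 2 * h23))
  have e₂ : α ^ 2 * β * l = A₂ := by
    linear_combination A₂ * hc + qi ^ 3 * ((-X ^ 3 * α ^ 2) * h23 +
      3 * X * Y ^ 2 * (α * β * h12) + Y ^ 3 * (α * β * h01 + β ^ 2 * h12))
  have e₁ : α * β ^ 2 * l = A₁ := by
    linear_combination A₁ * hc + qi ^ 3 * (-X ^ 3 * (α * β * h23 + α ^ 2 * h12) -
      3 * X ^ 2 * Y * (α * β * h12) + Y ^ 3 * (β ^ 2 * h01))
  have e₀ : β ^ 3 * l = A₀ := by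
    linear_combination A₀ * hc + qi ^ 3 * (-X ^ 3 * (β ^ 2 * h23 + α * β * h12 + α ^ 2 * h01) -
      3 * X ^ 2 * Y * (β ^ 2 * h12 + α * β * h01) - 3 * X * Y ^ 2 * (β ^ 2 * h01))
  have hdet : α.re * β.im - α.im * β.re = q := by
    simp only [α, β, hqd]
    ring
  have hαn : α.norm = p * q := by
    simp only [α, QuadraticAlgebra.norm_def, hqd]
    ring
  have hβn : β.norm = r * q := by
    simp only [β, QuadraticAlgebra.norm_def, hqd]
    ring
  have htr : (star α * β).trace = m * q := by
    simp only [α, β, QuadraticAlgebra.trace_def, QuadraticAlgebra.im_mul, QuadraticAlgebra.re_mul,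
      QuadraticAlgebra.re_star, QuadraticAlgebra.im_star, hqd]
    ring
  -- The Hessian identity with N(α) = pq reads p = p·q³N(l). As p may vanish, nothing is cancelled
  -- yet: the analogous relations for m and r are combined with weights x², xy, y², and the nonzero
  -- q is cancelled at the end.
  have hp1 : p * (q ^ 3 * l.norm - 1) = 0 := by
    have h := hessian_of_functional α β (α * l)
    have i1 : α * l * α * β = A₂ := by rw [← e₂]; ring
    have i2 : α * l * α ^ 2 = A₃ := by rw [← e₃]; ring
    have i3 : α * l * β ^ 2 = A₁ := by rw [← e₁]; ring
    rw [i1, i2, i3, hdet, map_mul, hαn] at h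
    simp only [A₁, A₂, A₃] at h
    linear_combination -h - hp
  have hr1 : r * (q ^ 3 * l.norm - 1) = 0 := by
    have h := hessian_of_functional α β (β * l)
    have i1 : β * l * α * β = A₁ := by rw [← e₁]; ring
    have i2 : β * l * α ^ 2 = A₂ := by rw [← e₂]; ring
    have i3 : β * l * β ^ 2 = A₀ := by rw [← e₀]; ring
    rw [i1, i2, i3, hdet, map_mul, hβn] at h
    simp only [A₁, A₂, A₀] at h
    linear_combination -h - hr
  have hm1 : m * (q ^ 3 * l.norm - 1) = 0 := by
    have h := hessian_middle α β l
    rw [e₀, e₁, e₂, e₃, hdet, htr] at h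
    simp only [A₁, A₂, A₀, A₃] at h
    linear_combination -h - hm
  refine ⟨q, α, β, l, hq, hdet, ?_, ?_, ?_, e₃, e₂, e₁, e₀⟩
  · have : q * (q ^ 3 * l.norm - 1) = 0 := by
      linear_combination (q ^ 3 * l.norm - 1) * hqd + x ^ 2 * hp1 + x * y * hm1 + y ^ 2 * hr1
    exact sub_eq_zero.1 ((mul_eq_zero.1 this).resolve_left hq)
  · ext <;> simp only [α, β, QuadraticAlgebra.re_mul, QuadraticAlgebra.im_mul,
      QuadraticAlgebra.omega_re, QuadraticAlgebra.omega_im, QuadraticAlgebra.re_smul,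
      QuadraticAlgebra.im_smul, smul_eq_mul] <;> ring
  · ext <;> simp only [α, β, QuadraticAlgebra.re_mul, QuadraticAlgebra.im_mul,
      QuadraticAlgebra.omega_re, QuadraticAlgebra.omega_im, QuadraticAlgebra.re_smul,
      QuadraticAlgebra.im_smul, QuadraticAlgebra.re_sub, QuadraticAlgebra.im_sub, smul_eq_mul] <;>
      ring

end Model

end

/-! ### Surjectivity: a quadruple for every nondegenerate form -/

section

variable {R : Type u} [CommRing R] [IsDedekindDomain R]
  {K : Type v} [Field K] [Algebra R K] [IsFractionRing R K]
section Existence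

variable {R : Type u} [CommRing R] [IsDedekindDomain R]
  {K : Type v} [Field K] [Algebra R K] [IsFractionRing R K]
  {𝔞 : (FractionalIdeal R⁰ K)ˣ}

theorem modelOrder_decomp {A B : K} (hA : ∀ s ∈ (𝔞 : FractionalIdeal R⁰ K),
      ∀ t ∈ (𝔞 : FractionalIdeal R⁰ K), A * s * t ∈ (1 : FractionalIdeal R⁰ K))
    (hB : B ∈ ((𝔞⁻¹ : (FractionalIdeal R⁰ K)ˣ) : FractionalIdeal R⁰ K)) :
    IsSteinitzDecomp (Subalgebra.toSubmodule (modelOrder 𝔞 hA hB)) ![1, 𝔞]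
      ![1, QuadraticAlgebra.omega] := by
  have hz : ∀ s t : K, s • (1 : QuadraticAlgebra K A B) + t • QuadraticAlgebra.omega = ⟨s, t⟩ := by
    intro s t
    ext <;> simp [QuadraticAlgebra.re_one, QuadraticAlgebra.im_one, QuadraticAlgebra.omega_re,
      QuadraticAlgebra.omega_im]
  refine IsSteinitzDecomp.mk (LinearIndependent.pair_iff.2 fun s t hst => ?_) fun x => ?_
  · rw [hz] at hst
    exact ⟨congrArg QuadraticAlgebra.re hst, congrArg QuadraticAlgebra.im hst⟩
  · rw [Units.val_one]
    constructor
    · rintro ⟨h1, h2⟩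
      exact ⟨x.re, h1, x.im, h2, (hz _ _).symm⟩
    · rintro ⟨s, hs, t, ht, rfl⟩
      rw [hz]
      exact ⟨hs, ht⟩

/-- The products of three elements of `R α + 𝔞 β`, times `l`, lie in the order. -/
theorem cubic_product_mem {a b c d p m r : K} (ha : a ∈ (𝔞 : FractionalIdeal R⁰ K))
    (hb : b ∈ (1 : FractionalIdeal R⁰ K))
    (hc : c ∈ ((𝔞⁻¹ : (FractionalIdeal R⁰ K)ˣ) : FractionalIdeal R⁰ K))
    (hd : d ∈ ((𝔞⁻¹ ^ 2 : (FractionalIdeal R⁰ K)ˣ) : FractionalIdeal R⁰ K))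
    (hp : p ∈ (1 : FractionalIdeal R⁰ K))
    (hm : m ∈ ((𝔞⁻¹ : (FractionalIdeal R⁰ K)ˣ) : FractionalIdeal R⁰ K))
    (hr : r ∈ ((𝔞⁻¹ ^ 2 : (FractionalIdeal R⁰ K)ˣ) : FractionalIdeal R⁰ K))
    {α β l : QuadraticAlgebra K (-(p * r)) m}
    (h3 : α ^ 3 * l = ⟨p * b - a * m, a⟩) (h2 : α ^ 2 * β * l = ⟨-(a * r), b⟩)
    (h1 : α * β ^ 2 * l = ⟨-(b * r), c⟩) (h0 : β ^ 3 * l = ⟨-(c * r), d⟩)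
    {x y x' y' x'' y'' : K} (hx : x ∈ (1 : FractionalIdeal R⁰ K))
    (hy : y ∈ (𝔞 : FractionalIdeal R⁰ K)) (hx' : x' ∈ (1 : FractionalIdeal R⁰ K))
    (hy' : y' ∈ (𝔞 : FractionalIdeal R⁰ K)) (hx'' : x'' ∈ (1 : FractionalIdeal R⁰ K))
    (hy'' : y'' ∈ (𝔞 : FractionalIdeal R⁰ K)) :
    ((x • α + y • β) * (x' • α + y' • β) * (x'' • α + y'' • β) * l).re ∈
        (1 : FractionalIdeal R⁰ K) ∧
      ((x • α + y • β) * (x' • α + y' • β) * (x'' • α + y'' • β) * l).im ∈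
        (𝔞 : FractionalIdeal R⁰ K) := by
  have e1 : (1 : FractionalIdeal R⁰ K) = ((𝔞 ^ (0 : ℤ) : (FractionalIdeal R⁰ K)ˣ) : _) := by simp
  have e2 : (𝔞 : FractionalIdeal R⁰ K) = ((𝔞 ^ (1 : ℤ) : (FractionalIdeal R⁰ K)ˣ) : _) := by simp
  have e3 : ((𝔞⁻¹ : (FractionalIdeal R⁰ K)ˣ) : FractionalIdeal R⁰ K) =
    ((𝔞 ^ (-1 : ℤ) : (FractionalIdeal R⁰ K)ˣ) : _) := by simp
  have e4 : ((𝔞⁻¹ ^ 2 : (FractionalIdeal R⁰ K)ˣ) : FractionalIdeal R⁰ K) =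
    ((𝔞 ^ (-2 : ℤ) : (FractionalIdeal R⁰ K)ˣ) : _) := by
    rw [zpow_neg, inv_pow]
    rfl
  have hprod : (x • α + y • β) * (x' • α + y' • β) * (x'' • α + y'' • β) * l =
      (x * x' * x'') • (α ^ 3 * l) +
      ((x * x' * y'' + x * y' * x'' + y * x' * x'') • (α ^ 2 * β * l) +
      ((x * y' * y'' + y * x' * y'' + y * y' * x'') • (α * β ^ 2 * l) +
      (y * y' * y'') • (β ^ 3 * l))) := by
    simp only [Algebra.smul_def, map_mul, map_add]
    ring
  rw [hprod, h3, h2, h1, h0]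
  simp only [QuadraticAlgebra.re_add, QuadraticAlgebra.im_add, QuadraticAlgebra.re_smul,
    QuadraticAlgebra.im_smul, smul_eq_mul]
  rw [e3] at hc hm
  rw [e4] at hd hr
  rw [e2] at ha hy hy' hy''
  rw [e1] at hb hp hx hx' hx''
  have w1 : x * x' * x'' ∈ ((𝔞 ^ (0 : ℤ) : (FractionalIdeal R⁰ K)ˣ) : FractionalIdeal R⁰ K) :=
    zpow_mul_mem (zpow_mul_mem hx hx' rfl) hx'' rfl
  have w2 : x * x' * y'' + x * y' * x'' + y * x' * x'' ∈
      ((𝔞 ^ (1 : ℤ) : (FractionalIdeal R⁰ K)ˣ) : FractionalIdeal R⁰ K) :=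
    frac_add_mem (frac_add_mem (zpow_mul_mem (zpow_mul_mem hx hx' rfl) hy'' rfl)
      (zpow_mul_mem (zpow_mul_mem hx hy' rfl) hx'' rfl))
      (zpow_mul_mem (zpow_mul_mem hy hx' rfl) hx'' rfl)
  have w3 : x * y' * y'' + y * x' * y'' + y * y' * x'' ∈
      ((𝔞 ^ (2 : ℤ) : (FractionalIdeal R⁰ K)ˣ) : FractionalIdeal R⁰ K) :=
    frac_add_mem (frac_add_mem (zpow_mul_mem (zpow_mul_mem hx hy' rfl) hy'' rfl)
      (zpow_mul_mem (zpow_mul_mem hy hx' rfl) hy'' rfl))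
      (zpow_mul_mem (zpow_mul_mem hy hy' rfl) hx'' rfl)
  have w4 : y * y' * y'' ∈ ((𝔞 ^ (3 : ℤ) : (FractionalIdeal R⁰ K)ˣ) : FractionalIdeal R⁰ K) :=
    zpow_mul_mem (zpow_mul_mem hy hy' rfl) hy'' rfl
  rw [e1, e2]
  refine ⟨frac_add_mem (zpow_mul_mem w1 (frac_sub_mem (zpow_mul_mem hp hb rfl)
      (zpow_mul_mem ha hm rfl)) rfl) (frac_add_mem (zpow_mul_mem w2
      (frac_neg_mem (zpow_mul_mem ha hr rfl)) rfl) (frac_add_mem (zpow_mul_mem w3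
      (frac_neg_mem (zpow_mul_mem hb hr rfl)) rfl) (zpow_mul_mem w4
      (frac_neg_mem (zpow_mul_mem hc hr rfl)) rfl))), ?_⟩
  exact frac_add_mem (zpow_mul_mem w1 ha rfl) (frac_add_mem (zpow_mul_mem w2 hb rfl)
    (frac_add_mem (zpow_mul_mem w3 hc rfl) (zpow_mul_mem w4 hd rfl)))

/-- Take the order R + 𝔞ω and the lattice Rα + 𝔞β of the model algebra. The memberships p ∈ R, m ∈
𝔞⁻¹, r ∈ 𝔞⁻² make them a ring and an ideal, and those of a, b, c, d give I³ ⊆ δS. -/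
theorem exists_quadruple (h3 : (3 : K) ≠ 0) (f : NondegForm 𝔞) :
    ∃ Q : BalancedQuadruple 𝔞, Corresponds f.1 Q := by
  obtain ⟨f, ⟨a, ha, b, hb, c, hc, d, hd, rfl⟩, hdisc⟩ := f
  rw [disc_cubicForm h3] at hdisc
  have hpp := first_covariant_mem ha hb hc
  have hmm := middle_covariant_mem ha hb hc hd
  have hrr := last_covariant_mem hb hc hd
  obtain ⟨p, hp⟩ : ∃ p, p = b ^ 2 - a * c := ⟨_, rfl⟩
  obtain ⟨m, hm⟩ : ∃ m, m = b * c - a * d := ⟨_, rfl⟩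
  obtain ⟨r, hr⟩ : ∃ r, r = c ^ 2 - b * d := ⟨_, rfl⟩
  rw [← hp, ← hm, ← hr] at hdisc
  rw [← hp] at hpp
  rw [← hm] at hmm
  rw [← hr] at hrr
  obtain ⟨q, α, β, l, hq, hdet, hl, hα, hβ, e₃, e₂, e₁, e₀⟩ := exists_model hp hm hr hdisc
  have hA : ∀ s ∈ (𝔞 : FractionalIdeal R⁰ K), ∀ t ∈ (𝔞 : FractionalIdeal R⁰ K),
      -(p * r) * s * t ∈ (1 : FractionalIdeal R⁰ K) := by
    intro s hs t ht
    have := frac_neg_mem (mul_mem_of_eq (one_mul _) hpp (mul_inv_mem (mul_inv_sq_mem hrr hs) ht))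
    convert this using 1
    ring
  have hT := modelOrder_decomp hA hmm
  have hLL : Module.finrank K (QuadraticAlgebra K (-(p * r)) m) = 2 :=
    QuadraticAlgebra.finrank_eq_two _ _
  obtain ⟨S, _, _, hfin, htf, e, he⟩ := exists_ring_of_subalgebra (modelOrder 𝔞 hA hmm) hT.fg
    (hT.span_eq_top hLL)
  have hL : Module.finrank K (K ⊗[R] S) = 2 := by rw [e.toLinearEquiv.finrank_eq, hLL]
  have hring : IsSteinitzDecomp (ringLattice R K S) ![1, 𝔞]
      ![1, e.symm QuadraticAlgebra.omega] := by
    have h1 := hT.map e.symm.toLinearMap e.symm.injective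
    have h2 : ringLattice R K S = (Subalgebra.toSubmodule (modelOrder 𝔞 hA hmm)).map
        (e.symm.toLinearMap.restrictScalars R) := by
      ext x
      rw [he]
      constructor
      · intro hx
        exact ⟨e x, hx, e.symm_apply_apply x⟩
      · rintro ⟨y, hy, rfl⟩
        change e (e.symm y) ∈ _
        rwa [e.apply_symm_apply]
    have h4 : ![1, e.symm QuadraticAlgebra.omega] =
        e.symm.toLinearMap ∘ ![1, QuadraticAlgebra.omega] := by
      funext i
      fin_cases i
      · exact (map_one e.symm).symm
      · rfl
    rw [h2, h4]
    exact h1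
  obtain ⟨π, hπ⟩ := exists_alt_eq_one hL hring.1
  have hπe : ∀ x y, π ![e.symm x, e.symm y] = x.re * y.im - x.im * y.re := by
    have hx : ∀ x, e.symm x = x.re • 1 + x.im • e.symm QuadraticAlgebra.omega := by
      intro x
      rw [← map_one e.symm, ← map_smul, ← map_smul, ← map_add]
      congr 1
      ext <;> simp [QuadraticAlgebra.re_one, QuadraticAlgebra.im_one, QuadraticAlgebra.omega_re,
        QuadraticAlgebra.omega_im]
    intro x y
    rw [hx x, hx y, alt_comb, hπ, mul_one]
  have hπ1 : ∀ y, π ![1, e.symm y] = y.im := by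
    intro y
    rw [← map_one e.symm, hπe]
    simp [QuadraticAlgebra.re_one, QuadraticAlgebra.im_one]
  have hs : π ![e.symm α, e.symm β] = q := by rw [hπe, hdet]
  have hI := pairLattice_decomp (𝔞 := 𝔞)
    (linearIndependent_of_alt_ne_zero π (v := e.symm α) (w := e.symm β) (by rwa [hs]))
  have hθα : e.symm QuadraticAlgebra.omega * e.symm α = p • e.symm β := by
    rw [← map_mul, hα, map_smul]
  have hθβ : e.symm QuadraticAlgebra.omega * e.symm β = m • e.symm β - r • e.symm α := by
    rw [← map_mul, hβ, map_sub, map_smul, map_smul]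
  have hlu : IsUnit l := by
    refine QuadraticAlgebra.isUnit_iff_norm_isUnit.2 (isUnit_iff_ne_zero.2 fun h => ?_)
    rw [h, mul_zero] at hl
    exact zero_ne_one hl
  obtain ⟨lu, rfl⟩ := hlu
  set μ : (K ⊗[R] S)ˣ := Units.map (e.symm : _ →* K ⊗[R] S) lu with hμ
  have hμv : (μ : K ⊗[R] S) = e.symm lu.val := rfl
  let Q : BalancedQuadruple 𝔞 :=
    { S := S
      finite := hfin
      torsionFree := htf
      rank_eq_two := hL
      nondegenerate := by
        refine (traceForm_nondegenerate_iff hL π hπ (A := -(p * r)) (B := m) ?_).2 hdisc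
        rw [← map_mul, QuadraticAlgebra.omega_mul_omega_eq_add, map_add, map_smul, map_smul,
          map_one]
      I := pairLattice 𝔞 (e.symm α) (e.symm β)
      isFracIdeal := by
        refine ⟨fun x y hy => ?_, hI.fg, hI.span_eq_top hL⟩
        obtain ⟨s, hs, t, ht, hst⟩ := (hring.mem_iff _).1 (mem_ringLattice.2 ⟨x, rfl⟩)
        obtain ⟨u, hu, v, hv, rfl⟩ := (hI.mem_iff y).1 hy
        rw [Units.val_one] at hs hu
        refine (hI.mem_iff _).2 ⟨s * u - t * (v * r), ?_, s * v + t * (u * p) + t * m * v, ?_, ?_⟩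
        · rw [Units.val_one]
          exact frac_sub_mem (mul_mem_of_eq (one_mul _) hs hu)
            (mul_inv_mem (mul_inv_sq_mem hrr hv) ht)
        · exact frac_add_mem (frac_add_mem (mul_mem_of_eq (one_mul _) hs hv)
            (mul_mem_of_eq (mul_one _) ht (mul_mem_of_eq (one_mul _) hu hpp)))
            (mul_mem_of_eq (one_mul _) (mul_inv_mem hmm ht) hv)
        · rw [hst, add_mul, smul_one_mul, smul_mul_assoc, mul_add, mul_smul_comm, mul_smul_comm,
            hθα, hθβ]
          module
      -- The model supplies l, which plays the role of δ⁻¹; accordingly s³ = N(δ) is the relation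
      -- q³N(l) = 1.
      δ := μ⁻¹
      s := Units.mk0 q hq
      steinitz_ring := ⟨2, _, _, hring, by simp⟩
      steinitz_ideal := ⟨2, _, _, hI, by simp⟩
      cube_le := by
        rw [pow_succ, pow_two, Submodule.mul_le]
        intro z hz k hk
        refine Submodule.mul_induction_on hz ?_ ?_
        · intro i hi j hj
          obtain ⟨x, hx, y, hy, rfl⟩ := (hI.mem_iff i).1 hi
          obtain ⟨x', hx', y', hy', rfl⟩ := (hI.mem_iff j).1 hj
          obtain ⟨x'', hx'', y'', hy'', rfl⟩ := (hI.mem_iff k).1 hk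
          rw [Units.val_one] at hx hx' hx''
          refine ⟨_, (he (e.symm ((x • α + y • β) * (x' • α + y' • β) * (x'' • α + y'' • β) *
            lu.val))).2 ?_, ?_⟩
          · rw [e.apply_symm_apply]
            exact cubic_product_mem ha hb hc hd hpp hmm hrr e₃ e₂ e₁ e₀ hx hy hx' hy' hx'' hy''
          · rw [LinearMap.mulLeft_apply, map_mul, ← hμv, mul_left_comm, Units.inv_mul, mul_one]
            simp only [map_mul, map_add, map_smul]
        · intro x y hx hy
          rw [add_mul]
          exact Submodule.add_mem _ hx hy
      index_eq := by
        rw [moduleIndex_eq π hL hring hI hπ, hs]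
        rfl
      norm_eq := by
        have h1 : Algebra.norm K (μ : K ⊗[R] S) * Algebra.norm K ((μ⁻¹ : (K ⊗[R] S)ˣ) : K ⊗[R] S) =
            1 := by
          rw [← map_mul, Units.mul_inv, map_one]
        rw [hμv, Algebra.norm_eq_of_algEquiv, QuadraticAlgebra.algebraNorm_eq] at h1
        have h2 : (lu.val).norm ≠ 0 := left_ne_zero_of_mul_eq_one h1
        rw [Units.val_mk0]
        apply mul_right_cancel₀ h2
        rw [hl, mul_comm, h1] }
  refine ⟨Q, π, e.symm α, e.symm β, isOrientation_of_alt_eq_one hring hπ, hI, hs, ?_⟩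
  have hδ : (Q.δ⁻¹).val = e.symm lu.val := by
    change ((μ⁻¹)⁻¹).val = _
    rw [inv_inv, hμv]
  have c₃ : π ![1, e.symm α ^ 3 * (Q.δ⁻¹).val] = a := by
    rw [hδ, ← map_pow, ← map_mul, hπ1, e₃]
  have c₂ : π ![1, e.symm α ^ 2 * e.symm β * (Q.δ⁻¹).val] = b := by
    rw [hδ, ← map_pow, ← map_mul, ← map_mul, hπ1, e₂]
  have c₁ : π ![1, e.symm α * e.symm β ^ 2 * (Q.δ⁻¹).val] = c := by
    rw [hδ, ← map_pow, ← map_mul, ← map_mul, hπ1, e₁]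
  have c₀ : π ![1, e.symm β ^ 3 * (Q.δ⁻¹).val] = d := by
    rw [hδ, ← map_pow, ← map_mul, hπ1, e₀]
  exact (congr (congr (congr (congrArg cubicForm c₃) c₂) c₁) c₀).symm

end Existence

end

end TripSymCubic

end

/-! ### Assembly of the bijection -/

theorem theorem1p1 {R : Type u} [CommRing R] [IsDedekindDomain R]
    {K : Type v} [Field K] [Algebra R K] [IsFractionRing R K]
    (hR : ringChar R ≠ 3) (𝔞 : (FractionalIdeal R⁰ K)ˣ) :
    ∃ Φ : Quotient (TripSymCubic.generalEquivalence 𝔞) ≃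
        Quotient (TripSymCubic.orbitRelation 𝔞),
      ∀ (Q : TripSymCubic.BalancedQuadruple 𝔞) (f : TripSymCubic.NondegForm 𝔞),
        (Φ (Quotient.mk _ Q) = Quotient.mk _ f ↔ TripSymCubic.Corresponds f.1 Q) ∧
        (Φ (Quotient.mk _ Q) = Quotient.mk _ f →
          TripSymCubic.IsDiscriminantIdeal Q.S
            (FractionalIdeal.spanSingleton R⁰ (TripSymCubic.disc f.1) *
              (𝔞 : FractionalIdeal R⁰ K) ^ 2) ∧
          (TripSymCubic.IsProjectiveForm 𝔞 f.1 ↔ TripSymCubic.IsInvertibleIdeal Q.I)) := by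
  have h3 : (3 : K) ≠ 0 := TripSymCubic.three_ne_zero_of_ringChar hR
  choose F hF using TripSymCubic.exists_corresponds (𝔞 := 𝔞) h3
  -- The forms corresponding to Q are exactly one orbit, so the choice of F Q is immaterial and Φ
  -- has the stated characterization.
  have hFf : ∀ (Q : TripSymCubic.BalancedQuadruple 𝔞) (f : TripSymCubic.NondegForm 𝔞),
      (Quotient.mk (TripSymCubic.orbitRelation 𝔞) (F Q) = Quotient.mk _ f ↔
        TripSymCubic.Corresponds f.1 Q) := by
    intro Q f
    rw [Quotient.eq]
    constructor
    · rintro ⟨g, hg, hgf⟩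
      rw [hgf]
      exact (hF Q).act hg
    · intro h
      exact (hF Q).exists_act_eq h
  let Φ : Quotient (TripSymCubic.generalEquivalence 𝔞) → Quotient (TripSymCubic.orbitRelation 𝔞) :=
    Quotient.lift (fun Q => Quotient.mk _ (F Q)) fun Q Q' h =>
      (hFf Q (F Q')).2 ((hF Q').of_genEquivalent (TripSymCubic.genEquivalent_symm h))
  have hΦ : Function.Bijective Φ := by
    constructor
    · rintro ⟨Q⟩ ⟨Q'⟩ h
      exact Quotient.sound (((hFf Q (F Q')).1 h).genEquivalent h3 (hF Q'))
    · rintro ⟨f⟩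
      obtain ⟨Q, hQ⟩ := TripSymCubic.exists_quadruple h3 f
      exact ⟨Quotient.mk _ Q, (hFf Q f).2 hQ⟩
  refine ⟨Equiv.ofBijective Φ hΦ, fun Q f => ⟨hFf Q f, fun h => ?_⟩⟩
  have hc := (hFf Q f).1 h
  exact ⟨hc.isDiscriminantIdeal h3, hc.isInvertible_of_isProjective,
    hc.isProjective_of_isInvertible h3⟩
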